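/- Let $n\ge 2$ and $N\ge 1$ be integers, let $p_1,p_2,q_1,q_2\in[1,\infty]$ and $s_1,s_2\in\mathbb R$, and put $\sigma=2-\frac{n-1}{2}N$. The spherical average is $A_1f(x)=\int_{\mathbb S^{n-1}}f(x-y')\,d\omega(y')$, where $d\omega(y')$ is the normalized surface measure on the unit sphere of $\mathbb R^n$. It is defined in this way on Schwartz functions and extended to tempered distributions by duality, $\langle A_1f,g\rangle=\langle f,A_1g\rangle$. The operator $\Delta(A_1)^N$ is the Laplacian applied to the $N$-th iterate of $A_1$, acting on $\mathcal S'(\mathbb R^n)$. Let $\varphi\in C_c^\infty(\mathbb R^n)$ be such that $\sum_{k\in\mathbb Z^n}\varphi(\xi-k)=1$ for every $\xi\in\mathbb R^n$, let $\Box_k=\mathcal F^{-1}\varphi(\cdot-k)\mathcal F$ (with $\mathcal Ff(\xi)=\int f(x)e^{-ix\cdot\xi}\,dx$) and $\langle k\rangle=(1+|k|^2)^{1/2}$. The modulation space $M^s_{p,q}(\mathbb R^n)$ is the set of all $f\in\mathcal S'(\mathbb R^n)$ with $$\|f\|_{M^s_{p,q}}=\Big(\sum_{k\in\mathbb Z^n}\langle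 k\rangle^{sq}\|\Box_kf\|_{L^p(\mathbb R^n)}^q\Big)^{1/q}<\infty,$$ with the supremum over $k$ in place of the sum when $q=\infty$. An operator $T$ is bounded from $M^{s_1}_{p_1,q_1}$ to $M^{s_2}_{p_2,q_2}$ if it maps the first space into the second and there is a constant $C$ with $\|Tf\|_{M^{s_2}_{p_2,q_2}}\le C\|f\|_{M^{s_1}_{p_1,q_1}}$ for all $f\in M^{s_1}_{p_1,q_1}$. Then, with $n/\infty=0$ and for every such $\varphi$: (i) If $q_1\le q_2$, then $\Delta(A_1)^N$ is bounded from $M^{s_1}_{p_1,q_1}(\mathbb R^n)$ to $M^{s_2}_{p_2,q_2}(\mathbb R^n)$ if and only if $p_1\le p_2$ and $s_1\ge s_2+\sigma$. (ii) If $q_1>q_2$, then $\Delta(A_1)^N$ is bounded from $M^{s_1}_{p_1,q_1}(\mathbb R^n)$ to $M^{s_2}_{p_2,q_2}(\mathbb R^n)$ if and only if $p_1\le p_2$ and $s_1+\frac n{q_1}>s_2+\sigma+\frac n{q_2}$. -/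

import Mathlib

open MeasureTheory SchwartzMap
open scoped ENNReal NNReal ContDiff FourierTransform Laplacian

noncomputable section

namespace SphericalModulation

/-- Euclidean space `ℝⁿ`. -/
abbrev E (n : ℕ) : Type := EuclideanSpace ℝ (Fin n)

/-! ### The spherical average -/

/-- The normalized surface measure on the unit sphere of `ℝⁿ`. -/
def sphereMeasure (n : ℕ) : Measure (Metric.sphere (0 : E n) 1) :=
  ((volume : Measure (E n)).toSphere Set.univ)⁻¹ • (volume : Measure (E n)).toSphere

instance instIsFiniteMeasureSphereMeasure (n : ℕ) : IsFiniteMeasure (sphereMeasure n) where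
  measure_univ_lt_top := by
    simp only [sphereMeasure, Measure.smul_apply, smul_eq_mul]
    exact (ENNReal.inv_mul_le_one _).trans_lt ENNReal.one_lt_top

theorem sphereMeasure_real_univ_le (n : ℕ) : (sphereMeasure n).real Set.univ ≤ 1 := by
  refine ENNReal.toReal_le_of_le_ofReal zero_le_one ?_
  simp only [sphereMeasure, Measure.smul_apply, smul_eq_mul, ENNReal.ofReal_one]
  exact ENNReal.inv_mul_le_one _

/-- The spherical average `A₁ f (x) = ∫_{S^{n-1}} f (x - y) dσ(y)` of a function. -/
def sphericalAverage {n : ℕ} {F : Type} [NormedAddCommGroup F] [NormedSpace ℝ F]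
    (f : E n → F) (x : E n) : F :=
  ∫ y, f (x - (y : E n)) ∂(sphereMeasure n)

section Schwartz

variable {n : ℕ} {F : Type} [NormedAddCommGroup F] [NormedSpace ℝ F]

theorem integrable_translate (f : 𝓢(E n, F)) (x : E n) :
    Integrable (fun y : Metric.sphere (0 : E n) 1 => f (x - (y : E n))) (sphereMeasure n) := by
  have hc : Continuous (fun y : Metric.sphere (0 : E n) 1 => f (x - (y : E n))) :=
    f.continuous.comp (by fun_prop)
  refine Integrable.of_bound hc.aestronglyMeasurable (SchwartzMap.seminorm ℝ 0 0 f) ?_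
  exact Filter.Eventually.of_forall fun y => norm_le_seminorm ℝ f _

theorem hasFDerivAt_sphericalAverage (f : 𝓢(E n, F)) (x : E n) :
    HasFDerivAt (sphericalAverage f) (sphericalAverage (fderivCLM ℝ (E n) F f) x) x := by
  refine hasFDerivAt_integral_of_dominated_of_fderiv_le (s := Set.univ)
    (F' := fun (z : E n) (y : Metric.sphere (0 : E n) 1) => fderivCLM ℝ (E n) F f (z - (y : E n)))
    (bound := fun _ => SchwartzMap.seminorm ℝ 0 0 (fderivCLM ℝ (E n) F f))
    Filter.univ_mem ?_ (integrable_translate f x)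
    (integrable_translate (fderivCLM ℝ (E n) F f) x).aestronglyMeasurable ?_
    (integrable_const _) ?_
  · exact Filter.Eventually.of_forall fun z => (integrable_translate f z).aestronglyMeasurable
  · exact Filter.Eventually.of_forall fun y z _ => norm_le_seminorm ℝ _ _
  · refine Filter.Eventually.of_forall fun y z _ => ?_
    have h := (f.differentiableAt (x := z - (y : E n))).hasFDerivAt.comp z
      ((hasFDerivAt_id z).sub_const (y : E n))
    simpa [Function.comp_def] using h

theorem fderiv_sphericalAverage (f : 𝓢(E n, F)) :
    fderiv ℝ (sphericalAverage f) = sphericalAverage (fderivCLM ℝ (E n) F f) :=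
  funext fun x => (hasFDerivAt_sphericalAverage f x).fderiv

theorem contDiff_sphericalAverage_nat (m : ℕ) :
    ∀ {F : Type} [NormedAddCommGroup F] [NormedSpace ℝ F] (f : 𝓢(E n, F)),
      ContDiff ℝ m (sphericalAverage f) := by
  induction m with
  | zero =>
    intro F _ _ f
    have hd : Differentiable ℝ (sphericalAverage f) :=
      fun x => (hasFDerivAt_sphericalAverage f x).differentiableAt
    simpa using hd.continuous
  | succ m ih =>
    intro F _ _ f
    have h := ih (fderivCLM ℝ (E n) F f)
    rw [← fderiv_sphericalAverage] at h
    push_cast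
    refine contDiff_succ_iff_fderiv.2 ⟨fun x => (hasFDerivAt_sphericalAverage f x).differentiableAt,
      by simp, h⟩

theorem contDiff_sphericalAverage (f : 𝓢(E n, F)) : ContDiff ℝ ∞ (sphericalAverage f) :=
  contDiff_infty.2 fun m => contDiff_sphericalAverage_nat m f

theorem norm_pow_mul_sphericalAverage_le (k : ℕ) (f : E n → F) (B C : ℝ)
    (hB : ∀ x, ‖f x‖ ≤ B) (hC : ∀ x, ‖x‖ ^ k * ‖f x‖ ≤ C) (x : E n) :
    ‖x‖ ^ k * ‖sphericalAverage f x‖ ≤ 2 ^ k * (C + B) := by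
  have hB0 : 0 ≤ B := (norm_nonneg _).trans (hB 0)
  have hC0 : 0 ≤ C := le_trans (by positivity) (hC 0)
  have hpt : ∀ y : Metric.sphere (0 : E n) 1,
      ‖(‖x‖ ^ k) • f (x - (y : E n))‖ ≤ 2 ^ k * (C + B) := by
    intro y
    have hy : ‖(y : E n)‖ = 1 := by simp
    have h1 : ‖x‖ ≤ ‖x - (y : E n)‖ + 1 := by
      have := norm_add_le (x - (y : E n)) (y : E n)
      rwa [sub_add_cancel, hy] at this
    have h2 : ‖x‖ ^ k ≤ 2 ^ k * (‖x - (y : E n)‖ ^ k + 1) := by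
      calc ‖x‖ ^ k ≤ (‖x - (y : E n)‖ + 1) ^ k := by gcongr
        _ ≤ (2 * max ‖x - (y : E n)‖ 1) ^ k := by
            gcongr
            have := le_max_left ‖x - (y : E n)‖ 1
            have := le_max_right ‖x - (y : E n)‖ 1
            linarith
        _ = 2 ^ k * (max ‖x - (y : E n)‖ 1) ^ k := mul_pow _ _ _
        _ ≤ 2 ^ k * (‖x - (y : E n)‖ ^ k + 1) := by
            gcongr
            rcases max_cases ‖x - (y : E n)‖ 1 with h | h
            · rw [h.1]; linarith
            · rw [h.1, one_pow]
              have : 0 ≤ ‖x - (y : E n)‖ ^ k := by positivity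
              linarith
    rw [norm_smul, norm_pow, norm_norm]
    calc ‖x‖ ^ k * ‖f (x - (y : E n))‖
        ≤ 2 ^ k * (‖x - (y : E n)‖ ^ k + 1) * ‖f (x - (y : E n))‖ := by gcongr
      _ = 2 ^ k * (‖x - (y : E n)‖ ^ k * ‖f (x - (y : E n))‖ + ‖f (x - (y : E n))‖) := by ring
      _ ≤ 2 ^ k * (C + B) := by
            gcongr
            · exact hC _
            · exact hB _
  have hint : ‖∫ y : Metric.sphere (0 : E n) 1, (‖x‖ ^ k) • f (x - (y : E n)) ∂(sphereMeasure n)‖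
      ≤ 2 ^ k * (C + B) * (sphereMeasure n).real Set.univ :=
    norm_integral_le_of_norm_le_const (Filter.Eventually.of_forall hpt)
  rw [integral_smul, norm_smul, norm_pow, norm_norm] at hint
  refine hint.trans ?_
  exact mul_le_of_le_one_right (by positivity) (sphereMeasure_real_univ_le n)

theorem iteratedFDeriv_sphericalAverage_le (k m : ℕ) :
    ∀ {F : Type} [NormedAddCommGroup F] [NormedSpace ℝ F] (f : 𝓢(E n, F)) (x : E n),
      ‖x‖ ^ k * ‖iteratedFDeriv ℝ m (sphericalAverage f) x‖ ≤
        2 ^ k * (SchwartzMap.seminorm ℝ k m f + SchwartzMap.seminorm ℝ 0 m f) := by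
  induction m with
  | zero =>
    intro F _ _ f x
    rw [norm_iteratedFDeriv_zero]
    exact norm_pow_mul_sphericalAverage_le k f _ _ (fun x => norm_le_seminorm ℝ f x)
      (fun x => norm_pow_mul_le_seminorm ℝ f k x) x
  | succ m ih =>
    intro F _ _ f x
    have key : ∀ j, SchwartzMap.seminorm ℝ j m (fderivCLM ℝ (E n) F f) ≤
        SchwartzMap.seminorm ℝ j (m + 1) f := by
      intro j
      refine seminorm_le_bound ℝ j m _ (apply_nonneg _ _) fun x => ?_
      have : (fderivCLM ℝ (E n) F f : E n → _) = fderiv ℝ f := rfl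
      rw [this, norm_iteratedFDeriv_fderiv]
      exact le_seminorm ℝ j (m + 1) f x
    have h := ih (fderivCLM ℝ (E n) F f) x
    rw [← fderiv_sphericalAverage, norm_iteratedFDeriv_fderiv] at h
    refine h.trans ?_
    gcongr <;> exact key _

/-- The spherical average as a continuous linear operator on Schwartz functions. -/
def sphericalAverageSchwartz (n : ℕ) : 𝓢(E n, ℂ) →L[ℂ] 𝓢(E n, ℂ) :=
  SchwartzMap.mkCLM (fun f => sphericalAverage f)
    (fun f g x => by
      simp only [sphericalAverage, add_apply]
      exact integral_add (integrable_translate f x) (integrable_translate g x))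
    (fun a f x => by
      simp only [sphericalAverage, smul_apply, RingHom.id_apply]
      exact integral_smul a _)
    contDiff_sphericalAverage
    (fun ⟨k, m⟩ => by
      refine ⟨{(k, m), (0, m)}, 2 ^ k * 2, by positivity, fun f x => ?_⟩
      refine (iteratedFDeriv_sphericalAverage_le k m f x).trans ?_
      have h1 : SchwartzMap.seminorm ℂ k m f ≤
          (({(k, m), (0, m)} : Finset (ℕ × ℕ)).sup (schwartzSeminormFamily ℂ (E n) ℂ)) f :=
        Seminorm.le_def.1 (Finset.le_sup (f := schwartzSeminormFamily ℂ (E n) ℂ)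
          (b := (k, m)) (by simp)) f
      have h2 : SchwartzMap.seminorm ℂ 0 m f ≤
          (({(k, m), (0, m)} : Finset (ℕ × ℕ)).sup (schwartzSeminormFamily ℂ (E n) ℂ)) f :=
        Seminorm.le_def.1 (Finset.le_sup (f := schwartzSeminormFamily ℂ (E n) ℂ)
          (b := (0, m)) (by simp)) f
      have e : ∀ j, SchwartzMap.seminorm ℝ j m f = SchwartzMap.seminorm ℂ j m f := fun j => rfl
      rw [e, e, mul_assoc]
      gcongr
      linarith)

theorem sphericalAverageSchwartz_apply (f : 𝓢(E n, ℂ)) (x : E n) :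
    sphericalAverageSchwartz n f x = ∫ y, f (x - (y : E n)) ∂(sphereMeasure n) := rfl

end Schwartz

/-- The spherical average `A₁` on tempered distributions, by duality. The surface measure is
invariant under `y ↦ -y`, so `A₁` is its own transpose: `⟨A₁ f, g⟩ = ⟨f, A₁ g⟩`. -/
def sphericalAverageDistribution (n : ℕ) : 𝓢'(E n, ℂ) →L[ℂ] 𝓢'(E n, ℂ) :=
  PointwiseConvergenceCLM.precomp _ (sphericalAverageSchwartz n)

/-- The operator `Δ (A₁)^N` on tempered distributions. -/
def laplacianIteratedAverage (n N : ℕ) (f : 𝓢'(E n, ℂ)) : 𝓢'(E n, ℂ) :=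
  Δ ((sphericalAverageDistribution n)^[N] f)

/-! ### Modulation spaces -/

/-- An integer vector, viewed in `ℝⁿ`. -/
def latticePoint {n : ℕ} (k : Fin n → ℤ) : E n := WithLp.toLp 2 fun i => (k i : ℝ)

/-- `φ` is smooth with compact support and its integer translates form a partition of unity. -/
structure IsPartitionWindow {n : ℕ} (φ : E n → ℂ) : Prop where
  smooth : ContDiff ℝ ∞ φ
  compactSupport : HasCompactSupport φ
  partition : ∀ ξ : E n, HasSum (fun k : Fin n → ℤ => φ (ξ - latticePoint k)) 1

/-- The frequency-uniform decomposition operator `□_k = 𝓕⁻¹ φ(· - k) 𝓕`, where `𝓕` is taken with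
the kernel `e^{-i x·ξ}`. Mathlib's Fourier transform has the kernel `e^{-2πi x·ξ}`, which turns the
symbol `φ(ξ - k)` into `φ(2πξ - k)`. -/
def box {n : ℕ} (φ : E n → ℂ) (k : Fin n → ℤ) : 𝓢'(E n, ℂ) →L[ℂ] 𝓢'(E n, ℂ) :=
  TemperedDistribution.fourierMultiplierCLM ℂ
    fun ξ : E n => φ ((2 * Real.pi) • ξ - latticePoint k)

/-- The `L^p` norm, `1 ≤ p ≤ ∞`, of a tempered distribution: it is `‖g‖_p` if the distribution is
given by a (necessarily a.e. unique) function `g ∈ L^p`, and `∞` if there is no such `g`. -/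
def distLpNorm {n : ℕ} (p : ℝ≥0∞) (u : 𝓢'(E n, ℂ)) : ℝ≥0∞ :=
  ⨅ (g : E n → ℂ) (_ : MemLp g p volume) (_ : ∀ ψ : 𝓢(E n, ℂ), u ψ = ∫ x, g x * ψ x),
    eLpNorm g p volume

/-- The Japanese bracket `⟨k⟩ = (1 + |k|²)^{1/2}`. -/
def bracket {n : ℕ} (k : Fin n → ℤ) : ℝ := √(1 + ‖latticePoint k‖ ^ 2)

/-- The norm of the modulation space `M^s_{p,q}(ℝⁿ)`, with values in `[0, ∞]`. -/
def modulationNorm {n : ℕ} (φ : E n → ℂ) (s : ℝ) (p q : ℝ≥0∞) (f : 𝓢'(E n, ℂ)) : ℝ≥0∞ :=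
  if q = ⊤ then
    ⨆ k : Fin n → ℤ, ENNReal.ofReal (bracket k ^ s) * distLpNorm p (box φ k f)
  else
    (∑' k : Fin n → ℤ,
      (ENNReal.ofReal (bracket k ^ s) * distLpNorm p (box φ k f)) ^ q.toReal) ^ (1 / q.toReal)

/-- The modulation space `M^s_{p,q}(ℝⁿ)`. -/
def modulationSpace {n : ℕ} (φ : E n → ℂ) (s : ℝ) (p q : ℝ≥0∞) : Set 𝓢'(E n, ℂ) :=
  {f | modulationNorm φ s p q f < ⊤}

/-- `T` maps `M^{s₁}_{p₁,q₁}` boundedly into `M^{s₂}_{p₂,q₂}`. -/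
def IsBoundedOnModulation {n : ℕ} (φ : E n → ℂ) (s₁ : ℝ) (p₁ q₁ : ℝ≥0∞) (s₂ : ℝ) (p₂ q₂ : ℝ≥0∞)
    (T : 𝓢'(E n, ℂ) → 𝓢'(E n, ℂ)) : Prop :=
  ∃ C : ℝ≥0, ∀ f ∈ modulationSpace φ s₁ p₁ q₁,
    T f ∈ modulationSpace φ s₂ p₂ q₂ ∧
      modulationNorm φ s₂ p₂ q₂ (T f) ≤ C * modulationNorm φ s₁ p₁ q₁ f

end SphericalModulation

end

/-!
The operator `Δ (A₁)^N` is the Fourier multiplier with symbol `-|η|² m(η)^N`, where `m` is the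
Fourier transform of the surface measure of the sphere. The function `m` is radial, and the
Liouville normal form of its radial equation is a perturbed harmonic oscillator, so an energy
estimate gives `|m(η)| ≲ ⟨η⟩^(-(n-1)/2)` together with a matching lower bound within unit
distance of every large frequency. Since the measure has compact support, `m` is reproduced by
convolution with a Schwartz function, so all its derivatives obey the same upper bound. Hence
the symbol is of order exactly `σ`.

On the frequency piece `□_k` such a multiplier acts like multiplication by `⟨k⟩^σ`, uniformly in
`k`, which reduces sufficiency to Bernstein's inequality and embeddings of weighted `ℓ^q`
spaces. For necessity, test on sums of wave packets placed at frequencies where the symbol is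
large. Dilating a packet forces `p₁ ≤ p₂`, moving it to high frequencies gives the smoothness
condition, and placing packets near a lattice of well separated frequencies, with the
coefficients extremal for Hölder's inequality, turns failure of the strict condition into
divergence of `∑ ⟨k⟩^(-n)`.
-/

noncomputable section

namespace SphericalModulation

/-! ### The surface measure of the sphere -/

section Sphere

variable {n : ℕ}

/-- A linear isometry of `ℝⁿ`, restricted to the unit sphere. -/
def sphereIsometry (U : E n ≃ₗᵢ[ℝ] E n) (y : Metric.sphere (0 : E n) 1) :
    Metric.sphere (0 : E n) 1 :=
  ⟨U y, by simp⟩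

theorem continuous_sphereIsometry (U : E n ≃ₗᵢ[ℝ] E n) : Continuous (sphereIsometry U) :=
  Continuous.subtype_mk (U.continuous.comp continuous_subtype_val) _

open scoped Pointwise in
theorem Ioo_smul_image_preimage_sphereIsometry (U : E n ≃ₗᵢ[ℝ] E n)
    (s : Set (Metric.sphere (0 : E n) 1)) :
    Set.Ioo (0 : ℝ) 1 • ((↑) '' (sphereIsometry U ⁻¹' s) : Set (E n)) =
      U ⁻¹' (Set.Ioo (0 : ℝ) 1 • ((↑) '' s : Set (E n))) := by
  ext x
  simp only [Set.mem_smul, Set.mem_image, Set.mem_preimage]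
  constructor
  · rintro ⟨r, hr, _, ⟨y, hy, rfl⟩, rfl⟩
    exact ⟨r, hr, _, ⟨_, hy, rfl⟩, by simp [sphereIsometry]⟩
  · rintro ⟨r, hr, _, ⟨y, hy, rfl⟩, hx⟩
    refine ⟨r, hr, U.symm y, ⟨⟨U.symm y, by simp⟩, ?_, rfl⟩, ?_⟩
    · convert hy
      exact Subtype.ext (U.apply_symm_apply _)
    · rw [← U.symm.map_smul, hx, U.symm_apply_apply]

theorem measurePreserving_sphereIsometry (U : E n ≃ₗᵢ[ℝ] E n) :
    MeasurePreserving (sphereIsometry U) (sphereMeasure n) (sphereMeasure n) := by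
  have hm : Measurable (sphereIsometry U) := (continuous_sphereIsometry U).measurable
  refine ⟨hm, ?_⟩
  rw [sphereMeasure, Measure.map_smul]
  congr 1
  ext s hs
  rw [Measure.map_apply hm hs, Measure.toSphere_apply' _ hs, Measure.toSphere_apply' _ (hm hs),
    Ioo_smul_image_preimage_sphereIsometry]
  congr 1
  exact U.measurePreserving.measure_preimage_equiv (f := U.toMeasurableEquiv) _

theorem integral_sphere_comp_isometry {F : Type*} [NormedAddCommGroup F] [NormedSpace ℝ F]
    (U : E n ≃ₗᵢ[ℝ] E n) {f : E n → F} (hf : Continuous f) :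
    ∫ y, f (U (y : E n)) ∂sphereMeasure n = ∫ y, f (y : E n) ∂sphereMeasure n := by
  conv_rhs => rw [← (measurePreserving_sphereIsometry U).map_eq]
  exact (integral_map (f := fun y : Metric.sphere (0 : E n) 1 => f y)
    (continuous_sphereIsometry U).measurable.aemeasurable
    (hf.comp continuous_subtype_val).aestronglyMeasurable).symm

theorem isProbabilityMeasure_sphereMeasure (hn : 1 ≤ n) :
    IsProbabilityMeasure (sphereMeasure n) := by
  have : Nonempty (Fin n) := ⟨⟨0, hn⟩⟩
  constructor
  simp only [sphereMeasure, Measure.smul_apply, smul_eq_mul]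
  refine ENNReal.inv_mul_cancel ?_ (measure_ne_top _ _)
  rw [Ne, Measure.measure_univ_eq_zero]
  exact Measure.toSphere_ne_zero _

theorem integrable_sphere {F : Type*} [NormedAddCommGroup F]
    {f : Metric.sphere (0 : E n) 1 → F} (hf : Continuous f) : Integrable f (sphereMeasure n) :=
  hf.integrable_of_hasCompactSupport (HasCompactSupport.of_compactSpace f)

theorem hasDerivAt_integral_of_compactSpace {X : Type*} [TopologicalSpace X] [CompactSpace X]
    [MeasurableSpace X] [OpensMeasurableSpace X] {μ : Measure X} [IsFiniteMeasure μ]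
    {f f' : ℝ → X → ℝ} (hf : ∀ t, Continuous (f t)) (hf' : Continuous (Function.uncurry f'))
    (hd : ∀ t x, HasDerivAt (fun s => f s x) (f' t x) t) (t : ℝ) :
    HasDerivAt (fun s => ∫ x, f s x ∂μ) (∫ x, f' t x ∂μ) t := by
  obtain ⟨C, hC⟩ := ((isCompact_closedBall t 1).prod isCompact_univ).exists_bound_of_continuousOn
    hf'.continuousOn
  have hf't : Continuous (f' t) := hf'.comp (Continuous.prodMk_right t)
  refine (hasDerivAt_integral_of_dominated_loc_of_deriv_le (s := Metric.closedBall t 1)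
    (bound := fun _ => C) (Metric.closedBall_mem_nhds t one_pos) ?_
    ((hf t).integrable_of_hasCompactSupport (HasCompactSupport.of_compactSpace _))
    hf't.aestronglyMeasurable ?_ (integrable_const C) ?_).2
  · exact Filter.Eventually.of_forall fun s => (hf s).aestronglyMeasurable
  · exact Filter.Eventually.of_forall fun x s hs => hC (s, x) ⟨hs, Set.mem_univ x⟩
  · exact Filter.Eventually.of_forall fun x s _ => hd s x

theorem reflection_span_singleton_of_norm_eq_one {w : E n} (hw : ‖w‖ = 1) (y : E n) :
    (Submodule.span ℝ {w}).reflection y = (2 * inner ℝ w y) • w - y := by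
  rw [Submodule.reflection_singleton_apply]
  simp [hw, two_smul, two_mul, add_smul]

theorem norm_cos_smul_add_sin_smul {e v : E n} (he : ‖e‖ = 1) (hv : ‖v‖ = 1)
    (hev : inner ℝ e v = 0) (t : ℝ) : ‖Real.cos t • e + Real.sin t • v‖ = 1 := by
  rw [← sq_eq_sq₀ (norm_nonneg _) zero_le_one, norm_add_sq_real, norm_smul, norm_smul, he, hv,
    inner_smul_left, inner_smul_right, hev]
  simp

theorem hasDerivAt_integral_sphere_comp_reflection {w w' : ℝ → E n} (hw : Continuous w)
    (hw' : Continuous w') (hd : ∀ t, HasDerivAt w (w' t) t) {F : E n → ℝ} (hF : ContDiff ℝ 1 F)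
    (t : ℝ) :
    HasDerivAt (fun s => ∫ y, F ((2 * inner ℝ (w s) (y : E n)) • w s - y) ∂sphereMeasure n)
      (∫ y, fderiv ℝ F ((2 * inner ℝ (w t) (y : E n)) • w t - y)
        ((2 * inner ℝ (w t) (y : E n)) • w' t + (2 * inner ℝ (w' t) (y : E n)) • w t)
        ∂sphereMeasure n) t := by
  refine hasDerivAt_integral_of_compactSpace
    (f := fun s (y : Metric.sphere (0 : E n) 1) =>
      F ((2 * inner ℝ (w s) (y : E n)) • w s - y))
    (f' := fun s (y : Metric.sphere (0 : E n) 1) =>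
      fderiv ℝ F ((2 * inner ℝ (w s) (y : E n)) • w s - y)
        ((2 * inner ℝ (w s) (y : E n)) • w' s + (2 * inner ℝ (w' s) (y : E n)) • w s))
    (fun s => hF.continuous.comp (by fun_prop)) ?_ (fun s y => ?_) t
  · have hF' := hF.continuous_fderiv one_ne_zero
    exact (hF'.comp (by fun_prop)).clm_apply (by fun_prop)
  · have h : HasDerivAt (fun s => 2 * inner ℝ (w s) (y : E n))
        (2 * inner ℝ (w' s) (y : E n)) s := by
      simpa using ((hd s).inner ℝ (hasDerivAt_const s (y : E n))).const_mul 2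
    exact (hF.differentiable one_ne_zero _).hasFDerivAt.comp_hasDerivAt s
      ((h.smul (hd s)).sub_const (y : E n))

/-- The surface measure is preserved by the reflections in the lines spanned by
`cos t • e + sin t • v`, and the identity is the derivative at `t = 0`. -/
theorem integral_sphere_fderiv_rotation_eq_zero {e v : E n} (he : ‖e‖ = 1) (hv : ‖v‖ = 1)
    (hev : inner ℝ e v = 0) {F : E n → ℝ} (hF : ContDiff ℝ 1 F) :
    ∫ y, fderiv ℝ F (y : E n) (inner ℝ e (y : E n) • v - inner ℝ v (y : E n) • e)
      ∂sphereMeasure n = 0 := by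
  have hd (t : ℝ) : HasDerivAt (fun t => Real.cos t • e + Real.sin t • v)
      (-Real.sin t • e + Real.cos t • v) t :=
    ((Real.hasDerivAt_cos t).smul_const e).add ((Real.hasDerivAt_sin t).smul_const v)
  have h := hasDerivAt_integral_sphere_comp_reflection (by fun_prop) (by fun_prop) hd hF 0
  simp_rw [← reflection_span_singleton_of_norm_eq_one (norm_cos_smul_add_sin_smul he hv hev _),
    integral_sphere_comp_isometry _ hF.continuous] at h
  replace h := h.unique (hasDerivAt_const _ _)
  rw [← integral_sphere_comp_isometry (Submodule.span ℝ {e}).reflection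
    (f := fun y => fderiv ℝ F y (inner ℝ e y • v - inner ℝ v y • e))
    ((hF.continuous_fderiv one_ne_zero).clm_apply (by fun_prop))]
  rw [← mul_eq_zero_iff_left (two_ne_zero (α := ℝ)), ← integral_const_mul, ← h]
  refine integral_congr_ae (Filter.Eventually.of_forall fun y => ?_)
  have hve : inner ℝ v e = 0 := by rw [real_inner_comm, hev]
  simp only [reflection_span_singleton_of_norm_eq_one he, Real.cos_zero, Real.sin_zero, neg_zero,
    zero_smul, one_smul, add_zero, zero_add, ← smul_eq_mul, ← map_smul]
  congr 1
  simp only [inner_sub_right, inner_smul_right, real_inner_self_eq_norm_sq, he, hve, smul_eq_mul]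
  module

end Sphere

/-! ### The symbol of the spherical average -/

/-- The Fourier transform `ξ ↦ ∫_{S^{n-1}} cos ⟨y, ξ⟩ dω(y)` of the surface measure. -/
def sphereSymbol (n : ℕ) (ξ : E n) : ℝ :=
  ∫ y, Real.cos (inner ℝ (y : E n) ξ) ∂sphereMeasure n

theorem sphereSymbol_eq_of_norm_eq {n : ℕ} {ξ ζ : E n} (h : ‖ξ‖ = ‖ζ‖) :
    sphereSymbol n ξ = sphereSymbol n ζ := by
  rw [sphereSymbol, sphereSymbol,
    ← integral_sphere_comp_isometry (Submodule.span ℝ {ξ - ζ})ᗮ.reflection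
      (f := fun y => Real.cos (inner ℝ y ζ)) (by fun_prop)]
  refine integral_congr_ae (Filter.Eventually.of_forall fun y => ?_)
  simp only
  rw [← LinearIsometryEquiv.inner_map_map (Submodule.span ℝ {ξ - ζ})ᗮ.reflection y ξ,
    Submodule.reflection_sub h]

theorem integral_sin_inner_sphere {n : ℕ} (ξ : E n) :
    ∫ y, Real.sin (inner ℝ (y : E n) ξ) ∂sphereMeasure n = 0 := by
  have h := integral_sphere_comp_isometry (LinearIsometryEquiv.neg ℝ (E := E n))
    (f := fun y => Real.sin (inner ℝ y ξ)) (by fun_prop)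
  simp only [LinearIsometryEquiv.coe_neg, inner_neg_left, Real.sin_neg, integral_neg] at h
  linarith

theorem integral_cexp_inner_sphere {n : ℕ} (ξ : E n) :
    ∫ y, Complex.exp (((-inner ℝ (y : E n) ξ : ℝ) : ℂ) * Complex.I) ∂sphereMeasure n =
      (sphereSymbol n ξ : ℂ) := by
  have hc : ∀ y : Metric.sphere (0 : E n) 1,
      Complex.exp (((-inner ℝ (y : E n) ξ : ℝ) : ℂ) * Complex.I) =
      ((Real.cos (inner ℝ (y : E n) ξ) : ℝ) : ℂ) -
        ((Real.sin (inner ℝ (y : E n) ξ) : ℝ) : ℂ) * Complex.I := by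
    intro y
    rw [Complex.exp_mul_I]
    push_cast
    simp [sub_eq_add_neg]
  simp_rw [hc]
  rw [integral_sub, integral_mul_const, integral_complex_ofReal, integral_complex_ofReal,
    integral_sin_inner_sphere]
  · simp [sphereSymbol]
  · exact integrable_sphere (by fun_prop)
  · exact integrable_sphere (by fun_prop)

theorem abs_sphereSymbol_le (n : ℕ) (ξ : E n) : |sphereSymbol n ξ| ≤ 1 := by
  have h := norm_integral_le_of_norm_le_const (μ := sphereMeasure n) (C := 1)
    (f := fun y : Metric.sphere (0 : E n) 1 => Real.cos (inner ℝ (y : E n) ξ))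
    (Filter.Eventually.of_forall fun y => Real.abs_cos_le_one _)
  rw [one_mul] at h
  exact h.trans (sphereMeasure_real_univ_le n)

theorem continuous_sphereSymbol (n : ℕ) : Continuous (sphereSymbol n) := by
  refine continuous_of_dominated (bound := fun _ => 1) ?_ ?_ (integrable_const _) ?_
  · intro ξ
    exact (by fun_prop : Continuous fun y : Metric.sphere (0 : E n) 1 =>
      Real.cos (inner ℝ (y : E n) ξ)).aestronglyMeasurable
  · exact fun ξ => Filter.Eventually.of_forall fun y => Real.abs_cos_le_one _
  · exact Filter.Eventually.of_forall fun y => by fun_prop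

/-! ### The radial equation -/

section RadialEquation

variable {n : ℕ} {e : E n}

theorem hasDerivAt_sphereSymbol_smul (e : E n) (r : ℝ) :
    HasDerivAt (fun s => sphereSymbol n (s • e))
      (-∫ y, inner ℝ (y : E n) e * Real.sin (r * inner ℝ (y : E n) e) ∂sphereMeasure n) r := by
  simp only [sphereSymbol, inner_smul_right, ← integral_neg]
  refine hasDerivAt_integral_of_compactSpace
    (f := fun s (y : Metric.sphere (0 : E n) 1) => Real.cos (s * inner ℝ (y : E n) e))
    (f' := fun s (y : Metric.sphere (0 : E n) 1) =>
      -(inner ℝ (y : E n) e * Real.sin (s * inner ℝ (y : E n) e)))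
    (fun s => by fun_prop) (by fun_prop) (fun s y => ?_) r
  exact (hasDerivAt_mul_const (inner ℝ (y : E n) e)).cos.congr_deriv (by ring)

theorem hasDerivAt_integral_inner_mul_sin (e : E n) (r : ℝ) :
    HasDerivAt
      (fun s => ∫ y, inner ℝ (y : E n) e * Real.sin (s * inner ℝ (y : E n) e) ∂sphereMeasure n)
      (∫ y, inner ℝ (y : E n) e ^ 2 * Real.cos (r * inner ℝ (y : E n) e) ∂sphereMeasure n) r := by
  refine hasDerivAt_integral_of_compactSpace
    (f := fun s (y : Metric.sphere (0 : E n) 1) =>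
      inner ℝ (y : E n) e * Real.sin (s * inner ℝ (y : E n) e))
    (f' := fun s (y : Metric.sphere (0 : E n) 1) =>
      inner ℝ (y : E n) e ^ 2 * Real.cos (s * inner ℝ (y : E n) e))
    (fun s => by fun_prop) (by fun_prop) (fun s y => ?_) r
  exact ((hasDerivAt_mul_const (inner ℝ (y : E n) e)).sin.const_mul _).congr_deriv (by ring)

theorem mul_integral_inner_sq_mul_cos_of_orthogonal {v : E n} (he : ‖e‖ = 1) (hv : ‖v‖ = 1)
    (hev : inner ℝ e v = 0) (r : ℝ) :
    r * ∫ y, inner ℝ (y : E n) v ^ 2 * Real.cos (r * inner ℝ (y : E n) e) ∂sphereMeasure n =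
      ∫ y, inner ℝ (y : E n) e * Real.sin (r * inner ℝ (y : E n) e) ∂sphereMeasure n := by
  have h := integral_sphere_fderiv_rotation_eq_zero he hv hev
    (F := fun y => inner ℝ v y * Real.sin (r * inner ℝ e y))
    ((innerSL ℝ v).contDiff.mul (contDiff_const.mul (innerSL ℝ e).contDiff).sin)
  have hderiv (y z : E n) : fderiv ℝ (fun y => inner ℝ v y * Real.sin (r * inner ℝ e y)) y z =
      inner ℝ v y * (Real.cos (r * inner ℝ e y) * (r * inner ℝ e z)) +
        Real.sin (r * inner ℝ e y) * inner ℝ v z := by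
    have hsin := ((innerSL ℝ e).hasFDerivAt (x := y)).const_mul r |>.sin
    have := ((innerSL ℝ v).hasFDerivAt (x := y)).mul hsin
    rw [HasFDerivAt.fderiv (f := fun y => inner ℝ v y * Real.sin (r * inner ℝ e y)) this]
    simp
  have hve : inner ℝ v e = 0 := by rw [real_inner_comm, hev]
  simp only [hderiv, inner_sub_right, inner_smul_right, real_inner_self_eq_norm_sq, he, hv, hev,
    hve] at h
  rw [← integral_const_mul, eq_comm, ← sub_eq_zero, ← integral_sub (integrable_sphere (by fun_prop))
    (integrable_sphere (by fun_prop)), ← h]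
  refine integral_congr_ae (Filter.Eventually.of_forall fun y => ?_)
  simp only [real_inner_comm (y : E n) e, real_inner_comm (y : E n) v]
  ring

theorem sphereSymbol_radial_equation (b : OrthonormalBasis (Fin n) ℝ (E n)) (i : Fin n) (r : ℝ) :
    r * ∫ y, inner ℝ (y : E n) (b i) ^ 2 * Real.cos (r * inner ℝ (y : E n) (b i))
        ∂sphereMeasure n +
      ((n : ℝ) - 1) *
        ∫ y, inner ℝ (y : E n) (b i) * Real.sin (r * inner ℝ (y : E n) (b i)) ∂sphereMeasure n =
    r * sphereSymbol n (r • b i) := by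
  have horth (j : Fin n) (hj : j ∈ Finset.univ.erase i) :=
    mul_integral_inner_sq_mul_cos_of_orthogonal (b.orthonormal.1 i) (b.orthonormal.1 j)
      (b.orthonormal.2 (Finset.ne_of_mem_erase hj).symm) r
  have hsum := Finset.sum_congr rfl horth
  rw [Finset.sum_const, Finset.card_erase_of_mem (Finset.mem_univ _), Finset.card_univ,
    Fintype.card_fin, nsmul_eq_mul, Nat.cast_sub i.pos, Nat.cast_one] at hsum
  rw [← hsum, ← Finset.mul_sum, ← mul_add,
    Finset.add_sum_erase _ (fun j => ∫ y, inner ℝ (y : E n) (b j) ^ 2 *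
      Real.cos (r * inner ℝ (y : E n) (b i)) ∂sphereMeasure n) (Finset.mem_univ i),
    ← integral_finsetSum _ fun j _ => integrable_sphere (by fun_prop)]
  simp_rw [← Finset.sum_mul, b.sum_sq_inner_left, norm_eq_of_mem_sphere, one_pow, one_mul,
    sphereSymbol, inner_smul_right]

end RadialEquation

/-! ### Perturbations of the harmonic oscillator -/

/-- `u` solves `u'' + u = c u / r²` on `(0, ∞)` and `v = u'`. This is the Liouville normal form of
the radial equation. -/
structure IsOscillatorSolution (c : ℝ) (u v : ℝ → ℝ) : Prop where
  hasDerivAt_fst : ∀ r, 0 < r → HasDerivAt u (v r) r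
  hasDerivAt_snd : ∀ r, 0 < r → HasDerivAt v ((c / r ^ 2 - 1) * u r) r

namespace IsOscillatorSolution

variable {c : ℝ} {u v : ℝ → ℝ} {r s : ℝ}

theorem hasDerivAt_energy_mul_exp (h : IsOscillatorSolution c u v) (κ : ℝ) (hr : 0 < r) :
    HasDerivAt (fun s => (u s ^ 2 + v s ^ 2) * Real.exp (κ / s))
      (Real.exp (κ / r) / r ^ 2 * (2 * c * (u r * v r) - κ * (u r ^ 2 + v r ^ 2))) r := by
  have hexp : HasDerivAt (fun s => Real.exp (κ / s)) (Real.exp (κ / r) * (-κ / r ^ 2)) r :=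
    (((hasDerivAt_const r κ).div (hasDerivAt_id r) hr.ne').exp).congr_deriv (by simp)
  refine ((((h.hasDerivAt_fst r hr).pow 2).add ((h.hasDerivAt_snd r hr).pow 2)).mul
    hexp).congr_deriv ?_
  simp only [Pi.add_apply, Pi.pow_apply]
  field_simp
  ring

theorem abs_two_mul_mul_le (c x y : ℝ) : |2 * c * (x * y)| ≤ |c| * (x ^ 2 + y ^ 2) := by
  rw [mul_comm 2 c, mul_assoc, ← mul_assoc 2, abs_mul]
  gcongr
  rw [abs_le]
  constructor <;> nlinarith [sq_nonneg (x - y), sq_nonneg (x + y)]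

theorem monotoneOn_energy_mul_exp (h : IsOscillatorSolution c u v) :
    MonotoneOn (fun s => (u s ^ 2 + v s ^ 2) * Real.exp (-|c| / s)) (Set.Ioi 0) := by
  have hd := fun (r : ℝ) (hr : 0 < r) => h.hasDerivAt_energy_mul_exp (-|c|) hr
  refine monotoneOn_of_deriv_nonneg (convex_Ioi 0)
    (fun r hr => (hd r hr).continuousAt.continuousWithinAt) ?_ ?_ <;> rw [interior_Ioi]
  · exact fun r hr => (hd r hr).differentiableAt.differentiableWithinAt
  · intro r hr
    rw [(hd r hr).deriv]
    have := (abs_le.1 (abs_two_mul_mul_le c (u r) (v r))).1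
    exact mul_nonneg (by positivity) (by linarith)

theorem antitoneOn_energy_mul_exp (h : IsOscillatorSolution c u v) :
    AntitoneOn (fun s => (u s ^ 2 + v s ^ 2) * Real.exp (|c| / s)) (Set.Ioi 0) := by
  have hd := fun (r : ℝ) (hr : 0 < r) => h.hasDerivAt_energy_mul_exp |c| hr
  refine antitoneOn_of_deriv_nonpos (convex_Ioi 0)
    (fun r hr => (hd r hr).continuousAt.continuousWithinAt) ?_ ?_ <;> rw [interior_Ioi]
  · exact fun r hr => (hd r hr).differentiableAt.differentiableWithinAt
  · intro r hr
    rw [(hd r hr).deriv]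
    have := (abs_le.1 (abs_two_mul_mul_le c (u r) (v r))).2
    exact mul_nonpos_of_nonneg_of_nonpos (by positivity) (by linarith)

theorem energy_pos (h : IsOscillatorSolution c u v) (hr : 0 < r) (hu : u r ≠ 0) (hs : 0 < s) :
    0 < u s ^ 2 + v s ^ 2 := by
  have hur : 0 < u r ^ 2 + v r ^ 2 := by positivity
  rcases le_total r s with hrs | hrs
  · exact pos_of_mul_pos_left ((mul_pos hur (Real.exp_pos _)).trans_le
      (h.monotoneOn_energy_mul_exp hr hs hrs)) (Real.exp_nonneg _)
  · exact pos_of_mul_pos_left ((mul_pos hur (Real.exp_pos _)).trans_le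
      (h.antitoneOn_energy_mul_exp hs hr hrs)) (Real.exp_nonneg _)

theorem energy_le (h : IsOscillatorSolution c u v) (hr : 1 ≤ r) :
    u r ^ 2 + v r ^ 2 ≤ (u 1 ^ 2 + v 1 ^ 2) * Real.exp |c| := by
  have hr0 : 0 < r := by positivity
  have := h.antitoneOn_energy_mul_exp (Set.mem_Ioi.2 one_pos) hr0 hr
  simp only [div_one] at this
  exact (le_mul_of_one_le_right (by positivity) (Real.one_le_exp (by positivity))).trans this

theorem le_energy (h : IsOscillatorSolution c u v) (hr : 1 ≤ r) :
    (u 1 ^ 2 + v 1 ^ 2) * Real.exp (-|c|) ≤ u r ^ 2 + v r ^ 2 := by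
  have hr0 : 0 < r := by positivity
  have := h.monotoneOn_energy_mul_exp (Set.mem_Ioi.2 one_pos) hr0 hr
  simp only [div_one] at this
  refine this.trans (mul_le_of_le_one_right (by positivity) (Real.exp_le_one_iff.2 ?_))
  exact div_nonpos_of_nonpos_of_nonneg (by simp) hr0.le

theorem exists_abs_le (h : IsOscillatorSolution c u v) : ∃ C, ∀ r, 1 ≤ r → |u r| ≤ C := by
  refine ⟨√((u 1 ^ 2 + v 1 ^ 2) * Real.exp |c|), fun r hr => Real.abs_le_sqrt ?_⟩
  linarith [h.energy_le hr, sq_nonneg (v r)]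

/-- If `|u|` were small on all of `[r, r + 1]`, then `v = u'` would be small at some point of this
interval, and so would the energy. -/
theorem exists_le_abs (h : IsOscillatorSolution c u v) (hs : 0 < s) (hu : u s ≠ 0) :
    ∃ ε, 0 < ε ∧ ∀ r, 1 ≤ r → ∃ t ∈ Set.Icc r (r + 1), ε ≤ |u t| := by
  set a := (u 1 ^ 2 + v 1 ^ 2) * Real.exp (-|c|)
  have ha0 : 0 < a := mul_pos (h.energy_pos hs hu one_pos) (Real.exp_pos _)
  refine ⟨√(a / 5), by positivity, fun r hr => ?_⟩
  by_contra! hsmall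
  have hsq (t : ℝ) (ht : t ∈ Set.Icc r (r + 1)) : u t ^ 2 < a / 5 := by
    simpa using (Real.lt_sqrt (abs_nonneg _)).1 (hsmall t ht)
  obtain ⟨t, ht, htv⟩ := exists_hasDerivAt_eq_slope u v (by linarith : r < r + 1)
    (fun t ht => (h.hasDerivAt_fst t (by linarith [ht.1])).continuousAt.continuousWithinAt)
    (fun t ht => h.hasDerivAt_fst t (by linarith [ht.1]))
  have hv : v t ^ 2 ≤ 2 * (u (r + 1) ^ 2 + u r ^ 2) := by
    rw [htv, add_sub_cancel_left, div_one]
    nlinarith [sq_nonneg (u (r + 1) + u r)]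
  have henergy : a ≤ u t ^ 2 + v t ^ 2 := h.le_energy (by linarith [ht.1])
  have := hsq t ⟨ht.1.le, ht.2.le⟩
  have := hsq r ⟨le_rfl, by linarith⟩
  have := hsq (r + 1) ⟨by linarith, le_rfl⟩
  linarith

theorem of_radial_equation {g g₁ g₂ : ℝ → ℝ} (hg : ∀ r, HasDerivAt g (g₁ r) r)
    (hg₁ : ∀ r, HasDerivAt g₁ (g₂ r) r) {b : ℝ}
    (hode : ∀ r, r * g₂ r + 2 * b * g₁ r + r * g r = 0) :
    IsOscillatorSolution (b ^ 2 - b) (fun r => r ^ b * g r)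
      (fun r => r ^ b * (g₁ r + b / r * g r)) where
  hasDerivAt_fst r hr := by
    refine ((Real.hasDerivAt_rpow_const (Or.inl hr.ne')).mul (hg r)).congr_deriv ?_
    rw [Real.rpow_sub_one hr.ne']
    field_simp
    ring
  hasDerivAt_snd r hr := by
    have hg₂ : g₂ r = -(2 * b / r) * g₁ r - g r := by
      field_simp
      linarith [hode r]
    have hdiv : HasDerivAt (fun r => b / r) (-b / r ^ 2) r :=
      ((hasDerivAt_const r b).div (hasDerivAt_id r) hr.ne').congr_deriv (by simp)
    refine ((Real.hasDerivAt_rpow_const (Or.inl hr.ne')).mul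
      ((hg₁ r).add (hdiv.mul (hg r)))).congr_deriv ?_
    simp only [Pi.add_apply, Pi.mul_apply, hg₂]
    rw [Real.rpow_sub_one hr.ne']
    field_simp
    ring

end IsOscillatorSolution

/-! ### The Japanese bracket -/

/-- The Japanese bracket `⟨ξ⟩ = (1 + ‖ξ‖²)^{1/2}`. -/
def japaneseBracket {V : Type*} [SeminormedAddCommGroup V] (ξ : V) : ℝ := √(1 + ‖ξ‖ ^ 2)

section JapaneseBracket

theorem bracket_eq {n : ℕ} (k : Fin n → ℤ) : bracket k = japaneseBracket (latticePoint k) := rfl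

variable {V : Type*} [SeminormedAddCommGroup V]

theorem one_le_japaneseBracket (ξ : V) : 1 ≤ japaneseBracket ξ := by
  rw [japaneseBracket, Real.one_le_sqrt]
  nlinarith [sq_nonneg ‖ξ‖]

theorem japaneseBracket_pos (ξ : V) : 0 < japaneseBracket ξ :=
  one_pos.trans_le (one_le_japaneseBracket ξ)

theorem norm_le_japaneseBracket (ξ : V) : ‖ξ‖ ≤ japaneseBracket ξ :=
  Real.le_sqrt_of_sq_le (by linarith)

theorem japaneseBracket_le_one_add_norm (ξ : V) : japaneseBracket ξ ≤ 1 + ‖ξ‖ := by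
  rw [japaneseBracket, Real.sqrt_le_left (by positivity)]
  nlinarith [norm_nonneg ξ]

theorem japaneseBracket_neg (ξ : V) : japaneseBracket (-ξ) = japaneseBracket ξ := by
  simp [japaneseBracket]

theorem japaneseBracket_add_le (x y : V) :
    japaneseBracket (x + y) ≤ 2 * japaneseBracket x * japaneseBracket y := by
  unfold japaneseBracket
  rw [mul_assoc, ← Real.sqrt_mul (by positivity)]
  refine Real.sqrt_le_iff.2 ⟨by positivity, ?_⟩
  rw [mul_pow, Real.sq_sqrt (by positivity)]
  have h := norm_add_le x y
  have h2 : ‖x + y‖ ^ 2 ≤ (‖x‖ + ‖y‖) ^ 2 := by gcongr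
  nlinarith [sq_nonneg (‖x‖ - ‖y‖), mul_nonneg (sq_nonneg ‖x‖) (sq_nonneg ‖y‖), sq_nonneg ‖x‖,
    sq_nonneg ‖y‖]

theorem japaneseBracket_rpow_pos (ξ : V) (a : ℝ) : 0 < japaneseBracket ξ ^ a :=
  Real.rpow_pos_of_pos (japaneseBracket_pos ξ) a

theorem japaneseBracket_add_rpow_le (x y : V) (a : ℝ) :
    japaneseBracket (x + y) ^ a ≤ 2 ^ |a| * japaneseBracket x ^ a * japaneseBracket y ^ |a| := by
  have hx := japaneseBracket_pos x
  have hy := japaneseBracket_pos y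
  have hxy := japaneseBracket_pos (x + y)
  rcases le_total 0 a with ha | ha
  · rw [abs_of_nonneg ha, ← Real.mul_rpow (by norm_num) hx.le,
      ← Real.mul_rpow (by positivity) hy.le]
    exact Real.rpow_le_rpow hxy.le (japaneseBracket_add_le x y) ha
  · rw [abs_of_nonpos ha]
    have h : japaneseBracket x ≤ 2 * japaneseBracket (x + y) * japaneseBracket y := by
      have := japaneseBracket_add_le (x + y) (-y)
      rwa [japaneseBracket_neg, add_neg_cancel_right] at this
    have h2 := Real.rpow_le_rpow_of_nonpos hx h ha
    rw [Real.mul_rpow (by positivity) hy.le, Real.mul_rpow (by norm_num) hxy.le] at h2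
    calc japaneseBracket (x + y) ^ a
        = 2 ^ (-a) * (2 ^ a * japaneseBracket (x + y) ^ a * japaneseBracket y ^ a) *
            japaneseBracket y ^ (-a) := by
          rw [Real.rpow_neg (by norm_num), Real.rpow_neg hy.le]
          have : (0 : ℝ) < 2 ^ a := by positivity
          have := japaneseBracket_rpow_pos y a
          field_simp
      _ ≤ _ := by
          have := japaneseBracket_rpow_pos y (-a)
          gcongr

theorem japaneseBracket_rpow_le_of_norm_sub_le {x y : V} {R : ℝ} (h : ‖x - y‖ ≤ R) (a : ℝ) :
    japaneseBracket x ^ a ≤ 2 ^ |a| * (1 + R) ^ |a| * japaneseBracket y ^ a := by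
  have h1 := japaneseBracket_add_rpow_le y (x - y) a
  rw [add_sub_cancel] at h1
  refine h1.trans ?_
  rw [mul_assoc, mul_assoc, mul_comm (japaneseBracket y ^ a)]
  have := japaneseBracket_rpow_pos y a
  have h2 := (japaneseBracket_le_one_add_norm (x - y)).trans (add_le_add_right h 1)
  have := japaneseBracket_pos (x - y)
  gcongr

theorem japaneseBracket_rpow_le_one_add_norm_pow (x : V) {a : ℝ} {k : ℕ} (h : a ≤ k) :
    japaneseBracket x ^ a ≤ (1 + ‖x‖) ^ k := by
  have hx := japaneseBracket_pos x
  calc japaneseBracket x ^ a ≤ japaneseBracket x ^ (k : ℝ) :=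
        Real.rpow_le_rpow_of_exponent_le (one_le_japaneseBracket x) h
    _ = japaneseBracket x ^ k := Real.rpow_natCast _ _
    _ ≤ (1 + ‖x‖) ^ k := by
        gcongr
        exact japaneseBracket_le_one_add_norm x

section Decay

variable {V : Type*} [NormedAddCommGroup V] [NormedSpace ℝ V]

theorem integrable_japaneseBracket_rpow [FiniteDimensional ℝ V] [MeasurableSpace V] [BorelSpace V]
    {μ : Measure V} [μ.IsAddHaarMeasure] {r : ℝ} (hr : (Module.finrank ℝ V : ℝ) < r) :
    Integrable (fun x : V => japaneseBracket x ^ (-r)) μ := by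
  refine (integrable_rpow_neg_one_add_norm_sq (E := V) hr).congr
    (Filter.Eventually.of_forall fun x => ?_)
  simp only [japaneseBracket]
  rw [Real.sqrt_eq_rpow, ← Real.rpow_mul (by positivity)]
  congr 1
  ring

theorem exists_schwartz_le_japaneseBracket {F : Type*} [NormedAddCommGroup F] [NormedSpace ℝ F]
    (Ψ : 𝓢(V, F)) (r : ℝ) : ∃ C, 0 ≤ C ∧ ∀ x, ‖Ψ x‖ ≤ C * japaneseBracket x ^ (-r) := by
  set k := ⌈|r|⌉₊
  refine ⟨2 ^ k * ((Finset.Iic (k, 0)).sup fun m => SchwartzMap.seminorm ℝ m.1 m.2) Ψ,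
    by positivity, fun x => ?_⟩
  have h := one_add_le_sup_seminorm_apply (𝕜 := ℝ) (m := (k, 0)) (k := k) (n := 0) le_rfl le_rfl Ψ x
  rw [norm_iteratedFDeriv_zero] at h
  have hx := japaneseBracket_pos x
  rw [Real.rpow_neg hx.le, ← div_eq_mul_inv, le_div_iff₀ (Real.rpow_pos_of_pos hx _), mul_comm]
  refine le_trans ?_ h
  gcongr
  exact japaneseBracket_rpow_le_one_add_norm_pow x ((le_abs_self r).trans (Nat.le_ceil _))

end Decay

end JapaneseBracket

/-! ### Decay and lower bound of the symbol -/

section SphereSymbol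

variable {n : ℕ}

theorem exists_oscillator_eq_sphereSymbol (hn : 1 ≤ n) :
    ∃ (c : ℝ) (u v : ℝ → ℝ), IsOscillatorSolution c u v ∧ (∃ r, 0 < r ∧ u r ≠ 0) ∧
      ∀ ξ : E n, u ‖ξ‖ = ‖ξ‖ ^ (((n : ℝ) - 1) / 2) * sphereSymbol n ξ := by
  have := isProbabilityMeasure_sphereMeasure hn
  set b := EuclideanSpace.basisFun (Fin n) ℝ
  set i : Fin n := ⟨0, hn⟩
  have hg := hasDerivAt_sphereSymbol_smul (b i)
  have hsol := IsOscillatorSolution.of_radial_equation (b := ((n : ℝ) - 1) / 2) hg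
    (fun r => (hasDerivAt_integral_inner_mul_sin (b i) r).neg)
    fun r => by linarith [sphereSymbol_radial_equation b i r]
  refine ⟨_, _, _, hsol, ?_, fun ξ => ?_⟩
  · have hg0 : sphereSymbol n ((0 : ℝ) • b i) ≠ 0 := by simp [sphereSymbol]
    have hpos : ∀ᶠ r in nhdsWithin (0 : ℝ) (Set.Ioi 0), sphereSymbol n (r • b i) ≠ 0 :=
      ((hg 0).continuousAt.eventually_ne hg0).filter_mono nhdsWithin_le_nhds
    obtain ⟨r, hr, hr0⟩ := (hpos.and self_mem_nhdsWithin).exists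
    exact ⟨r, hr0, mul_ne_zero (Real.rpow_pos_of_pos hr0 _).ne' hr⟩
  · rw [sphereSymbol_eq_of_norm_eq (ζ := ξ)]
    rw [norm_smul, b.orthonormal.1 i, norm_norm, mul_one]

theorem exists_abs_sphereSymbol_le (hn : 1 ≤ n) : ∃ C : ℝ, 0 ≤ C ∧
    ∀ ξ : E n, |sphereSymbol n ξ| ≤ C * japaneseBracket ξ ^ (-(((n : ℝ) - 1) / 2)) := by
  obtain ⟨_, u, _, hsol, -, hu⟩ := exists_oscillator_eq_sphereSymbol hn
  obtain ⟨C, hC⟩ := hsol.exists_abs_le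
  set b : ℝ := ((n : ℝ) - 1) / 2
  have hb : 0 ≤ b := div_nonneg (sub_nonneg.2 (by exact_mod_cast hn)) two_pos.le
  refine ⟨2 ^ b * max 1 C, by positivity, fun ξ => ?_⟩
  have hpos := japaneseBracket_pos ξ
  have hle := japaneseBracket_le_one_add_norm ξ
  rw [Real.rpow_neg hpos.le, ← div_eq_mul_inv, le_div_iff₀ (Real.rpow_pos_of_pos hpos _)]
  rcases le_total ‖ξ‖ 1 with h | h
  · calc |sphereSymbol n ξ| * japaneseBracket ξ ^ b ≤ 1 * 2 ^ b := by
          gcongr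
          · exact abs_sphereSymbol_le n ξ
          · linarith
      _ ≤ 2 ^ b * max 1 C := by
          rw [mul_comm]
          gcongr
          exact le_max_left 1 C
  · calc |sphereSymbol n ξ| * japaneseBracket ξ ^ b
        ≤ |sphereSymbol n ξ| * (2 * ‖ξ‖) ^ b := by gcongr; linarith
      _ = 2 ^ b * |u ‖ξ‖| := by
          rw [hu, abs_mul, abs_of_nonneg (by positivity : 0 ≤ ‖ξ‖ ^ b),
            Real.mul_rpow two_pos.le (norm_nonneg ξ)]
          ring
      _ ≤ 2 ^ b * max 1 C := by
          gcongr
          exact (hC _ h).trans (le_max_right 1 C)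

theorem exists_le_abs_sphereSymbol (hn : 1 ≤ n) : ∃ ε : ℝ, 0 < ε ∧ ∀ κ : E n, 1 ≤ ‖κ‖ →
    ∃ ξ, ‖ξ - κ‖ ≤ 1 ∧ ‖κ‖ ≤ ‖ξ‖ ∧
      ε * japaneseBracket κ ^ (-(((n : ℝ) - 1) / 2)) ≤ |sphereSymbol n ξ| := by
  obtain ⟨_, u, _, hsol, ⟨r, hr, hur⟩, hu⟩ := exists_oscillator_eq_sphereSymbol hn
  obtain ⟨ε, hε, hlarge⟩ := hsol.exists_le_abs hr hur
  set b : ℝ := ((n : ℝ) - 1) / 2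
  have hb : 0 ≤ b := div_nonneg (sub_nonneg.2 (by exact_mod_cast hn)) two_pos.le
  refine ⟨ε / 2 ^ b, by positivity, fun κ hκ => ?_⟩
  obtain ⟨t, ht, htu⟩ := hlarge ‖κ‖ hκ
  have hκ0 : 0 < ‖κ‖ := by positivity
  have ht0 : 0 < t := hκ0.trans_le ht.1
  have hξ : ‖(t / ‖κ‖) • κ‖ = t := by
    rw [norm_smul, Real.norm_of_nonneg (by positivity), div_mul_cancel₀ _ hκ0.ne']
  refine ⟨(t / ‖κ‖) • κ, ?_, hξ.symm ▸ ht.1, ?_⟩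
  · have hsub : (t / ‖κ‖) • κ - κ = (t / ‖κ‖ - 1) • κ := by rw [sub_smul, one_smul]
    rw [hsub, norm_smul, Real.norm_of_nonneg (sub_nonneg.2 ((one_le_div hκ0).2 ht.1)), sub_mul,
      div_mul_cancel₀ _ hκ0.ne']
    linarith [ht.2]
  · have hpos := japaneseBracket_pos κ
    have htκ : t ≤ 2 * japaneseBracket κ := by
      linarith [ht.2, norm_le_japaneseBracket κ, one_le_japaneseBracket κ]
    rw [Real.rpow_neg hpos.le, ← div_eq_mul_inv, div_div, ← Real.mul_rpow two_pos.le hpos.le,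
      div_le_iff₀ (by positivity)]
    calc ε ≤ |u t| := htu
      _ = |sphereSymbol n ((t / ‖κ‖) • κ)| * t ^ b := by
          rw [← hξ, hu, hξ, abs_mul, abs_of_nonneg (by positivity), mul_comm]
      _ ≤ _ := by gcongr

end SphereSymbol

/-! ### Symbol classes -/

/-- Smooth functions all of whose derivatives are `O(⟨ξ⟩^a)`. Derivatives are not required to gain
decay, since the symbol of the spherical average oscillates. -/
structure IsSymbol {V F : Type*} [NormedAddCommGroup V] [NormedSpace ℝ V] [NormedAddCommGroup F]
    [NormedSpace ℝ F] (a : ℝ) (f : V → F) : Prop where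
  contDiff : ContDiff ℝ ∞ f
  bound : ∀ j : ℕ, ∃ C : ℝ, 0 ≤ C ∧ ∀ ξ, ‖iteratedFDeriv ℝ j f ξ‖ ≤ C * japaneseBracket ξ ^ a

namespace IsSymbol

variable {V F G H : Type*} [NormedAddCommGroup V] [NormedSpace ℝ V]
  [NormedAddCommGroup F] [NormedSpace ℝ F] [NormedAddCommGroup G] [NormedSpace ℝ G]
  [NormedAddCommGroup H] [NormedSpace ℝ H] {a b : ℝ}

theorem bilin (B : F →L[ℝ] G →L[ℝ] H) {f : V → F} {g : V → G} (hf : IsSymbol a f)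
    (hg : IsSymbol b g) : IsSymbol (a + b) fun ξ => B (f ξ) (g ξ) := by
  choose C hC0 hC using hf.bound
  choose D hD0 hD using hg.bound
  refine ⟨B.isBoundedBilinearMap.contDiff.comp (hf.contDiff.prodMk hg.contDiff), fun j => ?_⟩
  refine ⟨‖B‖ * ∑ i ∈ Finset.range (j + 1), (j.choose i : ℝ) * C i * D (j - i),
    mul_nonneg (norm_nonneg B) (Finset.sum_nonneg fun i _ => mul_nonneg (mul_nonneg
      (Nat.cast_nonneg _) (hC0 _)) (hD0 _)), fun ξ => ?_⟩
  refine (B.norm_iteratedFDeriv_le_of_bilinear hf.contDiff hg.contDiff ξ (n := j)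
    (by exact_mod_cast le_top)).trans ?_
  rw [mul_assoc, Finset.sum_mul]
  refine mul_le_mul_of_nonneg_left (Finset.sum_le_sum fun i _ => ?_) (norm_nonneg B)
  have hx := japaneseBracket_pos ξ
  rw [Real.rpow_add hx]
  calc _ ≤ (j.choose i : ℝ) * (C i * japaneseBracket ξ ^ a) *
        (D (j - i) * japaneseBracket ξ ^ b) := by
        have := hC0 i
        gcongr
        · exact hC i ξ
        · exact hD _ ξ
    _ = _ := by ring

theorem of_norm_le_of_fderiv {f : V → F} (hf : ContDiff ℝ ∞ f) {C : ℝ} (hC : 0 ≤ C)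
    (h : ∀ ξ, ‖f ξ‖ ≤ C * japaneseBracket ξ ^ a) (hd : IsSymbol a (fderiv ℝ f)) :
    IsSymbol a f := by
  refine ⟨hf, fun j => ?_⟩
  rcases j with _ | j
  · exact ⟨C, hC, fun ξ => by rw [norm_iteratedFDeriv_zero]; exact h ξ⟩
  · obtain ⟨D, hD, h⟩ := hd.bound j
    exact ⟨D, hD, fun ξ => by rw [← norm_iteratedFDeriv_fderiv]; exact h ξ⟩

theorem const (c : F) (ha : 0 ≤ a) : IsSymbol a fun _ : V => c := by
  have h1 : ∀ ξ : V, 1 ≤ japaneseBracket ξ ^ a := fun ξ =>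
    Real.one_le_rpow (one_le_japaneseBracket ξ) ha
  refine ⟨contDiff_const, fun j => ⟨‖c‖, norm_nonneg _, fun ξ => ?_⟩⟩
  rcases j with _ | j
  · rw [norm_iteratedFDeriv_zero]
    exact le_mul_of_one_le_right (norm_nonneg _) (h1 ξ)
  · rw [iteratedFDeriv_const_of_ne (by simp)]
    simp only [Pi.zero_apply, norm_zero]
    exact mul_nonneg (norm_nonneg _) (zero_le_one.trans (h1 ξ))

theorem id : IsSymbol 1 fun ξ : V => ξ := by
  refine of_norm_le_of_fderiv (C := 1) contDiff_id zero_le_one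
    (fun ξ => by simpa using norm_le_japaneseBracket ξ) ?_
  have : fderiv ℝ (fun ξ : V => ξ) = fun _ => ContinuousLinearMap.id ℝ V := by
    ext1 ξ; exact fderiv_fun_id
  rw [this]
  exact const _ zero_le_one

theorem norm_sq {V : Type*} [NormedAddCommGroup V] [InnerProductSpace ℝ V] :
    IsSymbol 2 fun ξ : V => ((‖ξ‖ ^ 2 : ℝ) : ℂ) := by
  have h := (bilin (innerSL ℝ) (id (V := V)) id).bilin (ContinuousLinearMap.lsmul ℝ ℝ)
    (const (V := V) (1 : ℂ) le_rfl)
  have e : (1 + 1 + 0 : ℝ) = 2 := by norm_num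
  rw [e] at h
  refine (congrArg (IsSymbol 2) (funext fun ξ => ?_)).mpr h
  have h2 : innerSL ℝ ξ ξ = ‖ξ‖ ^ 2 := real_inner_self_eq_norm_sq ξ
  simp [h2]

theorem mul {f g : V → ℂ} (hf : IsSymbol a f) (hg : IsSymbol b g) :
    IsSymbol (a + b) fun ξ => f ξ * g ξ :=
  bilin (ContinuousLinearMap.mul ℝ ℂ) hf hg

theorem pow {f : V → ℂ} (hf : IsSymbol a f) (N : ℕ) : IsSymbol (N * a) fun ξ => f ξ ^ N := by
  induction N with
  | zero => simpa using const (V := V) (1 : ℂ) le_rfl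
  | succ N ih =>
    have := ih.mul hf
    simp_rw [← pow_succ] at this
    convert this using 1
    push_cast; ring

theorem neg {f : V → ℂ} (hf : IsSymbol a f) : IsSymbol a fun ξ => -f ξ := by
  have := (const (V := V) (-1 : ℂ) le_rfl).mul hf
  simpa using this

theorem hasTemperateGrowth {f : V → F} (hf : IsSymbol a f) : f.HasTemperateGrowth := by
  refine ⟨hf.contDiff, fun j => ?_⟩
  obtain ⟨C, hC, h⟩ := hf.bound j
  refine ⟨⌈|a|⌉₊, C, fun ξ => (h ξ).trans ?_⟩
  gcongr
  exact japaneseBracket_rpow_le_one_add_norm_pow ξ ((le_abs_self a).trans (Nat.le_ceil _))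

end IsSymbol

/-! ### Convolution with a Schwartz function -/

section Convolution

open ContinuousLinearMap (lsmul)
open scoped Convolution

universe u

variable {V F : Type u} [NormedAddCommGroup V] [NormedSpace ℝ V]
  [NormedAddCommGroup F] [NormedSpace ℝ F] {m : V → ℝ} {a C : ℝ}

theorem exists_norm_smul_schwartz_le (hm : ∀ ξ, |m ξ| ≤ C * japaneseBracket ξ ^ a) (Ψ : 𝓢(V, F))
    (b : ℝ) : ∃ D : ℝ, 0 ≤ D ∧ ∀ ξ η,
      ‖m η • Ψ (ξ - η)‖ ≤ D * japaneseBracket ξ ^ a * japaneseBracket (ξ - η) ^ (-b) := by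
  have hC : 0 ≤ C :=
    nonneg_of_mul_nonneg_left ((abs_nonneg _).trans (hm 0)) (japaneseBracket_rpow_pos _ _)
  obtain ⟨B, hB, hΨ⟩ := exists_schwartz_le_japaneseBracket Ψ (|a| + b)
  refine ⟨C * 2 ^ |a| * B, by positivity, fun ξ η => ?_⟩
  have hη := japaneseBracket_add_rpow_le ξ (-(ξ - η)) a
  rw [japaneseBracket_neg, neg_sub, add_sub_cancel] at hη
  have hpos := japaneseBracket_pos (ξ - η)
  have := japaneseBracket_rpow_pos η a
  rw [norm_smul, Real.norm_eq_abs]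
  calc _ ≤ (C * (2 ^ |a| * japaneseBracket ξ ^ a * japaneseBracket (ξ - η) ^ |a|)) *
        (B * japaneseBracket (ξ - η) ^ (-(|a| + b))) := by
        gcongr
        · exact (abs_nonneg _).trans ((hm η).trans (by gcongr))
        · exact (hm η).trans (by gcongr)
        · exact hΨ _
    _ = C * 2 ^ |a| * B * japaneseBracket ξ ^ a *
        (japaneseBracket (ξ - η) ^ |a| * japaneseBracket (ξ - η) ^ (-(|a| + b))) := by ring
    _ = _ := by
        rw [← Real.rpow_add hpos]
        congr 2
        ring

variable [FiniteDimensional ℝ V] [MeasurableSpace V] [BorelSpace V] {μ : Measure V}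
  [μ.IsAddHaarMeasure]

variable (μ) in
theorem integrable_japaneseBracket_sub (ξ : V) :
    Integrable (fun η => japaneseBracket (ξ - η) ^ (-((Module.finrank ℝ V : ℝ) + 1))) μ :=
  (integrable_japaneseBracket_rpow (lt_add_one _)).comp_sub_left ξ

theorem convolutionExists_schwartz (hmc : AEStronglyMeasurable m μ)
    (hm : ∀ ξ, |m ξ| ≤ C * japaneseBracket ξ ^ a) (Ψ : 𝓢(V, F)) :
    ConvolutionExists m Ψ (lsmul ℝ ℝ) μ := fun ξ => by
  obtain ⟨D, -, h⟩ := exists_norm_smul_schwartz_le hm Ψ (Module.finrank ℝ V + 1)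
  refine Integrable.mono' ((integrable_japaneseBracket_sub μ ξ).const_mul _) ?_
    (Filter.Eventually.of_forall fun η => h ξ η)
  exact hmc.smul (Ψ.continuous.comp (by fun_prop)).aestronglyMeasurable

theorem exists_norm_convolution_schwartz_le (hm : ∀ ξ, |m ξ| ≤ C * japaneseBracket ξ ^ a)
    (Ψ : 𝓢(V, F)) :
    ∃ D : ℝ, 0 ≤ D ∧ ∀ ξ, ‖(m ⋆[lsmul ℝ ℝ, μ] Ψ) ξ‖ ≤ D * japaneseBracket ξ ^ a := by
  obtain ⟨D, hD, h⟩ := exists_norm_smul_schwartz_le hm Ψ (Module.finrank ℝ V + 1)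
  set w : V → ℝ := fun η => japaneseBracket η ^ (-((Module.finrank ℝ V : ℝ) + 1))
  refine ⟨D * ∫ η, w η ∂μ,
    mul_nonneg hD (integral_nonneg fun η => (japaneseBracket_rpow_pos _ _).le), fun ξ => ?_⟩
  refine (norm_integral_le_of_norm_le ((integrable_japaneseBracket_sub μ ξ).const_mul _)
    (Filter.Eventually.of_forall fun η => h ξ η)).trans_eq ?_
  rw [integral_const_mul, integral_sub_left_eq_self w μ ξ]
  ring

theorem hasFDerivAt_convolution_schwartz (hmc : AEStronglyMeasurable m μ)
    (hm : ∀ ξ, |m ξ| ≤ C * japaneseBracket ξ ^ a) (Ψ : 𝓢(V, F)) (ξ : V) :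
    HasFDerivAt (m ⋆[lsmul ℝ ℝ, μ] Ψ) ((m ⋆[lsmul ℝ ℝ, μ] fderivCLM ℝ V F Ψ) ξ) ξ := by
  set r : ℝ := Module.finrank ℝ V + 1
  obtain ⟨D, hD, h⟩ := exists_norm_smul_schwartz_le hm (fderivCLM ℝ V F Ψ) r
  refine hasFDerivAt_integral_of_dominated_of_fderiv_le (s := Metric.ball ξ 1)
    (F' := fun z η => m η • fderivCLM ℝ V F Ψ (z - η))
    (bound := fun η => D * (2 ^ |a| * (1 + 1) ^ |a| * japaneseBracket ξ ^ a) *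
      (2 ^ |-r| * (1 + 1) ^ |-r| * japaneseBracket (ξ - η) ^ (-r)))
    (Metric.ball_mem_nhds ξ one_pos) ?_ (convolutionExists_schwartz hmc hm Ψ ξ)
    (convolutionExists_schwartz hmc hm _ ξ).aestronglyMeasurable ?_ ?_ ?_
  · exact Filter.Eventually.of_forall fun z =>
      (convolutionExists_schwartz hmc hm Ψ z).aestronglyMeasurable
  · refine Filter.Eventually.of_forall fun η z hz => (h z η).trans ?_
    have hz' : ‖z - ξ‖ ≤ 1 := (mem_ball_iff_norm.1 hz).le
    have := japaneseBracket_rpow_pos (z - η) (-r)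
    have := japaneseBracket_rpow_pos ξ a
    gcongr
    · exact japaneseBracket_rpow_le_of_norm_sub_le hz' a
    · exact japaneseBracket_rpow_le_of_norm_sub_le (by simpa using hz') _
  · exact ((integrable_japaneseBracket_sub μ ξ).const_mul _).const_mul _
  · refine Filter.Eventually.of_forall fun η z _ => ?_
    have h := (Ψ.differentiableAt (x := z - η)).hasFDerivAt.comp z
      ((hasFDerivAt_id z).sub_const η)
    exact HasFDerivAt.const_smul (by simpa [Function.comp_def] using h) (m η)

theorem fderiv_convolution_schwartz (hmc : AEStronglyMeasurable m μ)
    (hm : ∀ ξ, |m ξ| ≤ C * japaneseBracket ξ ^ a) (Ψ : 𝓢(V, F)) :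
    fderiv ℝ (m ⋆[lsmul ℝ ℝ, μ] Ψ) = m ⋆[lsmul ℝ ℝ, μ] fderivCLM ℝ V F Ψ :=
  funext fun ξ => (hasFDerivAt_convolution_schwartz hmc hm Ψ ξ).fderiv

theorem contDiff_convolution_schwartz (hmc : AEStronglyMeasurable m μ)
    (hm : ∀ ξ, |m ξ| ≤ C * japaneseBracket ξ ^ a) (Ψ : 𝓢(V, F)) (j : ℕ) :
    ContDiff ℝ j (m ⋆[lsmul ℝ ℝ, μ] Ψ) := by
  induction j generalizing F with
  | zero =>
    exact contDiff_zero.2 (continuous_iff_continuousAt.2 fun ξ =>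
      (hasFDerivAt_convolution_schwartz hmc hm Ψ ξ).continuousAt)
  | succ j ih =>
    have h := ih (fderivCLM ℝ V F Ψ)
    rw [← fderiv_convolution_schwartz hmc hm] at h
    push_cast
    exact contDiff_succ_iff_fderiv.2
      ⟨fun ξ => (hasFDerivAt_convolution_schwartz hmc hm Ψ ξ).differentiableAt, by simp, h⟩

theorem isSymbol_convolution_schwartz (hmc : AEStronglyMeasurable m μ)
    (hm : ∀ ξ, |m ξ| ≤ C * japaneseBracket ξ ^ a) (Ψ : 𝓢(V, F)) :
    IsSymbol a (m ⋆[lsmul ℝ ℝ, μ] Ψ) := by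
  refine ⟨contDiff_infty.2 fun j => contDiff_convolution_schwartz hmc hm Ψ j, fun j => ?_⟩
  induction j generalizing F with
  | zero =>
    obtain ⟨D, hD, h⟩ := exists_norm_convolution_schwartz_le (μ := μ) hm Ψ
    exact ⟨D, hD, fun ξ => by rw [norm_iteratedFDeriv_zero]; exact h ξ⟩
  | succ j ih =>
    obtain ⟨D, hD, h⟩ := ih (fderivCLM ℝ V F Ψ)
    refine ⟨D, hD, fun ξ => ?_⟩
    rw [← norm_iteratedFDeriv_fderiv, fderiv_convolution_schwartz hmc hm]
    exact h ξ

end Convolution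

/-! ### The symbol of the spherical average is a symbol -/

section Dilation

variable {V F : Type*} [NormedAddCommGroup V] [NormedSpace ℝ V] [NormedAddCommGroup F]
  [NormedSpace ℝ F]

variable (V) in
/-- The dilation `x ↦ c x` of a normed space, as a linear equivalence with which Schwartz functions
can be composed. -/
def dilation {c : ℝ} (hc : c ≠ 0) : V ≃L[ℝ] V :=
  ContinuousLinearEquiv.smulLeft (Units.mk0 c hc)

theorem dilation_apply {c : ℝ} (hc : c ≠ 0) (x : V) : dilation V hc x = c • x := rfl

theorem hasTemperateGrowth_comp_smul {f : V → F} (hf : f.HasTemperateGrowth) {c : ℝ}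
    (hc : c ≠ 0) : (fun ξ => f (c • ξ)).HasTemperateGrowth :=
  hf.comp (dilation V hc).hasTemperateGrowth

theorem exists_schwartz_eq_one_on_closedBall [FiniteDimensional ℝ V] :
    ∃ χ : 𝓢(V, ℂ), ∀ y, ‖y‖ ≤ 1 → χ y = 1 := by
  let b : ContDiffBump (0 : V) := ⟨1, 2, one_pos, one_lt_two⟩
  have hc : HasCompactSupport fun y => ((b y : ℝ) : ℂ) :=
    b.hasCompactSupport.comp_left Complex.ofReal_zero
  have hs : ContDiff ℝ ∞ fun y => ((b y : ℝ) : ℂ) :=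
    Complex.ofRealCLM.contDiff.comp b.contDiff
  refine ⟨hc.toSchwartzMap hs, fun y hy => ?_⟩
  have : b y = 1 := b.one_of_mem_closedBall (by simpa using hy)
  simp [this]

end Dilation

section Reproduction

open ContinuousLinearMap (lsmul)
open scoped Convolution

variable {n : ℕ}

theorem sphereSymbol_neg (ξ : E n) : sphereSymbol n (-ξ) = sphereSymbol n ξ :=
  sphereSymbol_eq_of_norm_eq (norm_neg ξ)

theorem integrable_prod_sphere_cexp_mul {θ : Metric.sphere (0 : E n) 1 × E n → ℝ}
    (hθ : Continuous θ) (Φ : 𝓢(E n, ℂ)) :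
    Integrable (fun z : Metric.sphere (0 : E n) 1 × E n =>
      Complex.exp ((θ z : ℂ) * Complex.I) * Φ z.2) ((sphereMeasure n).prod volume) := by
  refine Integrable.mono ((Φ.integrable (μ := volume)).comp_snd (sphereMeasure n))
    (by fun_prop) (Filter.Eventually.of_forall fun z => ?_)
  rw [norm_mul, Complex.norm_exp_ofReal_mul_I, one_mul]

theorem cexp_inner_eq_integral_mul (Φ : 𝓢(E n, ℂ)) {y : E n} (hy : 𝓕 Φ y = 1) (ξ : E n) :
    Complex.exp (((-inner ℝ y ξ : ℝ) : ℂ) * Complex.I) =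
      ∫ ζ, Complex.exp (((-inner ℝ y (ξ + (2 * Real.pi) • ζ) : ℝ) : ℂ) * Complex.I) * Φ ζ := by
  rw [fourier_coe, Real.fourier_eq'] at hy
  refine (mul_one (Complex.exp _)).symm.trans ((congrArg (_ * ·) hy.symm).trans ?_)
  refine (integral_const_mul _ _).symm.trans (integral_congr_ae (.of_forall fun ζ => ?_))
  simp only [smul_eq_mul]
  rw [← mul_assoc, ← Complex.exp_add, ← add_mul, ← Complex.ofReal_add]
  congr 4
  rw [inner_add_right, inner_smul_right, real_inner_comm ζ]
  ring

theorem sphereSymbol_eq_integral_mul (Φ : 𝓢(E n, ℂ)) (hΦ : ∀ y, ‖y‖ ≤ 1 → 𝓕 Φ y = 1) (ξ : E n) :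
    (sphereSymbol n ξ : ℂ) =
      ∫ ζ, (sphereSymbol n (ξ + (2 * Real.pi) • ζ) : ℂ) * Φ ζ := by
  have hθ : Continuous fun z : Metric.sphere (0 : E n) 1 × E n =>
      -inner ℝ (z.1 : E n) (ξ + (2 * Real.pi) • z.2) := by fun_prop
  have hint : Integrable (Function.uncurry fun (y : Metric.sphere (0 : E n) 1) (ζ : E n) =>
      Complex.exp (((-inner ℝ (y : E n) (ξ + (2 * Real.pi) • ζ) : ℝ) : ℂ) * Complex.I) * Φ ζ)
      ((sphereMeasure n).prod volume) :=
    integrable_prod_sphere_cexp_mul hθ Φ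
  rw [← integral_cexp_inner_sphere, integral_congr_ae (.of_forall
    fun y : Metric.sphere (0 : E n) 1 =>
      cexp_inner_eq_integral_mul Φ (hΦ (y : E n) (by simp)) ξ), integral_integral_swap hint]
  exact integral_congr_ae (.of_forall fun ζ =>
    (integral_mul_const _ _).trans (by rw [integral_cexp_inner_sphere]))

/-- The surface measure lives in the unit ball, so its Fourier transform is reproduced by
convolution with the Fourier transform of a cutoff that is `1` there. -/
theorem exists_sphereSymbol_eq_convolution (n : ℕ) : ∃ Ψ : 𝓢(E n, ℂ),
    ∀ ξ, (sphereSymbol n ξ : ℂ) = (sphereSymbol n ⋆[lsmul ℝ ℝ, volume] Ψ) ξ := by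
  obtain ⟨χ, hχ⟩ := exists_schwartz_eq_one_on_closedBall (V := E n)
  have hΦ : ∀ y, ‖y‖ ≤ 1 → 𝓕 (𝓕⁻ χ) y = 1 := fun y hy => by
    rw [FourierTransform.fourier_fourierInv_eq]
    exact hχ y hy
  have hpi : 2 * Real.pi ≠ 0 := by positivity
  have hc : -(2 * Real.pi)⁻¹ ≠ 0 := by simp [Real.pi_ne_zero]
  set c : ℝ := |((2 * Real.pi) ^ Module.finrank ℝ (E n))⁻¹|
  refine ⟨c • compCLMOfContinuousLinearEquiv ℝ (dilation (E n) hc) (𝓕⁻ χ), fun ξ => ?_⟩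
  have hscale := Measure.integral_comp_smul (volume : Measure (E n))
    (fun x => (sphereSymbol n (ξ + x) : ℂ) * 𝓕⁻ χ ((2 * Real.pi)⁻¹ • x)) (2 * Real.pi)
  simp only [smul_smul, inv_mul_cancel₀ hpi, one_smul] at hscale
  rw [sphereSymbol_eq_integral_mul _ hΦ, hscale, ← integral_sub_right_eq_self _ ξ, ← integral_smul]
  refine integral_congr_ae (Filter.Eventually.of_forall fun η => ?_)
  simp only [add_sub_cancel, smul_apply, compCLMOfContinuousLinearEquiv_apply,
    Function.comp_apply, dilation_apply, neg_smul, ← smul_neg, neg_sub,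
    ContinuousLinearMap.lsmul_apply]
  rw [smul_comm, Complex.real_smul (x := sphereSymbol n η)]

theorem isSymbol_sphereSymbol (hn : 1 ≤ n) :
    IsSymbol (-(((n : ℝ) - 1) / 2)) fun ξ : E n => (sphereSymbol n ξ : ℂ) := by
  obtain ⟨C, -, h⟩ := exists_abs_sphereSymbol_le hn
  obtain ⟨Ψ, hΨ⟩ := exists_sphereSymbol_eq_convolution n
  rw [funext hΨ]
  exact isSymbol_convolution_schwartz (continuous_sphereSymbol n).aestronglyMeasurable h Ψ

end Reproduction

/-! ### The operator as a Fourier multiplier -/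

section Multiplier

variable {n : ℕ}

/-- The operator `M(D)` with symbol `M` in the normalization `∫ f(x) exp(-i x·η) dx` of the Fourier
transform, whose variable `η` is `2π` times that of Mathlib's transform. -/
def symbolOperator (M : E n → ℂ) : 𝓢'(E n, ℂ) →L[ℂ] 𝓢'(E n, ℂ) :=
  TemperedDistribution.fourierMultiplierCLM ℂ fun ξ => M ((2 * Real.pi) • ξ)

/-- The symbol `-|η|² m(η)^N` of `Δ (A₁)^N`, where `m` is the symbol of `A₁`. -/
def averageSymbol (n N : ℕ) (η : E n) : ℂ :=
  -(((‖η‖ ^ 2 : ℝ) : ℂ) * (sphereSymbol n η : ℂ) ^ N)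

theorem isSymbol_averageSymbol (hn : 1 ≤ n) (N : ℕ) :
    IsSymbol (2 - ((n : ℝ) - 1) / 2 * N) (averageSymbol n N) := by
  have h := (IsSymbol.norm_sq.mul ((isSymbol_sphereSymbol hn).pow N)).neg
  have e : 2 + (N : ℝ) * -(((n : ℝ) - 1) / 2) = 2 - ((n : ℝ) - 1) / 2 * N := by ring
  rw [e] at h
  exact h

theorem two_pi_ne_zero : 2 * Real.pi ≠ 0 := mul_ne_zero two_ne_zero Real.pi_ne_zero

theorem hasTemperateGrowth_sphereSymbol_two_pi (hn : 1 ≤ n) :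
    (fun ξ : E n => (sphereSymbol n ((2 * Real.pi) • ξ) : ℂ)).HasTemperateGrowth :=
  hasTemperateGrowth_comp_smul (isSymbol_sphereSymbol hn).hasTemperateGrowth two_pi_ne_zero

theorem schwartz_eq_integral_cexp_mul (ψ : 𝓢(E n, ℂ)) (x : E n) :
    ψ x = ∫ v, Complex.exp (((-2 * Real.pi * inner ℝ v x : ℝ) : ℂ) * Complex.I) *
      (𝓕⁻ ψ : 𝓢(E n, ℂ)) v := by
  conv_lhs => rw [← FourierTransform.fourier_fourierInv_eq (F := 𝓢(E n, ℂ)) ψ]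
  rw [fourier_coe, Real.fourier_eq']
  simp only [smul_eq_mul]

theorem integral_cexp_inner_sub_sphere (x v : E n) :
    ∫ y : Metric.sphere (0 : E n) 1, Complex.exp (((-2 * Real.pi * inner ℝ v (x - (y : E n)) : ℝ) :
      ℂ) * Complex.I) ∂sphereMeasure n =
      Complex.exp (((-2 * Real.pi * inner ℝ v x : ℝ) : ℂ) * Complex.I) *
        sphereSymbol n ((2 * Real.pi) • v) := by
  rw [← sphereSymbol_neg, ← integral_cexp_inner_sphere, ← integral_const_mul]
  congr with y
  rw [← Complex.exp_add, ← add_mul, ← Complex.ofReal_add]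
  congr 3
  rw [inner_sub_right, inner_neg_right, inner_smul_right, real_inner_comm v]
  ring

theorem sphericalAverageSchwartz_eq (hn : 1 ≤ n) (ψ : 𝓢(E n, ℂ)) :
    sphericalAverageSchwartz n ψ =
      𝓕 (smulLeftCLM ℂ (fun ξ : E n => (sphereSymbol n ((2 * Real.pi) • ξ) : ℂ)) (𝓕⁻ ψ)) := by
  ext x
  have hθ : Continuous fun z : Metric.sphere (0 : E n) 1 × E n =>
      -2 * Real.pi * inner ℝ z.2 (x - (z.1 : E n)) := by fun_prop
  have hint : Integrable (Function.uncurry fun (y : Metric.sphere (0 : E n) 1) (v : E n) =>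
      Complex.exp (((-2 * Real.pi * inner ℝ v (x - (y : E n)) : ℝ) : ℂ) * Complex.I) *
        (𝓕⁻ ψ : 𝓢(E n, ℂ)) v) ((sphereMeasure n).prod volume) :=
    integrable_prod_sphere_cexp_mul hθ (𝓕⁻ ψ)
  rw [sphericalAverageSchwartz_apply, fourier_coe, Real.fourier_eq',
    integral_congr_ae (.of_forall fun y : Metric.sphere (0 : E n) 1 =>
      schwartz_eq_integral_cexp_mul ψ (x - (y : E n))), integral_integral_swap hint]
  refine integral_congr_ae (.of_forall fun v => ?_)
  refine (integral_mul_const _ _).trans ?_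
  rw [integral_cexp_inner_sub_sphere]
  simp only [smulLeftCLM_apply_apply (hasTemperateGrowth_sphereSymbol_two_pi hn), smul_eq_mul,
    mul_assoc]

theorem sphericalAverageDistribution_eq (hn : 1 ≤ n) (f : 𝓢'(E n, ℂ)) :
    sphericalAverageDistribution n f = TemperedDistribution.fourierMultiplierCLM ℂ
      (fun ξ : E n => (sphereSymbol n ((2 * Real.pi) • ξ) : ℂ)) f := by
  ext ψ
  rw [TemperedDistribution.fourierMultiplierCLM_apply_apply, ← sphericalAverageSchwartz_eq hn]
  rfl

theorem iterate_sphericalAverageDistribution_eq (hn : 1 ≤ n) (N : ℕ) (f : 𝓢'(E n, ℂ)) :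
    (sphericalAverageDistribution n)^[N] f = TemperedDistribution.fourierMultiplierCLM ℂ
      (fun ξ : E n => (sphereSymbol n ((2 * Real.pi) • ξ) : ℂ) ^ N) f := by
  have ht := hasTemperateGrowth_sphereSymbol_two_pi hn
  have htN (M : ℕ) :
      (fun ξ : E n => (sphereSymbol n ((2 * Real.pi) • ξ) : ℂ) ^ M).HasTemperateGrowth := ht.pow M
  induction N with
  | zero => simp
  | succ N ih =>
    rw [Function.iterate_succ_apply', ih, sphericalAverageDistribution_eq hn,
      TemperedDistribution.fourierMultiplierCLM_fourierMultiplierCLM_apply (htN N) ht]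
    congr 1

theorem laplacianIteratedAverage_eq_symbolOperator (hn : 1 ≤ n) (N : ℕ) :
    laplacianIteratedAverage n N = symbolOperator (averageSymbol n N) := by
  ext1 f
  have ht := hasTemperateGrowth_sphereSymbol_two_pi hn
  have htN : (fun ξ : E n => (sphereSymbol n ((2 * Real.pi) • ξ) : ℂ) ^ N).HasTemperateGrowth :=
    ht.pow N
  have hs : (fun ξ : E n => ((‖ξ‖ ^ 2 : ℝ) : ℂ)).HasTemperateGrowth :=
    IsSymbol.norm_sq.hasTemperateGrowth
  rw [symbolOperator, laplacianIteratedAverage,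
    TemperedDistribution.laplacian_eq_fourierMultiplierCLM,
    iterate_sphericalAverageDistribution_eq hn,
    TemperedDistribution.fourierMultiplierCLM_fourierMultiplierCLM_apply htN hs,
    ← Complex.coe_smul, ← _root_.smul_apply,
    ← TemperedDistribution.fourierMultiplierCLM_smul (htN.mul hs)]
  congr 2
  ext ξ
  simp only [averageSymbol, Pi.smul_apply, Pi.mul_apply, smul_eq_mul, norm_smul, mul_pow,
    Real.norm_eq_abs, sq_abs]
  push_cast
  ring

end Multiplier

/-! ### Convolution estimates in `L^p` -/

section Interpolation

variable {α : Type*} [MeasurableSpace α] {μ : Measure α}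

theorem eLpNorm_le_of_enorm_le {F : Type*} [ENorm F] {h : α → F} {p₁ p₂ D : ℝ≥0∞} (hp₁ : p₁ ≠ 0)
    (hp : p₁ ≤ p₂) (hb : ∀ y, ‖h y‖ₑ ≤ D) (h₁ : eLpNorm h p₁ μ ≤ D) : eLpNorm h p₂ μ ≤ D := by
  rcases eq_or_ne p₂ ⊤ with rfl | h2
  · rw [eLpNorm_exponent_top]
    exact eLpNormEssSup_le_of_ae_enorm_bound (Filter.Eventually.of_forall hb)
  have h1 : p₁ ≠ ⊤ := ne_top_of_le_ne_top h2 hp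
  have hp₂ : p₂ ≠ 0 := (hp₁.bot_lt.trans_le hp).ne'
  have r1 : 0 < p₁.toReal := ENNReal.toReal_pos hp₁ h1
  have r2 : 0 < p₂.toReal := ENNReal.toReal_pos hp₂ h2
  have r12 : p₁.toReal ≤ p₂.toReal := ENNReal.toReal_mono h2 hp
  rw [eLpNorm_eq_lintegral_rpow_enorm_toReal hp₁ h1, one_div, ENNReal.rpow_inv_le_iff r1] at h₁
  rw [eLpNorm_eq_lintegral_rpow_enorm_toReal hp₂ h2, one_div, ENNReal.rpow_inv_le_iff r2]
  have hsplit (t : ℝ≥0∞) : t ^ p₂.toReal = t ^ (p₂.toReal - p₁.toReal) * t ^ p₁.toReal := by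
    rw [← ENNReal.rpow_add_of_nonneg _ _ (by linarith) r1.le, sub_add_cancel]
  rcases eq_or_ne D ⊤ with rfl | hD
  · rw [ENNReal.top_rpow_of_pos r2]; exact le_top
  calc ∫⁻ x, ‖h x‖ₑ ^ p₂.toReal ∂μ
      ≤ ∫⁻ x, D ^ (p₂.toReal - p₁.toReal) * ‖h x‖ₑ ^ p₁.toReal ∂μ := by
        refine lintegral_mono fun x => ?_
        rw [hsplit]
        gcongr
        exact hb x
    _ = D ^ (p₂.toReal - p₁.toReal) * ∫⁻ x, ‖h x‖ₑ ^ p₁.toReal ∂μ :=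
        lintegral_const_mul' _ _ (ENNReal.rpow_ne_top_of_nonneg (by linarith) hD)
    _ ≤ D ^ (p₂.toReal - p₁.toReal) * D ^ p₁.toReal := by gcongr
    _ = D ^ p₂.toReal := (hsplit D).symm

theorem lintegral_mul_rpow_le {f w : α → ℝ≥0∞} (hf : AEMeasurable f μ) (hw : AEMeasurable w μ)
    {r : ℝ} (hr : 1 ≤ r) :
    (∫⁻ x, f x * w x ∂μ) ^ r ≤ (∫⁻ x, f x ^ r * w x ∂μ) * (∫⁻ x, w x ∂μ) ^ (r - 1) := by
  have hr0 : 0 < r := one_pos.trans_le hr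
  have hr1 : 0 ≤ 1 - r⁻¹ := sub_nonneg.2 (inv_le_one_of_one_le₀ hr)
  have hsplit (x : α) : f x * w x = (f x ^ r * w x) ^ r⁻¹ * w x ^ (1 - r⁻¹) := by
    rw [ENNReal.mul_rpow_of_nonneg _ _ (inv_pos.2 hr0).le, ← ENNReal.rpow_mul,
      mul_inv_cancel₀ hr0.ne', ENNReal.rpow_one, mul_assoc,
      ← ENNReal.rpow_add_of_nonneg _ _ (inv_pos.2 hr0).le hr1, add_sub_cancel, ENNReal.rpow_one]
  have holder := ENNReal.lintegral_mul_norm_pow_le (μ := μ) ((hf.pow_const r).mul hw) hw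
    (inv_pos.2 hr0).le hr1 (add_sub_cancel _ _)
  simp only [Pi.mul_apply, ← hsplit] at holder
  refine (ENNReal.rpow_le_rpow holder hr0.le).trans_eq ?_
  rw [ENNReal.mul_rpow_of_nonneg _ _ hr0.le, ← ENNReal.rpow_mul, ← ENNReal.rpow_mul,
    inv_mul_cancel₀ hr0.ne', ENNReal.rpow_one, sub_mul, inv_mul_cancel₀ hr0.ne', one_mul]

end Interpolation

section Young

variable {G : Type*} [AddCommGroup G] [MeasurableSpace G] [MeasurableAdd₂ G] {μ : Measure G}
  {K g : G → ℂ} {M p : ℝ≥0∞}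

theorem lintegral_enorm_mul_sub_le [μ.IsAddLeftInvariant] (hp : 1 ≤ p)
    (hK : StronglyMeasurable K) (hb : ∀ x, ‖K x‖ₑ ≤ M) (h1 : ∫⁻ x, ‖K x‖ₑ ∂μ ≤ M)
    (hg : AEStronglyMeasurable g μ) (y : G) :
    ∫⁻ x, ‖g x * K (x - y)‖ₑ ∂μ ≤ M * eLpNorm g p μ := by
  have := ENNReal.HolderConjugate.conjExponent hp
  have hsub := measurePreserving_sub_right μ y
  have holder := eLpNorm_smul_le_mul_eLpNorm (p := p.conjExponent) (q := p) (r := 1) hg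
    (hK.aestronglyMeasurable.comp_measurePreserving hsub)
  rw [eLpNorm_comp_measurePreserving hK.aestronglyMeasurable hsub,
    eLpNorm_one_eq_lintegral_enorm] at holder
  calc ∫⁻ x, ‖g x * K (x - y)‖ₑ ∂μ = ∫⁻ x, ‖((K ∘ fun x => x - y) • g) x‖ₑ ∂μ := by
        simp only [Pi.smul_apply', Function.comp_apply, smul_eq_mul, mul_comm]
    _ ≤ eLpNorm K p.conjExponent μ * eLpNorm g p μ := holder
    _ ≤ M * eLpNorm g p μ := by
        gcongr
        exact eLpNorm_le_of_enorm_le one_ne_zero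
          (ENNReal.HolderConjugate.one_le p.conjExponent p) hb
          (by rwa [eLpNorm_one_eq_lintegral_enorm])

variable [MeasurableNeg G]

theorem aestronglyMeasurable_mul_comp_sub (hK : StronglyMeasurable K)
    (hg : AEStronglyMeasurable g μ) :
    AEStronglyMeasurable (fun z : G × G => g z.2 * K (z.2 - z.1)) (μ.prod μ) :=
  hg.comp_snd.mul (hK.comp_measurable (measurable_snd.sub measurable_fst)).aestronglyMeasurable

variable [SFinite μ] [μ.IsAddLeftInvariant]

theorem integral_mul_integral_sub_mul (hp : 1 ≤ p) (hK : StronglyMeasurable K) (hM : M ≠ ⊤)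
    (hb : ∀ x, ‖K x‖ₑ ≤ M) (h1 : ∫⁻ x, ‖K x‖ₑ ∂μ ≤ M) (hg : MemLp g p μ) {ψ : G → ℂ}
    (hψ : Integrable ψ μ) :
    ∫ x, g x * ∫ y, K (x - y) * ψ y ∂μ ∂μ = ∫ y, (∫ x, g x * K (x - y) ∂μ) * ψ y ∂μ := by
  have hm : AEStronglyMeasurable (Function.uncurry fun y x : G => g x * K (x - y) * ψ y)
      (μ.prod μ) := (aestronglyMeasurable_mul_comp_sub hK hg.1).mul hψ.1.comp_fst
  have hfin : HasFiniteIntegral (Function.uncurry fun y x : G => g x * K (x - y) * ψ y)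
      (μ.prod μ) := by
    rw [HasFiniteIntegral, lintegral_prod _ hm.enorm]
    calc _ ≤ ∫⁻ y, M * eLpNorm g p μ * ‖ψ y‖ₑ ∂μ := by
          refine lintegral_mono fun y => ?_
          simp only [Function.uncurry, enorm_mul _ (ψ y)]
          rw [lintegral_mul_const' _ _ enorm_ne_top]
          gcongr
          exact lintegral_enorm_mul_sub_le hp hK hb h1 hg.1 y
      _ = M * eLpNorm g p μ * ∫⁻ y, ‖ψ y‖ₑ ∂μ :=
          lintegral_const_mul' _ _ (ENNReal.mul_ne_top hM hg.2.ne)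
      _ < ⊤ := ENNReal.mul_lt_top (ENNReal.mul_lt_top hM.lt_top hg.2) hψ.2
  simp_rw [← integral_mul_const]
  rw [integral_integral_swap ⟨hm, hfin⟩]
  simp_rw [← integral_const_mul, mul_assoc]

variable [μ.IsNegInvariant]

theorem lintegral_lintegral_mul_sub_rpow_le {f w : G → ℝ≥0∞}
    (hf : AEMeasurable f μ) (hw : Measurable w) {r : ℝ} (hr : 1 ≤ r) :
    ∫⁻ y, (∫⁻ x, f x * w (x - y) ∂μ) ^ r ∂μ ≤ (∫⁻ x, w x ∂μ) ^ r * ∫⁻ x, f x ^ r ∂μ := by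
  set c := ∫⁻ x, w x ∂μ
  have hmass (y : G) : ∫⁻ x, w (x - y) ∂μ = c := lintegral_sub_right_eq_self w y
  have hmass' (x : G) : ∫⁻ y, w (x - y) ∂μ = c := lintegral_sub_left_eq_self w x
  have hmeas : AEMeasurable (Function.uncurry fun y x : G => f x ^ r * w (x - y)) (μ.prod μ) :=
    ((hf.pow_const _).comp_quasiMeasurePreserving Measure.quasiMeasurePreserving_snd).mul
      (hw.comp (measurable_snd.sub measurable_fst)).aemeasurable
  have hpow : c * c ^ (r - 1) = c ^ r := by
    conv_lhs => rw [← ENNReal.rpow_one c, ← ENNReal.rpow_mul, one_mul]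
    rw [← ENNReal.rpow_add_of_nonneg _ _ zero_le_one (by linarith), add_sub_cancel]
  calc _ ≤ ∫⁻ y, (∫⁻ x, f x ^ r * w (x - y) ∂μ) * c ^ (r - 1) ∂μ := lintegral_mono fun y => by
        rw [← hmass y]
        exact lintegral_mul_rpow_le hf (hw.comp (measurable_id.sub_const y)).aemeasurable hr
    _ = (∫⁻ y, ∫⁻ x, f x ^ r * w (x - y) ∂μ ∂μ) * c ^ (r - 1) :=
        lintegral_mul_const'' _ hmeas.lintegral_prod_right'
    _ = (∫⁻ x, ∫⁻ y, f x ^ r * w (x - y) ∂μ ∂μ) * c ^ (r - 1) := by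
        rw [lintegral_lintegral_swap hmeas]
    _ = (∫⁻ x, f x ^ r * c ∂μ) * c ^ (r - 1) := by
        congr 1
        refine lintegral_congr fun x => ?_
        have hwx : Measurable fun y => w (x - y) := hw.comp (measurable_id.const_sub x)
        rw [lintegral_const_mul _ hwx, hmass']
    _ = _ := by rw [lintegral_mul_const'' _ (hf.pow_const _), mul_assoc, hpow, mul_comm]

theorem eLpNorm_integral_mul_sub_le_self (hp : 1 ≤ p)
    (hK : StronglyMeasurable K) (hb : ∀ x, ‖K x‖ₑ ≤ M) (h1 : ∫⁻ x, ‖K x‖ₑ ∂μ ≤ M)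
    (hg : AEStronglyMeasurable g μ) :
    eLpNorm (fun y => ∫ x, g x * K (x - y) ∂μ) p μ ≤ M * eLpNorm g p μ := by
  rcases eq_or_ne p ⊤ with rfl | hp'
  · rw [eLpNorm_exponent_top]
    exact eLpNormEssSup_le_of_ae_enorm_bound (.of_forall fun y =>
      (enorm_integral_le_lintegral_enorm _).trans
        (lintegral_enorm_mul_sub_le hp hK hb h1 hg y))
  have hp0 : p ≠ 0 := (one_pos.trans_le hp).ne'
  have r : 0 < p.toReal := ENNReal.toReal_pos hp0 hp'
  have r1 : 1 ≤ p.toReal := ENNReal.toReal_one ▸ ENNReal.toReal_mono hp' hp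
  rw [eLpNorm_eq_lintegral_rpow_enorm_toReal hp0 hp', one_div, ENNReal.rpow_inv_le_iff r]
  calc _ ≤ ∫⁻ y, (∫⁻ x, ‖g x‖ₑ * ‖K (x - y)‖ₑ ∂μ) ^ p.toReal ∂μ := by
        simp_rw [← enorm_mul]
        gcongr
        exact enorm_integral_le_lintegral_enorm _
    _ ≤ (∫⁻ x, ‖K x‖ₑ ∂μ) ^ p.toReal * ∫⁻ x, ‖g x‖ₑ ^ p.toReal ∂μ :=
        lintegral_lintegral_mul_sub_rpow_le hg.enorm hK.enorm r1
    _ ≤ M ^ p.toReal * ∫⁻ x, ‖g x‖ₑ ^ p.toReal ∂μ := by gcongr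
    _ = (M * eLpNorm g p μ) ^ p.toReal := by
        rw [ENNReal.mul_rpow_of_nonneg _ _ r.le, eLpNorm_eq_lintegral_rpow_enorm_toReal hp0 hp',
          ← ENNReal.rpow_mul, one_div_mul_cancel r.ne', ENNReal.rpow_one]

theorem eLpNorm_integral_mul_sub_le {p₁ p₂ : ℝ≥0∞} (hp₁ : 1 ≤ p₁)
    (hp : p₁ ≤ p₂) (hK : StronglyMeasurable K) (hb : ∀ x, ‖K x‖ₑ ≤ M)
    (h1 : ∫⁻ x, ‖K x‖ₑ ∂μ ≤ M) (hg : AEStronglyMeasurable g μ) :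
    eLpNorm (fun y => ∫ x, g x * K (x - y) ∂μ) p₂ μ ≤ M * eLpNorm g p₁ μ :=
  eLpNorm_le_of_enorm_le (one_pos.trans_le hp₁).ne' hp
    (fun y => (enorm_integral_le_lintegral_enorm _).trans
      (lintegral_enorm_mul_sub_le hp₁ hK hb h1 hg y))
    (eLpNorm_integral_mul_sub_le_self hp₁ hK hb h1 hg)

theorem memLp_integral_mul_sub {p₁ p₂ : ℝ≥0∞} (hp₁ : 1 ≤ p₁) (hp : p₁ ≤ p₂)
    (hK : StronglyMeasurable K) (hM : M ≠ ⊤) (hb : ∀ x, ‖K x‖ₑ ≤ M)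
    (h1 : ∫⁻ x, ‖K x‖ₑ ∂μ ≤ M) (hg : MemLp g p₁ μ) :
    MemLp (fun y => ∫ x, g x * K (x - y) ∂μ) p₂ μ :=
  ⟨(aestronglyMeasurable_mul_comp_sub hK hg.1).integral_prod_right',
    (eLpNorm_integral_mul_sub_le hp₁ hp hK hb h1 hg.1).trans_lt
      (ENNReal.mul_lt_top hM.lt_top hg.2)⟩

end Young

/-! ### Fourier multipliers with Schwartz symbols -/

section Kernel

variable {n : ℕ}

/-- Composition of a Schwartz function with `w ↦ 2π w`, which turns symbols with respect to the
kernel `e^{-ix·ξ}` into symbols with respect to `e^{-2πix·ξ}`. -/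
def dilateTwoPi (n : ℕ) : 𝓢(E n, ℂ) →L[ℂ] 𝓢(E n, ℂ) :=
  compCLMOfContinuousLinearEquiv ℂ (dilation (E n) two_pi_ne_zero)

theorem dilateTwoPi_apply (b : 𝓢(E n, ℂ)) (w : E n) :
    dilateTwoPi n b w = b ((2 * Real.pi) • w) := rfl

/-- The convolution kernel of the Fourier multiplier with symbol `ξ ↦ b (2πξ - κ)`. -/
def multiplierKernel (b : 𝓢(E n, ℂ)) (κ x : E n) : ℂ :=
  Complex.exp (((-inner ℝ κ x : ℝ) : ℂ) * Complex.I) * 𝓕 (dilateTwoPi n b) x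

theorem continuous_multiplierKernel (b : 𝓢(E n, ℂ)) (κ : E n) :
    Continuous (multiplierKernel b κ) :=
  Continuous.mul (by fun_prop) (SchwartzMap.continuous _)

theorem hasTemperateGrowth_dilate_sub {b : E n → ℂ} (hb : b.HasTemperateGrowth) (κ : E n) :
    (fun ξ => b ((2 * Real.pi) • ξ - κ)).HasTemperateGrowth :=
  hb.comp ((dilation (E n) two_pi_ne_zero).hasTemperateGrowth.sub (.const κ))

theorem integral_cexp_mul_dilate_sub (b : 𝓢(E n, ℂ)) (κ x : E n) :
    ∫ v, Complex.exp (((-2 * Real.pi * inner ℝ v x : ℝ) : ℂ) * Complex.I) *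
      b ((2 * Real.pi) • v - κ) = multiplierKernel b κ x := by
  rw [← integral_add_right_eq_self _ ((2 * Real.pi)⁻¹ • κ), multiplierKernel, fourier_coe,
    Real.fourier_eq', ← integral_const_mul]
  refine integral_congr_ae (Filter.Eventually.of_forall fun w => ?_)
  simp only [smul_add, smul_smul, mul_inv_cancel₀ two_pi_ne_zero, one_smul, add_sub_cancel_right,
    smul_eq_mul, dilateTwoPi_apply]
  rw [← mul_assoc, ← Complex.exp_add, ← add_mul, ← Complex.ofReal_add]
  congr 4
  rw [inner_add_left, inner_smul_left]
  simp only [conj_trivial]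
  have := two_pi_ne_zero
  field_simp
  ring

theorem integrable_dilate_sub (b : 𝓢(E n, ℂ)) (κ : E n) :
    Integrable fun v : E n => b ((2 * Real.pi) • v - κ) := by
  have h := ((dilateTwoPi n b).integrable (μ := volume)).comp_sub_right ((2 * Real.pi)⁻¹ • κ)
  refine h.congr (Filter.Eventually.of_forall fun v => ?_)
  simp only [dilateTwoPi_apply, smul_sub, smul_smul, mul_inv_cancel₀ two_pi_ne_zero, one_smul]

theorem integrable_prod_cexp_mul_dilate_sub_mul (b ψ : 𝓢(E n, ℂ)) (κ x : E n) :
    Integrable (Function.uncurry fun v y : E n =>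
      Complex.exp (((-2 * Real.pi * inner ℝ v (x - y) : ℝ) : ℂ) * Complex.I) *
        (b ((2 * Real.pi) • v - κ) * ψ y)) (volume.prod volume) := by
  have h := (integrable_dilate_sub b κ).mul_prod (ψ.integrable (μ := volume))
  have hc : Continuous fun z : E n × E n =>
      Complex.exp (((-2 * Real.pi * inner ℝ z.1 (x - z.2) : ℝ) : ℂ) * Complex.I) := by
    fun_prop
  refine h.mono (hc.aestronglyMeasurable.mul h.1) (Filter.Eventually.of_forall fun z => ?_)
  simp only [Function.uncurry, norm_mul, Complex.norm_exp_ofReal_mul_I, one_mul, le_refl]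

theorem cexp_mul_fourierInv_eq_integral (ψ : 𝓢(E n, ℂ)) (c : ℂ) (v x : E n) :
    Complex.exp (((-2 * Real.pi * inner ℝ v x : ℝ) : ℂ) * Complex.I) * (c * 𝓕⁻ ψ v) =
      ∫ y, Complex.exp (((-2 * Real.pi * inner ℝ v (x - y) : ℝ) : ℂ) * Complex.I) *
        (c * ψ y) := by
  rw [fourierInv_coe, Real.fourierInv_eq', ← integral_const_mul, ← integral_const_mul]
  congr with y
  have hexp : Complex.exp (((-2 * Real.pi * inner ℝ v (x - y) : ℝ) : ℂ) * Complex.I) =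
      Complex.exp (((-2 * Real.pi * inner ℝ v x : ℝ) : ℂ) * Complex.I) *
        Complex.exp (((2 * Real.pi * inner ℝ y v : ℝ) : ℂ) * Complex.I) := by
    rw [← Complex.exp_add, ← add_mul, ← Complex.ofReal_add]
    congr 3
    rw [inner_sub_right, real_inner_comm v y]
    ring
  rw [hexp, smul_eq_mul]
  ring

theorem fourier_smulLeftCLM_fourierInv (b : 𝓢(E n, ℂ)) (κ : E n) (ψ : 𝓢(E n, ℂ)) (x : E n) :
    𝓕 (smulLeftCLM ℂ (fun ξ : E n => b ((2 * Real.pi) • ξ - κ)) (𝓕⁻ ψ)) x =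
      ∫ y, multiplierKernel b κ (x - y) * ψ y := by
  rw [fourier_coe, Real.fourier_eq']
  simp_rw [smulLeftCLM_apply_apply (hasTemperateGrowth_dilate_sub b.hasTemperateGrowth κ),
    smul_eq_mul, cexp_mul_fourierInv_eq_integral]
  rw [integral_integral_swap (integrable_prod_cexp_mul_dilate_sub_mul b ψ κ x)]
  simp_rw [← integral_cexp_mul_dilate_sub, ← integral_mul_const, mul_assoc]

theorem norm_multiplierKernel (b : 𝓢(E n, ℂ)) (κ x : E n) :
    ‖multiplierKernel b κ x‖ = ‖𝓕 (dilateTwoPi n b) x‖ := by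
  rw [multiplierKernel, norm_mul, Complex.norm_exp_ofReal_mul_I, one_mul]

theorem exists_norm_multiplierKernel_le (n : ℕ) :
    ∃ (s : Finset (ℕ × ℕ)) (C : ℝ), 0 < C ∧ ∀ (b : 𝓢(E n, ℂ)) (κ x : E n),
      ‖multiplierKernel b κ x‖ ≤ C * s.sup (schwartzSeminormFamily ℂ (E n) ℂ) b *
        japaneseBracket x ^ (-((n : ℝ) + 1)) := by
  set L : 𝓢(E n, ℂ) →L[ℂ] 𝓢(E n, ℂ) :=
    (FourierTransform.fourierCLM ℂ 𝓢(E n, ℂ)).comp (dilateTwoPi n)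
  set Q : Seminorm ℂ 𝓢(E n, ℂ) :=
    (Finset.Iic ((n + 1, 0) : ℕ × ℕ)).sup (schwartzSeminormFamily ℂ (E n) ℂ)
  have hQ : Continuous Q :=
    (schwartz_withSeminorms ℂ (E n) ℂ).finset_sups.continuous_seminorm (Finset.Iic (n + 1, 0))
  obtain ⟨s, C, hC, hle⟩ := Seminorm.bound_of_continuous (schwartz_withSeminorms ℂ (E n) ℂ)
    (Q.comp L.toLinearMap) (hQ.comp L.continuous)
  refine ⟨s, 2 ^ (n + 1) * C, by positivity, fun b κ x => ?_⟩
  have hdecay := one_add_le_sup_seminorm_apply (𝕜 := ℂ) (m := (n + 1, 0)) (k := n + 1) (n := 0)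
    le_rfl le_rfl (L b) x
  rw [norm_iteratedFDeriv_zero] at hdecay
  have hx := japaneseBracket_pos x
  have hbracket : japaneseBracket x ^ ((n : ℝ) + 1) ≤ (1 + ‖x‖) ^ (n + 1) :=
    japaneseBracket_rpow_le_one_add_norm_pow x (Nat.cast_succ n).ge
  rw [norm_multiplierKernel, Real.rpow_neg hx.le, ← div_eq_mul_inv,
    le_div_iff₀ (Real.rpow_pos_of_pos hx _)]
  calc ‖L b x‖ * japaneseBracket x ^ ((n : ℝ) + 1) ≤ ‖L b x‖ * (1 + ‖x‖) ^ (n + 1) := by gcongr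
    _ = (1 + ‖x‖) ^ (n + 1) * ‖L b x‖ := mul_comm _ _
    _ ≤ 2 ^ (n + 1) * Q (L b) := hdecay
    _ ≤ 2 ^ (n + 1) * (C * s.sup (schwartzSeminormFamily ℂ (E n) ℂ) b) := by
        gcongr
        exact hle b
    _ = _ := by ring

theorem exists_enorm_multiplierKernel_le (n : ℕ) :
    ∃ (s : Finset (ℕ × ℕ)) (C : ℝ), 0 < C ∧ ∀ (b : 𝓢(E n, ℂ)) (B : ℝ),
      s.sup (schwartzSeminormFamily ℂ (E n) ℂ) b ≤ B → ∀ κ : E n,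
      (∀ x, ‖multiplierKernel b κ x‖ₑ ≤ ENNReal.ofReal (C * B)) ∧
        ∫⁻ x, ‖multiplierKernel b κ x‖ₑ ≤ ENNReal.ofReal (C * B) := by
  obtain ⟨s, C, hC, h⟩ := exists_norm_multiplierKernel_le n
  set w : E n → ℝ := fun x => japaneseBracket x ^ (-((n : ℝ) + 1))
  have hw : Integrable w := integrable_japaneseBracket_rpow (by simp)
  have hw0 (x : E n) : 0 ≤ w x := (japaneseBracket_rpow_pos x _).le
  have hw1 (x : E n) : w x ≤ 1 :=
    Real.rpow_le_one_of_one_le_of_nonpos (one_le_japaneseBracket x)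
      (neg_nonpos.2 (by positivity))
  have hI : 0 ≤ ∫ x, w x := integral_nonneg hw0
  refine ⟨s, C * (1 + ∫ x, w x), by positivity, fun b B hbB κ => ?_⟩
  have hB : 0 ≤ B := (apply_nonneg _ _).trans hbB
  have hK (x : E n) : ‖multiplierKernel b κ x‖ₑ ≤ ENNReal.ofReal (C * B * w x) := by
    rw [← ofReal_norm]
    refine ENNReal.ofReal_le_ofReal ((h b κ x).trans ?_)
    have := hw0 x
    gcongr
  constructor
  · refine fun x => (hK x).trans (ENNReal.ofReal_le_ofReal ?_)
    calc C * B * w x ≤ C * B * (1 + ∫ x, w x) := by gcongr; linarith [hw1 x]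
      _ = _ := by ring
  · refine (lintegral_mono hK).trans ?_
    rw [← ofReal_integral_eq_lintegral_ofReal (hw.const_mul _)
      (.of_forall fun x => mul_nonneg (by positivity) (hw0 x)), integral_const_mul]
    refine ENNReal.ofReal_le_ofReal ?_
    calc C * B * ∫ x, w x ≤ C * B * (1 + ∫ x, w x) := by gcongr; linarith
      _ = _ := by ring

end Kernel

/-! ### The `L^p` norm of a distribution -/

section DistLpNorm

variable {n : ℕ}

theorem distLpNorm_le_of_memLp {p : ℝ≥0∞} {u : 𝓢'(E n, ℂ)} {g : E n → ℂ} (hg : MemLp g p volume)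
    (hu : ∀ ψ : 𝓢(E n, ℂ), u ψ = ∫ x, g x * ψ x) : distLpNorm p u ≤ eLpNorm g p volume :=
  iInf₂_le_of_le g hg (iInf_le _ hu)

theorem le_distLpNorm {p : ℝ≥0∞} {u : 𝓢'(E n, ℂ)} {c : ℝ≥0∞}
    (h : ∀ g : E n → ℂ, MemLp g p volume → (∀ ψ : 𝓢(E n, ℂ), u ψ = ∫ x, g x * ψ x) →
      c ≤ eLpNorm g p volume) : c ≤ distLpNorm p u :=
  le_iInf fun g => le_iInf fun hg => le_iInf fun hu => h g hg hu

theorem exists_memLp_of_distLpNorm_lt {p : ℝ≥0∞} {u : 𝓢'(E n, ℂ)} {c : ℝ≥0∞}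
    (h : distLpNorm p u < c) : ∃ g : E n → ℂ, MemLp g p volume ∧
      (∀ ψ : 𝓢(E n, ℂ), u ψ = ∫ x, g x * ψ x) ∧ eLpNorm g p volume < c := by
  simp only [distLpNorm, iInf_lt_iff] at h
  obtain ⟨g, hg, hu, hc⟩ := h
  exact ⟨g, hg, hu, hc⟩

theorem integrable_memLp_mul_schwartz {p : ℝ≥0∞} (hp : 1 ≤ p) {g : E n → ℂ}
    (hg : MemLp g p volume) (ψ : 𝓢(E n, ℂ)) : Integrable fun x => g x * ψ x := by
  have := ENNReal.HolderConjugate.conjExponent hp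
  exact memLp_one_iff_integrable.1 ((ψ.memLp p.conjExponent volume).mul hg (r := 1))

theorem distLpNorm_zero (p : ℝ≥0∞) : distLpNorm p (0 : 𝓢'(E n, ℂ)) = 0 := by
  refine le_antisymm ?_ bot_le
  refine (distLpNorm_le_of_memLp (g := fun _ => 0) MemLp.zero' fun ψ => ?_).trans_eq ?_
  · simp
  · exact eLpNorm_zero'

theorem distLpNorm_add_le {p : ℝ≥0∞} (hp : 1 ≤ p) (u v : 𝓢'(E n, ℂ)) :
    distLpNorm p (u + v) ≤ distLpNorm p u + distLpNorm p v := by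
  refine ENNReal.le_of_forall_pos_le_add fun ε hε htop => ?_
  have hu := (ENNReal.add_lt_top.1 htop).1
  have hv := (ENNReal.add_lt_top.1 htop).2
  have hε2 : (0 : ℝ≥0∞) < (ε / 2 : ℝ≥0) := by exact_mod_cast half_pos hε
  obtain ⟨g, hg, hgu, hgc⟩ := exists_memLp_of_distLpNorm_lt
    (ENNReal.lt_add_right hu.ne hε2.ne')
  obtain ⟨h, hh, hhv, hhc⟩ := exists_memLp_of_distLpNorm_lt
    (ENNReal.lt_add_right hv.ne hε2.ne')
  refine (distLpNorm_le_of_memLp (hg.add hh) fun ψ => ?_).trans ?_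
  · rw [show (u + v) ψ = u ψ + v ψ from rfl, hgu, hhv, ← integral_add
      (integrable_memLp_mul_schwartz hp hg ψ) (integrable_memLp_mul_schwartz hp hh ψ)]
    simp [add_mul]
  · refine (eLpNorm_add_le hg.1 hh.1 hp).trans ((add_le_add hgc.le hhc.le).trans_eq ?_)
    rw [add_add_add_comm, ← ENNReal.coe_add, add_halves]

theorem distLpNorm_sum_le {p : ℝ≥0∞} (hp : 1 ≤ p) {ι : Type*} (s : Finset ι)
    (u : ι → 𝓢'(E n, ℂ)) : distLpNorm p (∑ i ∈ s, u i) ≤ ∑ i ∈ s, distLpNorm p (u i) := by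
  classical
  induction s using Finset.induction_on with
  | empty => simp [distLpNorm_zero]
  | insert i s hi ih =>
    rw [Finset.sum_insert hi, Finset.sum_insert hi]
    exact (distLpNorm_add_le hp _ _).trans (by gcongr)

theorem distLpNorm_smul_le {p : ℝ≥0∞} (c : ℂ) (u : 𝓢'(E n, ℂ)) :
    distLpNorm p (c • u) ≤ ‖c‖ₑ * distLpNorm p u := by
  rcases eq_or_ne c 0 with rfl | hc
  · have h0 : (0 : ℂ) • u = 0 := by ext ψ; exact zero_mul (u ψ)
    rw [h0, distLpNorm_zero]
    exact zero_le
  have hc' : ‖c‖ₑ ≠ 0 := enorm_ne_zero.2 hc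
  rw [mul_comm, ← ENNReal.div_le_iff hc' enorm_ne_top]
  refine le_distLpNorm fun g hg hgu => ?_
  rw [ENNReal.div_le_iff hc' enorm_ne_top, mul_comm, ← eLpNorm_const_smul]
  refine distLpNorm_le_of_memLp (hg.const_smul c) fun ψ => ?_
  calc (c • u) ψ = c • u ψ := rfl
    _ = ∫ x, (c • g) x * ψ x := by
        simp only [hgu, ← integral_smul, Pi.smul_apply, smul_mul_assoc]

theorem eLpNorm_schwartz_ne_zero {q : ℝ≥0∞} (hq : q ≠ 0) {ψ : 𝓢(E n, ℂ)} (hψ : ψ ≠ 0) :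
    eLpNorm ψ q volume ≠ 0 := fun h => hψ <| by
  rw [eLpNorm_eq_zero_iff ψ.continuous.aestronglyMeasurable hq,
    ψ.continuous.ae_eq_iff_eq volume continuous_zero] at h
  exact DFunLike.coe_injective h

theorem enorm_apply_le_distLpNorm {p : ℝ≥0∞} (hp : 1 ≤ p) (u : 𝓢'(E n, ℂ)) (ψ : 𝓢(E n, ℂ)) :
    ‖u ψ‖ₑ ≤ distLpNorm p u * eLpNorm ψ p.conjExponent volume := by
  rcases eq_or_ne ψ 0 with rfl | hψ
  · rw [map_zero, enorm_zero]
    exact bot_le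
  have hconj := ENNReal.HolderConjugate.conjExponent hp
  have h0 := eLpNorm_schwartz_ne_zero
    (one_pos.trans_le (ENNReal.HolderConjugate.one_le p.conjExponent p)).ne' hψ
  have htop : eLpNorm ψ p.conjExponent volume ≠ ⊤ := (ψ.memLp p.conjExponent volume).2.ne
  rw [← ENNReal.div_le_iff h0 htop]
  refine le_distLpNorm fun g hg hu => ?_
  rw [ENNReal.div_le_iff h0 htop, hu]
  calc ‖∫ x, g x * ψ x‖ₑ ≤ ∫⁻ x, ‖g x * ψ x‖ₑ := enorm_integral_le_lintegral_enorm _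
    _ = eLpNorm (fun x => g x * ψ x) 1 volume := eLpNorm_one_eq_lintegral_enorm.symm
    _ ≤ eLpNorm g p volume * eLpNorm ψ p.conjExponent volume :=
        eLpNorm_smul_le_mul_eLpNorm (f := ψ) (φ := g) ψ.continuous.aestronglyMeasurable hg.1

theorem exists_distLpNorm_fourierMultiplier_le {p₁ p₂ : ℝ≥0∞} (hp₁ : 1 ≤ p₁) (hp : p₁ ≤ p₂) :
    ∃ (s : Finset (ℕ × ℕ)) (C : ℝ), 0 < C ∧ ∀ (b : 𝓢(E n, ℂ)) (B : ℝ), 0 < B →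
      s.sup (schwartzSeminormFamily ℂ (E n) ℂ) b ≤ B → ∀ (κ : E n) (u : 𝓢'(E n, ℂ)),
      distLpNorm p₂ (TemperedDistribution.fourierMultiplierCLM ℂ
        (fun ξ : E n => b ((2 * Real.pi) • ξ - κ)) u) ≤
        ENNReal.ofReal (C * B) * distLpNorm p₁ u := by
  obtain ⟨s, C, hC, hkernel⟩ := exists_enorm_multiplierKernel_le n
  refine ⟨s, C, hC, fun b B hB hbB κ u => ?_⟩
  obtain ⟨hb, h1⟩ := hkernel b B hbB κ
  have hK := (continuous_multiplierKernel b κ).stronglyMeasurable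
  have hCB : ENNReal.ofReal (C * B) ≠ 0 := by
    rw [Ne, ENNReal.ofReal_eq_zero, not_le]; positivity
  rw [mul_comm (ENNReal.ofReal _), ← ENNReal.div_le_iff hCB ENNReal.ofReal_ne_top]
  refine le_distLpNorm fun g hg hu => ?_
  rw [ENNReal.div_le_iff hCB ENNReal.ofReal_ne_top]
  refine (distLpNorm_le_of_memLp
    (memLp_integral_mul_sub hp₁ hp hK ENNReal.ofReal_ne_top hb h1 hg) fun ψ => ?_).trans
    ((eLpNorm_integral_mul_sub_le hp₁ hp hK hb h1 hg.1).trans_eq (mul_comm _ _))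
  rw [TemperedDistribution.fourierMultiplierCLM_apply_apply, hu]
  simp_rw [fourier_smulLeftCLM_fourierInv]
  exact integral_mul_integral_sub_mul hp₁ hK ENNReal.ofReal_ne_top hb h1 hg ψ.integrable

end DistLpNorm

/-! ### Localization of a symbol -/

section Localize

variable {V : Type*} [NormedAddCommGroup V] [NormedSpace ℝ V]

theorem hasTemperateGrowth_comp_add {F : Type*} [NormedAddCommGroup F] [NormedSpace ℝ F] {f : V → F}
    (hf : f.HasTemperateGrowth) (κ : V) : (fun x => f (x + κ)).HasTemperateGrowth :=
  hf.comp (Function.HasTemperateGrowth.id'.add (.const κ))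

theorem IsSymbol.exists_norm_iteratedFDeriv_comp_add_le {F : Type*} [NormedAddCommGroup F]
    [NormedSpace ℝ F] {a : ℝ} {f : V → F} (hf : IsSymbol a f) (j : ℕ) :
    ∃ C, 0 ≤ C ∧ ∀ κ x, ‖iteratedFDeriv ℝ j (fun y => f (y + κ)) x‖ ≤
      C * japaneseBracket κ ^ a * (1 + ‖x‖) ^ ⌈|a|⌉₊ := by
  obtain ⟨C, hC, h⟩ := hf.bound j
  refine ⟨C * 2 ^ |a|, by positivity, fun κ x => ?_⟩
  have hκ := japaneseBracket_rpow_pos κ a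
  rw [iteratedFDeriv_comp_add_right, add_comm x]
  calc ‖iteratedFDeriv ℝ j f (κ + x)‖ ≤ C * japaneseBracket (κ + x) ^ a := h _
    _ ≤ C * (2 ^ |a| * japaneseBracket κ ^ a * japaneseBracket x ^ |a|) := by
        gcongr
        exact japaneseBracket_add_rpow_le κ x a
    _ ≤ C * (2 ^ |a| * japaneseBracket κ ^ a * (1 + ‖x‖) ^ ⌈|a|⌉₊) := by
        gcongr
        exact japaneseBracket_rpow_le_one_add_norm_pow x (Nat.le_ceil _)
    _ = _ := by ring

theorem IsSymbol.exists_seminorm_smulLeftCLM_comp_add_le {a : ℝ} {M : V → ℂ} (hM : IsSymbol a M)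
    (Φ : 𝓢(V, ℂ)) (k j : ℕ) : ∃ C, 0 ≤ C ∧ ∀ κ,
      SchwartzMap.seminorm ℂ k j (smulLeftCLM ℂ (fun x => M (x + κ)) Φ) ≤
        C * japaneseBracket κ ^ a := by
  choose C hC0 hC using hM.exists_norm_iteratedFDeriv_comp_add_le
  set K := ⌈|a|⌉₊
  set S : ℕ → ℝ := fun i =>
    2 ^ (k + K) * ((Finset.Iic (k + K, i)).sup fun m => SchwartzMap.seminorm ℝ m.1 m.2) Φ
  have hS (i : ℕ) (x : V) : (1 + ‖x‖) ^ (k + K) * ‖iteratedFDeriv ℝ i Φ x‖ ≤ S i :=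
    one_add_le_sup_seminorm_apply (𝕜 := ℝ) (m := (k + K, i)) le_rfl le_rfl Φ x
  have hS0 (i : ℕ) : 0 ≤ S i := by positivity
  have hnonneg : 0 ≤ ∑ i ∈ Finset.range (j + 1), (j.choose i : ℝ) * C i * S (j - i) :=
    Finset.sum_nonneg fun i _ => mul_nonneg (mul_nonneg (Nat.cast_nonneg _) (hC0 i)) (hS0 _)
  refine ⟨_, hnonneg, fun κ => ?_⟩
  have hκ := japaneseBracket_rpow_pos κ a
  have hgrowth := hasTemperateGrowth_comp_add hM.hasTemperateGrowth κ
  refine SchwartzMap.seminorm_le_bound ℂ k j _ (mul_nonneg hnonneg hκ.le) fun x => ?_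
  have hprod : (smulLeftCLM ℂ (fun x => M (x + κ)) Φ : V → ℂ) = fun x => M (x + κ) * Φ x :=
    funext fun x => by rw [smulLeftCLM_apply_apply hgrowth, smul_eq_mul]
  have hleibniz := norm_iteratedFDeriv_mul_le (𝕜 := ℝ) (N := ∞) hgrowth.1 (Φ.smooth ⊤) x (n := j)
    (by exact_mod_cast le_top)
  rw [hprod]
  refine (mul_le_mul_of_nonneg_left hleibniz (by positivity)).trans ?_
  rw [Finset.mul_sum, Finset.sum_mul]
  refine Finset.sum_le_sum fun i _ => ?_
  have hCi := hC0 i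
  calc _ ≤ (1 + ‖x‖) ^ k * ((j.choose i : ℝ) *
        (C i * japaneseBracket κ ^ a * (1 + ‖x‖) ^ K) * ‖iteratedFDeriv ℝ (j - i) Φ x‖) := by
        gcongr
        · exact le_add_of_nonneg_left zero_le_one
        · exact hC i κ x
    _ = (j.choose i : ℝ) * C i * ((1 + ‖x‖) ^ (k + K) * ‖iteratedFDeriv ℝ (j - i) Φ x‖) *
        japaneseBracket κ ^ a := by rw [pow_add]; ring
    _ ≤ _ := by
        gcongr
        exact hS _ x

theorem IsSymbol.exists_sup_seminorm_smulLeftCLM_comp_add_le {a : ℝ} {M : V → ℂ}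
    (hM : IsSymbol a M) (Φ : 𝓢(V, ℂ)) (s : Finset (ℕ × ℕ)) : ∃ C : ℝ, 0 < C ∧ ∀ κ,
      s.sup (schwartzSeminormFamily ℂ V ℂ) (smulLeftCLM ℂ (fun x => M (x + κ)) Φ) ≤
        C * japaneseBracket κ ^ a := by
  choose C hC0 hC using fun z : ℕ × ℕ => hM.exists_seminorm_smulLeftCLM_comp_add_le Φ z.1 z.2
  have hsum : 0 ≤ ∑ z ∈ s, C z := Finset.sum_nonneg fun z _ => hC0 z
  refine ⟨1 + ∑ z ∈ s, C z, by positivity, fun κ => ?_⟩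
  have hκ := japaneseBracket_rpow_pos κ a
  refine Seminorm.finset_sup_apply_le (by positivity) fun z hz => (hC z κ).trans ?_
  gcongr
  linarith [Finset.single_le_sum (fun z _ => hC0 z) hz]

end Localize

/-! ### The window and the integer lattice -/

section Window

variable {n : ℕ}

theorem latticePoint_add (k l : Fin n → ℤ) :
    latticePoint (k + l) = latticePoint k + latticePoint l := by
  ext i; simp [latticePoint]

theorem latticePoint_sub (k l : Fin n → ℤ) :
    latticePoint (k - l) = latticePoint k - latticePoint l := by
  ext i; simp [latticePoint]

theorem latticePoint_injective : Function.Injective (latticePoint : (Fin n → ℤ) → E n) := by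
  intro k l h
  ext i
  simpa [latticePoint] using congrArg (fun x : E n => x i) h

/-- The integer vectors with all coordinates between `-L` and `L`. -/
def latticeCube (n L : ℕ) : Finset (Fin n → ℤ) :=
  Fintype.piFinset fun _ => Finset.Icc (-(L : ℤ)) L

theorem mem_latticeCube_of_norm_le {L : ℕ} {l : Fin n → ℤ} (h : ‖latticePoint l‖ ≤ L) :
    l ∈ latticeCube n L := by
  rw [latticeCube, Fintype.mem_piFinset]
  intro i
  have h1 := (PiLp.norm_apply_le (latticePoint l) i).trans h
  simp only [latticePoint, Real.norm_eq_abs] at h1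
  rw [Finset.mem_Icc, ← abs_le]
  exact_mod_cast h1

theorem exists_norm_latticePoint_le (n L : ℕ) :
    ∃ R : ℝ, 0 ≤ R ∧ ∀ l ∈ latticeCube n L, ‖latticePoint l‖ ≤ R :=
  ⟨∑ l ∈ latticeCube n L, ‖latticePoint l‖, Finset.sum_nonneg fun _ _ => norm_nonneg _,
    fun _ hl => Finset.single_le_sum (f := fun l => ‖latticePoint l‖)
      (fun _ _ => norm_nonneg _) hl⟩

variable {φ : E n → ℂ}

/-- The window as a Schwartz function. -/
def IsPartitionWindow.schwartz (hφ : IsPartitionWindow φ) : 𝓢(E n, ℂ) :=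
  hφ.compactSupport.toSchwartzMap hφ.smooth

theorem IsPartitionWindow.schwartz_apply (hφ : IsPartitionWindow φ) (x : E n) :
    hφ.schwartz x = φ x := rfl

theorem IsPartitionWindow.hasTemperateGrowth (hφ : IsPartitionWindow φ) (k : Fin n → ℤ) :
    (fun ξ : E n => φ ((2 * Real.pi) • ξ - latticePoint k)).HasTemperateGrowth :=
  hasTemperateGrowth_dilate_sub hφ.schwartz.hasTemperateGrowth (latticePoint k)

theorem IsPartitionWindow.exists_radius (hφ : IsPartitionWindow φ) :
    ∃ R : ℝ, 0 ≤ R ∧ ∀ ξ, φ ξ ≠ 0 → ‖ξ‖ ≤ R := by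
  obtain ⟨R, hR⟩ := hφ.compactSupport.isCompact.isBounded.exists_norm_le
  exact ⟨max R 0, le_max_right _ _, fun ξ hξ =>
    (hR ξ (subset_tsupport φ hξ)).trans (le_max_left _ _)⟩

theorem IsPartitionWindow.sum_eq_one (hφ : IsPartitionWindow φ) {R r : ℝ}
    (hR : ∀ ξ, φ ξ ≠ 0 → ‖ξ‖ ≤ R) {L : ℕ} (hL : R + r ≤ L) {ξ : E n} {k : Fin n → ℤ}
    (hξ : ‖ξ - latticePoint k‖ ≤ r) :
    ∑ l ∈ latticeCube n L, φ (ξ - latticePoint (k + l)) = 1 := by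
  have h := (Equiv.addLeft k).hasSum_iff.2 (hφ.partition ξ)
  refine (hasSum_sum_of_ne_finset_zero fun l hl => ?_).unique h
  by_contra hne
  refine hl (mem_latticeCube_of_norm_le (le_trans ?_ hL))
  have h1 : ‖ξ - latticePoint (k + l)‖ ≤ R := hR _ hne
  have h2 : latticePoint l = (ξ - latticePoint k) - (ξ - latticePoint (k + l)) := by
    rw [latticePoint_add]; abel
  rw [h2]
  refine (norm_sub_le _ _).trans ?_
  linarith

theorem IsPartitionWindow.smulLeftCLM_comp_add_apply (hφ : IsPartitionWindow φ) {M : E n → ℂ}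
    (hM : M.HasTemperateGrowth) (κ x : E n) :
    smulLeftCLM ℂ (fun x => M (x + κ)) hφ.schwartz x = M (x + κ) * φ x := by
  rw [smulLeftCLM_apply_apply (hasTemperateGrowth_comp_add hM κ), hφ.schwartz_apply, smul_eq_mul]

theorem IsPartitionWindow.mul_eq_sum_mul (hφ : IsPartitionWindow φ) {M : E n → ℂ}
    (hM : M.HasTemperateGrowth) {R : ℝ} (hR : ∀ ξ, φ ξ ≠ 0 → ‖ξ‖ ≤ R) {L : ℕ} (hL : R + R ≤ L)
    (k : Fin n → ℤ) (ξ : E n) :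
    M ξ * φ (ξ - latticePoint k) = ∑ l ∈ latticeCube n L, φ (ξ - latticePoint (k + l)) *
      smulLeftCLM ℂ (fun x => M (x + latticePoint k)) hφ.schwartz (ξ - latticePoint k) := by
  rw [← Finset.sum_mul, hφ.smulLeftCLM_comp_add_apply hM, sub_add_cancel]
  rcases eq_or_ne (φ (ξ - latticePoint k)) 0 with h0 | h0
  · simp only [h0, mul_zero]
  · rw [hφ.sum_eq_one hR hL (hR _ h0), one_mul]

theorem IsPartitionWindow.box_symbolOperator (hφ : IsPartitionWindow φ) {M : E n → ℂ}
    (hM : M.HasTemperateGrowth) {R : ℝ} (hR : ∀ ξ, φ ξ ≠ 0 → ‖ξ‖ ≤ R) {L : ℕ} (hL : R + R ≤ L)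
    (k : Fin n → ℤ) (f : 𝓢'(E n, ℂ)) :
    box φ k (symbolOperator M f) =
      ∑ l ∈ latticeCube n L, TemperedDistribution.fourierMultiplierCLM ℂ
        (fun ξ : E n => smulLeftCLM ℂ (fun x => M (x + latticePoint k)) hφ.schwartz
          ((2 * Real.pi) • ξ - latticePoint k)) (box φ (k + l) f) := by
  set b := smulLeftCLM ℂ (fun x => M (x + latticePoint k)) hφ.schwartz
  have hb := hasTemperateGrowth_dilate_sub b.hasTemperateGrowth (latticePoint k)
  have hM' := hasTemperateGrowth_comp_smul hM two_pi_ne_zero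
  rw [box, symbolOperator, TemperedDistribution.fourierMultiplierCLM_fourierMultiplierCLM_apply hM'
    (hφ.hasTemperateGrowth k)]
  simp_rw [box, TemperedDistribution.fourierMultiplierCLM_fourierMultiplierCLM_apply
    (hφ.hasTemperateGrowth _) hb]
  rw [← _root_.sum_apply, ← TemperedDistribution.fourierMultiplierCLM_sum ℂ
    fun l _ => (hφ.hasTemperateGrowth (k + l)).mul hb]
  congr 2
  ext ξ
  simpa only [Pi.mul_apply] using hφ.mul_eq_sum_mul hM hR hL k ((2 * Real.pi) • ξ)

theorem IsPartitionWindow.exists_distLpNorm_box_symbolOperator_le (hφ : IsPartitionWindow φ)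
    {M : E n → ℂ} {a : ℝ} (hM : IsSymbol a M) {p₁ p₂ : ℝ≥0∞} (hp₁ : 1 ≤ p₁) (hp : p₁ ≤ p₂) :
    ∃ (L : ℕ) (C : ℝ), 0 < C ∧ ∀ (f : 𝓢'(E n, ℂ)) (k : Fin n → ℤ),
      distLpNorm p₂ (box φ k (symbolOperator M f)) ≤
        ENNReal.ofReal (C * bracket k ^ a) *
          ∑ l ∈ latticeCube n L, distLpNorm p₁ (box φ (k + l) f) := by
  obtain ⟨R, -, hR⟩ := hφ.exists_radius
  obtain ⟨L, hL⟩ := exists_nat_ge (R + R)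
  obtain ⟨s, C, hC, hmul⟩ := exists_distLpNorm_fourierMultiplier_le (n := n) hp₁ hp
  obtain ⟨D, hD, hloc⟩ := hM.exists_sup_seminorm_smulLeftCLM_comp_add_le hφ.schwartz s
  refine ⟨L, C * D, by positivity, fun f k => ?_⟩
  rw [hφ.box_symbolOperator hM.hasTemperateGrowth hR hL, Finset.mul_sum]
  refine (distLpNorm_sum_le (hp₁.trans hp) _ _).trans (Finset.sum_le_sum fun l _ => ?_)
  rw [mul_assoc, bracket_eq]
  exact hmul _ _ (mul_pos hD (japaneseBracket_rpow_pos _ _)) (hloc _) _ _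

end Window

/-! ### Weighted sequence spaces -/

section EllNorm

variable {ι : Type*} [MeasurableSpace ι]

/-- The `ℓ^q` norm of a family with values in `[0, ∞]`, as an `L^q` norm for the counting
measure. -/
def ellNorm (q : ℝ≥0∞) (a : ι → ℝ≥0∞) : ℝ≥0∞ := eLpNorm a q Measure.count

theorem ellNorm_mono {q : ℝ≥0∞} {a b : ι → ℝ≥0∞} (h : ∀ k, a k ≤ b k) :
    ellNorm q a ≤ ellNorm q b :=
  eLpNorm_mono_enorm h

variable [MeasurableSingletonClass ι]

theorem ellNorm_of_ne_top {q : ℝ≥0∞} (h0 : q ≠ 0) (h : q ≠ ⊤) (a : ι → ℝ≥0∞) :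
    ellNorm q a = (∑' k, a k ^ q.toReal) ^ (1 / q.toReal) := by
  rw [ellNorm, eLpNorm_eq_lintegral_rpow_enorm_toReal h0 h, lintegral_count]
  rfl

theorem ellNorm_top (a : ι → ℝ≥0∞) : ellNorm ⊤ a = ⨆ k, a k := by
  rw [ellNorm, eLpNorm_exponent_top, eLpNormEssSup_count]
  rfl

theorem apply_le_ellNorm {q : ℝ≥0∞} (hq : q ≠ 0) (a : ι → ℝ≥0∞) (k : ι) :
    a k ≤ ellNorm q a := by
  rcases eq_or_ne q ⊤ with rfl | h
  · rw [ellNorm_top]; exact le_iSup a k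
  have r := ENNReal.toReal_pos hq h
  rw [ellNorm_of_ne_top hq h, one_div, ENNReal.le_rpow_inv_iff r]
  exact ENNReal.le_tsum k

theorem ellNorm_antitone {q₁ q₂ : ℝ≥0∞} (hq₁ : q₁ ≠ 0) (hq : q₁ ≤ q₂)
    (a : ι → ℝ≥0∞) : ellNorm q₂ a ≤ ellNorm q₁ a :=
  eLpNorm_le_of_enorm_le hq₁ hq (fun k => apply_le_ellNorm hq₁ a k) le_rfl

variable [Countable ι]

theorem ellNorm_le_const_mul {q c : ℝ≥0∞} {a b : ι → ℝ≥0∞} (h : ∀ k, a k ≤ c * b k) :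
    ellNorm q a ≤ c * ellNorm q b :=
  eLpNorm_le_mul_eLpNorm_of_ae_le_mul'' q AEStronglyMeasurable.of_discrete
    (Filter.Eventually.of_forall h)

theorem ellNorm_comp_add [AddGroup ι] (q : ℝ≥0∞) (a : ι → ℝ≥0∞) (l : ι) :
    ellNorm q (fun k => a (k + l)) = ellNorm q a :=
  eLpNorm_comp_measurePreserving (g := a) AEStronglyMeasurable.of_discrete
    (measurePreserving_add_right Measure.count l)

theorem ellNorm_sum_le {q : ℝ≥0∞} (hq : 1 ≤ q) {κ : Type*} (s : Finset κ)
    (a : κ → ι → ℝ≥0∞) :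
    ellNorm q (fun k => ∑ i ∈ s, a i k) ≤ ∑ i ∈ s, ellNorm q (a i) := by
  have h := eLpNorm_sum_le (μ := Measure.count) (s := s) (f := a)
    (fun i _ => AEStronglyMeasurable.of_discrete) hq
  simpa only [Finset.sum_fn, ellNorm] using h

theorem ellNorm_mul_le {r q₁ q₂ : ℝ≥0∞} [hr : r.HolderTriple q₁ q₂] (hq₁ : q₁ ≠ 0)
    {w : ι → ℝ} (hw : ∀ k, 0 ≤ w k) (a : ι → ℝ≥0∞)
    (ha : ellNorm q₁ a ≠ ⊤) :
    ellNorm q₂ (fun k => ENNReal.ofReal (w k) * a k) ≤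
      ellNorm r (fun k => ENNReal.ofReal (w k)) * ellNorm q₁ a := by
  have hfin (k : ι) : a k ≠ ⊤ := ne_top_of_le_ne_top ha (apply_le_ellNorm hq₁ a k)
  have h := eLpNorm_smul_le_mul_eLpNorm (μ := Measure.count) (p := r) (q := q₁) (r := q₂)
    (f := fun k => (a k).toReal) AEStronglyMeasurable.of_discrete (φ := w)
    AEStronglyMeasurable.of_discrete
  have ha' : eLpNorm (fun k => (a k).toReal) q₁ Measure.count = ellNorm q₁ a := by
    refine eLpNorm_congr_enorm_ae (Filter.Eventually.of_forall fun k => ?_)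
    rw [Real.enorm_of_nonneg ENNReal.toReal_nonneg, ENNReal.ofReal_toReal (hfin k)]; rfl
  have hw' : eLpNorm w r Measure.count = ellNorm r fun k => ENNReal.ofReal (w k) := by
    refine eLpNorm_congr_enorm_ae (Filter.Eventually.of_forall fun k => ?_)
    rw [Real.enorm_of_nonneg (hw k)]; rfl
  have hwa : eLpNorm (w • fun k => (a k).toReal) q₂ Measure.count =
      ellNorm q₂ fun k => ENNReal.ofReal (w k) * a k := by
    refine eLpNorm_congr_enorm_ae (Filter.Eventually.of_forall fun k => ?_)
    rw [Pi.smul_apply', enorm_smul, Real.enorm_of_nonneg (hw k),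
      Real.enorm_of_nonneg ENNReal.toReal_nonneg, ENNReal.ofReal_toReal (hfin k)]; rfl
  rwa [ha', hw', hwa] at h

end EllNorm

section Weighted

variable {n : ℕ}

/-- The sequence `⟨k⟩^s a_k`. -/
def weighted (s : ℝ) (a : (Fin n → ℤ) → ℝ≥0∞) (k : Fin n → ℤ) : ℝ≥0∞ :=
  ENNReal.ofReal (bracket k ^ s) * a k

theorem one_le_bracket (k : Fin n → ℤ) : 1 ≤ bracket k := one_le_japaneseBracket _

theorem bracket_pos (k : Fin n → ℤ) : 0 < bracket k := japaneseBracket_pos _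

theorem bracket_rpow_pos (k : Fin n → ℤ) (s : ℝ) : 0 < bracket k ^ s :=
  japaneseBracket_rpow_pos _ _

theorem modulationNorm_eq {φ : E n → ℂ} {s : ℝ} {p q : ℝ≥0∞} (hq : 1 ≤ q) (f : 𝓢'(E n, ℂ)) :
    modulationNorm φ s p q f = ellNorm q (weighted s fun k => distLpNorm p (box φ k f)) := by
  rw [modulationNorm]
  split_ifs with h
  · rw [h, ellNorm_top]; rfl
  · rw [ellNorm_of_ne_top (one_pos.trans_le hq).ne' h]; rfl

theorem weighted_weighted (s t : ℝ) (a : (Fin n → ℤ) → ℝ≥0∞) :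
    weighted s (weighted t a) = weighted (s + t) a := by
  ext k
  simp only [weighted]
  rw [← mul_assoc, ← ENNReal.ofReal_mul (bracket_rpow_pos k s).le,
    ← Real.rpow_add (bracket_pos _)]

theorem exists_ellNorm_weighted_sum_shift_le (n L : ℕ) (s : ℝ) :
    ∃ C : ℝ, 0 < C ∧ ∀ q : ℝ≥0∞, 1 ≤ q → ∀ a : (Fin n → ℤ) → ℝ≥0∞,
      ellNorm q (weighted s fun k => ∑ l ∈ latticeCube n L, a (k + l)) ≤
        ENNReal.ofReal C * ellNorm q (weighted s a) := by
  obtain ⟨R, hR0, hR⟩ := exists_norm_latticePoint_le n L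
  set c : ℝ := 2 ^ |s| * (1 + R) ^ |s|
  have hc0 : 0 < c := by positivity
  refine ⟨((latticeCube n L).card + 1) * c, by positivity, fun q hq a => ?_⟩
  have hpt (k : Fin n → ℤ) : weighted s (fun k => ∑ l ∈ latticeCube n L, a (k + l)) k ≤
      ENNReal.ofReal c * ∑ l ∈ latticeCube n L, weighted s a (k + l) := by
    rw [weighted, Finset.mul_sum, Finset.mul_sum]
    refine Finset.sum_le_sum fun l hl => ?_
    rw [weighted, ← mul_assoc, ← ENNReal.ofReal_mul hc0.le]
    gcongr
    refine japaneseBracket_rpow_le_of_norm_sub_le ?_ s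
    rw [latticePoint_add, sub_add_cancel_left, norm_neg]
    exact hR l hl
  calc _ ≤ ENNReal.ofReal c * ellNorm q (fun k => ∑ l ∈ latticeCube n L, weighted s a (k + l)) :=
        ellNorm_le_const_mul hpt
    _ ≤ ENNReal.ofReal c * ∑ _ ∈ latticeCube n L, ellNorm q (weighted s a) := by
        gcongr
        refine (ellNorm_sum_le hq _ _).trans_eq (Finset.sum_congr rfl fun _ _ => ?_)
        exact ellNorm_comp_add q (weighted s a) _
    _ = ENNReal.ofReal ((latticeCube n L).card * c) * ellNorm q (weighted s a) := by
        rw [Finset.sum_const, nsmul_eq_mul, ENNReal.ofReal_mul (Nat.cast_nonneg _),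
          ENNReal.ofReal_natCast]
        ring
    _ ≤ _ := by
        gcongr
        linarith

theorem latticePoint_mem_span (k : Fin n → ℤ) :
    latticePoint k ∈ Submodule.span ℤ (Set.range (EuclideanSpace.basisFun (Fin n) ℝ).toBasis) := by
  have : latticePoint k = ∑ i, k i • (EuclideanSpace.basisFun (Fin n) ℝ).toBasis i := by
    ext j
    simp [latticePoint, Finset.sum_apply, Pi.single_apply]
  rw [this]
  exact Submodule.sum_mem _ fun i _ => Submodule.smul_mem _ _ (Submodule.subset_span ⟨i, rfl⟩)

theorem summable_bracket_rpow {t : ℝ} (ht : (n : ℝ) < t) :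
    Summable fun k : Fin n → ℤ => bracket k ^ (-t) := by
  set Λ := Submodule.span ℤ (Set.range (EuclideanSpace.basisFun (Fin n) ℝ).toBasis)
  have hrank : Module.finrank ℤ Λ = n := by
    rw [ZLattice.rank ℝ Λ]; simp
  have hinj : Function.Injective fun k : Fin n → ℤ =>
      (⟨latticePoint k, latticePoint_mem_span k⟩ : Λ) :=
    fun _ _ h => latticePoint_injective (congrArg Subtype.val h)
  have hsum := (ZLattice.summable_norm_rpow Λ (-t) (by rw [hrank]; linarith)).comp_injective hinj
  refine Summable.of_norm_bounded_eventually hsum ?_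
  filter_upwards [(Set.finite_singleton (0 : Fin n → ℤ)).compl_mem_cofinite] with k hk
  have hzero : latticePoint (0 : Fin n → ℤ) = 0 := by ext i; simp [latticePoint]
  have hk0 : latticePoint k ≠ 0 := fun h => hk (latticePoint_injective (h.trans hzero.symm))
  rw [Real.norm_of_nonneg (bracket_rpow_pos _ _).le]
  exact Real.rpow_le_rpow_of_nonpos (z := -t) (x := ‖latticePoint k‖) (norm_pos_iff.2 hk0)
    (norm_le_japaneseBracket _)
    (neg_nonpos.2 ((Nat.cast_nonneg n).trans ht.le))

/-- The exponent `r` with `1/r = 1/q₂ - 1/q₁`. -/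
def gapExponent (q₁ q₂ : ℝ≥0∞) : ℝ≥0∞ := (q₂⁻¹ - q₁⁻¹)⁻¹

variable {q₁ q₂ : ℝ≥0∞} {s : ℝ}

theorem holderTriple_gapExponent (hq : q₂ ≤ q₁) : (gapExponent q₁ q₂).HolderTriple q₁ q₂ :=
  ⟨by rw [gapExponent, inv_inv, tsub_add_cancel_of_le (ENNReal.inv_le_inv.2 hq)]⟩

theorem gapExponent_ne_top (hq : q₂ < q₁) : gapExponent q₁ q₂ ≠ ⊤ := by
  rw [gapExponent, Ne, ENNReal.inv_eq_top, tsub_eq_zero_iff_le, not_le]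
  exact ENNReal.inv_lt_inv.2 hq

theorem inv_toReal_gapExponent (hq₂ : q₂ ≠ 0) (hq : q₂ ≤ q₁) :
    ((gapExponent q₁ q₂).toReal)⁻¹ = q₂⁻¹.toReal - q₁⁻¹.toReal := by
  rw [gapExponent, ENNReal.toReal_inv, inv_inv, ENNReal.toReal_sub_of_le (ENNReal.inv_le_inv.2 hq)]
  exact ENNReal.inv_ne_top.2 hq₂

theorem gapExponent_ne_zero (hq₂ : q₂ ≠ 0) : gapExponent q₁ q₂ ≠ 0 := by
  rw [gapExponent, Ne, ENNReal.inv_eq_zero]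
  exact ne_top_of_le_ne_top (ENNReal.inv_ne_top.2 hq₂) tsub_le_self

theorem gapExponent_toReal_pos (hq₂ : q₂ ≠ 0) (hq : q₂ < q₁) : 0 < (gapExponent q₁ q₂).toReal :=
  ENNReal.toReal_pos (gapExponent_ne_zero hq₂) (gapExponent_ne_top hq)

theorem ellNorm_bracket_rpow_ne_top (hq₂ : q₂ ≠ 0) (hq : q₂ < q₁) {τ : ℝ}
    (hτ : n * (q₂⁻¹.toReal - q₁⁻¹.toReal) < τ) :
    ellNorm (gapExponent q₁ q₂) (fun k : Fin n → ℤ => ENNReal.ofReal (bracket k ^ (-τ))) ≠ ⊤ := by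
  have hr := gapExponent_toReal_pos hq₂ hq
  rw [← inv_toReal_gapExponent hq₂ hq.le, ← div_eq_mul_inv, div_lt_iff₀ hr] at hτ
  rw [ellNorm_of_ne_top (gapExponent_ne_zero hq₂) (gapExponent_ne_top hq)]
  refine ENNReal.rpow_ne_top_of_nonneg (by positivity) ?_
  have h (k : Fin n → ℤ) : ENNReal.ofReal (bracket k ^ (-τ)) ^ (gapExponent q₁ q₂).toReal =
      ENNReal.ofReal (bracket k ^ (-(τ * (gapExponent q₁ q₂).toReal))) := by
    rw [ENNReal.ofReal_rpow_of_pos (bracket_rpow_pos k _), ← Real.rpow_mul (bracket_pos k).le,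
      neg_mul]
  simp_rw [h]
  rw [← ENNReal.ofReal_tsum_of_nonneg (fun k => (bracket_rpow_pos k _).le)
    (summable_bracket_rpow hτ)]
  exact ENNReal.ofReal_ne_top

theorem ellNorm_weighted_le_of_le {t : ℝ} (hq₁ : q₁ ≠ 0) (hq : q₁ ≤ q₂) (hts : t ≤ s)
    (a : (Fin n → ℤ) → ℝ≥0∞) : ellNorm q₂ (weighted t a) ≤ ellNorm q₁ (weighted s a) := by
  refine (ellNorm_mono fun k => ?_).trans (ellNorm_antitone hq₁ hq _)
  simp only [weighted]
  gcongr
  exact one_le_bracket k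

theorem ellNorm_weighted_le_of_gap {t : ℝ} (hq₂ : q₂ ≠ 0) (hq : q₂ < q₁)
    {a : (Fin n → ℤ) → ℝ≥0∞} (ha : ellNorm q₁ (weighted s a) ≠ ⊤) :
    ellNorm q₂ (weighted t a) ≤ ellNorm (gapExponent q₁ q₂)
      (fun k : Fin n → ℤ => ENNReal.ofReal (bracket k ^ (-(s - t)))) *
        ellNorm q₁ (weighted s a) := by
  have := holderTriple_gapExponent hq.le
  have hsplit : weighted t a = weighted (-(s - t)) (weighted s a) := by
    rw [weighted_weighted, neg_sub, sub_add_cancel]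
  rw [hsplit]
  exact ellNorm_mul_le (hq₂.bot_lt.trans hq).ne' (fun k => (bracket_rpow_pos k _).le) _ ha

end Weighted

/-! ### Sufficiency -/

section Sufficiency

variable {n : ℕ} {φ M : E n → ℂ} {p₁ p₂ q₁ q₂ : ℝ≥0∞} {s₁ s₂ σ : ℝ}

theorem isBoundedOnModulation_of_modulationNorm_le {T : 𝓢'(E n, ℂ) → 𝓢'(E n, ℂ)} {D : ℝ≥0∞}
    (hD : D ≠ ⊤) (h : ∀ f ∈ modulationSpace φ s₁ p₁ q₁,
      modulationNorm φ s₂ p₂ q₂ (T f) ≤ D * modulationNorm φ s₁ p₁ q₁ f) :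
    IsBoundedOnModulation φ s₁ p₁ q₁ s₂ p₂ q₂ T := by
  refine ⟨D.toNNReal, fun f hf => ?_⟩
  rw [ENNReal.coe_toNNReal hD]
  exact ⟨(h f hf).trans_lt (ENNReal.mul_lt_top hD.lt_top hf), h f hf⟩

theorem exists_modulationNorm_symbolOperator_le (hφ : IsPartitionWindow φ)
    (hM : IsSymbol σ M) (hp₁ : 1 ≤ p₁) (hp : p₁ ≤ p₂) (hq : 1 ≤ q₂) (s : ℝ) :
    ∃ D : ℝ≥0∞, D ≠ ⊤ ∧ ∀ f, modulationNorm φ s p₂ q₂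
      (symbolOperator M f) ≤
        D * ellNorm q₂ (weighted (s + σ) fun k => distLpNorm p₁ (box φ k f)) := by
  obtain ⟨L, C, hC, hloc⟩ := hφ.exists_distLpNorm_box_symbolOperator_le hM hp₁ hp
  obtain ⟨B, -, hshift⟩ := exists_ellNorm_weighted_sum_shift_le n L (s + σ)
  refine ⟨ENNReal.ofReal C * ENNReal.ofReal B,
    ENNReal.mul_ne_top ENNReal.ofReal_ne_top ENNReal.ofReal_ne_top, fun f => ?_⟩
  rw [modulationNorm_eq hq, mul_assoc]
  refine (ellNorm_le_const_mul fun k => ?_).trans (by gcongr; exact hshift q₂ hq _)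
  simp only [weighted]
  refine (mul_le_mul_right (hloc f k) _).trans_eq ?_
  rw [← mul_assoc, ← mul_assoc, ← ENNReal.ofReal_mul (bracket_rpow_pos k s).le,
    ← ENNReal.ofReal_mul hC.le, Real.rpow_add (bracket_pos _), mul_left_comm]

theorem isBoundedOnModulation_symbolOperator_of_le (hφ : IsPartitionWindow φ)
    (hM : IsSymbol σ M) (hp₁ : 1 ≤ p₁) (hp : p₁ ≤ p₂) (hq₁ : 1 ≤ q₁) (hq : q₁ ≤ q₂)
    (hs : s₂ + σ ≤ s₁) :
    IsBoundedOnModulation φ s₁ p₁ q₁ s₂ p₂ q₂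
      (symbolOperator M) := by
  obtain ⟨D, hD, h⟩ :=
    exists_modulationNorm_symbolOperator_le hφ hM hp₁ hp (hq₁.trans hq) s₂
  refine isBoundedOnModulation_of_modulationNorm_le hD fun f _ => (h f).trans ?_
  rw [modulationNorm_eq hq₁]
  gcongr
  exact ellNorm_weighted_le_of_le (one_pos.trans_le hq₁).ne' hq hs _

theorem isBoundedOnModulation_symbolOperator_of_gap (hφ : IsPartitionWindow φ)
    (hM : IsSymbol σ M) (hp₁ : 1 ≤ p₁) (hp : p₁ ≤ p₂) (hq₂ : 1 ≤ q₂) (hq : q₂ < q₁)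
    (hs : s₂ + σ + n * q₂⁻¹.toReal < s₁ + n * q₁⁻¹.toReal) :
    IsBoundedOnModulation φ s₁ p₁ q₁ s₂ p₂ q₂
      (symbolOperator M) := by
  have hq₂' := (one_pos.trans_le hq₂).ne'
  obtain ⟨D, hD, h⟩ := exists_modulationNorm_symbolOperator_le hφ hM hp₁ hp hq₂ s₂
  have hgap := ellNorm_bracket_rpow_ne_top (n := n) hq₂' hq (τ := s₁ - (s₂ + σ)) (by linarith)
  refine isBoundedOnModulation_of_modulationNorm_le (ENNReal.mul_ne_top hD hgap)
    fun f hf => (h f).trans ?_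
  have hf' : modulationNorm φ s₁ p₁ q₁ f ≠ ⊤ := ne_of_lt hf
  rw [modulationNorm_eq (hq₂.trans hq.le)] at hf' ⊢
  rw [mul_assoc]
  gcongr
  exact ellNorm_weighted_le_of_gap hq₂' hq hf'

end Sufficiency

/-! ### Points where the symbol is large -/

section LargePoints

variable {V F : Type*} [NormedAddCommGroup V] [NormedSpace ℝ V] [NormedAddCommGroup F]
  [NormedSpace ℝ F] {σ : ℝ} {M : V → F}

/-- A symbol of order `σ` and of no smaller order in any region of frequency space: although it
may have zeros arbitrarily far out, it is as large as `⟨κ⟩^σ` within unit distance of every `κ`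
outside the unit ball. -/
structure IsExactSymbol (σ : ℝ) (M : V → F) : Prop extends IsSymbol σ M where
  exists_le : ∃ c, 0 < c ∧ ∀ κ, 1 ≤ ‖κ‖ → ∃ ξ, ‖ξ - κ‖ ≤ 1 ∧ c * japaneseBracket κ ^ σ ≤ ‖M ξ‖

/-- A frequency `ξ` near `κ` at which `M` has size at least `c ⟨κ⟩^σ`, and around which `M` is
almost constant on the scale `δ`. -/
structure IsProbe (M : V → F) (σ c δ : ℝ) (κ ξ : V) : Prop where
  norm_sub_le : ‖ξ - κ‖ ≤ 1
  le_norm : c * japaneseBracket κ ^ σ ≤ ‖M ξ‖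
  norm_image_sub_le : ∀ η, ‖η - ξ‖ ≤ δ → ‖M η - M ξ‖ ≤ ‖M ξ‖ / 2

theorem IsSymbol.exists_norm_sub_le (hM : IsSymbol σ M) :
    ∃ C : ℝ, 0 < C ∧ ∀ ξ η, ‖η - ξ‖ ≤ 1 →
      ‖M η - M ξ‖ ≤ C * japaneseBracket ξ ^ σ * ‖η - ξ‖ := by
  obtain ⟨D, hD, h⟩ := hM.bound 1
  refine ⟨D * (2 ^ |σ| * (1 + 1) ^ |σ|) + 1, by positivity, fun ξ η hη => ?_⟩
  have hpos := japaneseBracket_rpow_pos ξ σ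
  have hdiff : Differentiable ℝ M := hM.contDiff.differentiable (by simp)
  refine (convex_closedBall ξ 1).norm_image_sub_le_of_norm_fderiv_le (𝕜 := ℝ)
    (fun z _ => hdiff z) (fun z hz => ?_) (Metric.mem_closedBall_self zero_le_one)
    (mem_closedBall_iff_norm.2 hη)
  rw [← norm_iteratedFDeriv_one]
  calc _ ≤ D * japaneseBracket z ^ σ := h z
    _ ≤ D * (2 ^ |σ| * (1 + 1) ^ |σ| * japaneseBracket ξ ^ σ) := by
        gcongr
        exact japaneseBracket_rpow_le_of_norm_sub_le (mem_closedBall_iff_norm.1 hz) σ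
    _ = D * (2 ^ |σ| * (1 + 1) ^ |σ|) * japaneseBracket ξ ^ σ := by ring
    _ ≤ _ := by gcongr; linarith

theorem IsExactSymbol.exists_isProbe (hM : IsExactSymbol σ M) :
    ∃ c δ : ℝ, 0 < c ∧ 0 < δ ∧ δ ≤ 1 ∧ ∀ κ, 1 ≤ ‖κ‖ → ∃ ξ, IsProbe M σ c δ κ ξ := by
  obtain ⟨c, hc, hlarge⟩ := hM.exists_le
  obtain ⟨C, hC, hlip⟩ := hM.exists_norm_sub_le
  set B : ℝ := 2 ^ |σ| * (1 + 1) ^ |σ|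
  have hB : 0 < B := by positivity
  refine ⟨c, min 1 (c / (2 * C * B)), hc, by positivity, min_le_left _ _, fun κ hκ => ?_⟩
  obtain ⟨ξ, hξ, hlow⟩ := hlarge κ hκ
  refine ⟨ξ, hξ, hlow, fun η hη => ?_⟩
  have hpos := japaneseBracket_rpow_pos κ σ
  calc _ ≤ C * japaneseBracket ξ ^ σ * ‖η - ξ‖ := hlip ξ η (hη.trans (min_le_left _ _))
    _ ≤ C * (B * japaneseBracket κ ^ σ) * (c / (2 * C * B)) := by
        gcongr
        · exact japaneseBracket_rpow_le_of_norm_sub_le hξ σ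
        · exact hη.trans (min_le_right _ _)
    _ = c * japaneseBracket κ ^ σ / 2 := by field_simp
    _ ≤ _ := by gcongr

theorem isExactSymbol_averageSymbol {n : ℕ} (hn : 1 ≤ n) (N : ℕ) :
    IsExactSymbol (2 - ((n : ℝ) - 1) / 2 * N) (averageSymbol n N) where
  toIsSymbol := isSymbol_averageSymbol hn N
  exists_le := by
    obtain ⟨ε, hε, h⟩ := exists_le_abs_sphereSymbol hn
    refine ⟨ε ^ N / 4, by positivity, fun κ hκ => ?_⟩
    obtain ⟨ξ, hξ, hκξ, hlow⟩ := h κ hκ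
    refine ⟨ξ, hξ, ?_⟩
    have hpos := japaneseBracket_pos κ
    have hhalf : japaneseBracket κ / 2 ≤ ‖ξ‖ := by linarith [japaneseBracket_le_one_add_norm κ]
    rw [averageSymbol, norm_neg, norm_mul, norm_pow, Complex.norm_real, Complex.norm_real,
      Real.norm_of_nonneg (by positivity), Real.norm_eq_abs]
    calc ε ^ N / 4 * japaneseBracket κ ^ (2 - ((n : ℝ) - 1) / 2 * N)
        = (japaneseBracket κ / 2) ^ 2 *
            (ε * japaneseBracket κ ^ (-(((n : ℝ) - 1) / 2))) ^ N := by
          rw [mul_pow, ← Real.rpow_mul_natCast hpos.le, sub_eq_add_neg, ← neg_mul,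
            Real.rpow_add hpos, Real.rpow_two]
          ring
      _ ≤ _ := by gcongr

end LargePoints

/-! ### Wave packets -/

section Packets

variable {n : ℕ}

/-- The wave packet with profile `b` at frequency `ξ`, on the Fourier side: the Schwartz function
`w ↦ b (2πw - ξ)`. -/
def packet (b : 𝓢(E n, ℂ)) (ξ : E n) : 𝓢(E n, ℂ) :=
  compSubConstCLM ℂ ((2 * Real.pi)⁻¹ • ξ) (dilateTwoPi n b)

theorem packet_apply (b : 𝓢(E n, ℂ)) (ξ w : E n) : packet b ξ w = b ((2 * Real.pi) • w - ξ) := by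
  rw [packet, compSubConstCLM_apply, dilateTwoPi_apply, smul_sub, smul_smul,
    mul_inv_cancel₀ two_pi_ne_zero, one_smul]

theorem packet_mul_packet_eq_zero {b : 𝓢(E n, ℂ)} {r : ℝ} (hb : ∀ x, b x ≠ 0 → ‖x‖ ≤ r)
    {ξ ξ' : E n} (h : r + r < ‖ξ - ξ'‖) (w : E n) : packet b ξ w * packet b ξ' w = 0 := by
  by_contra hne
  have h₁ := left_ne_zero_of_mul hne
  have h₂ := right_ne_zero_of_mul hne
  rw [packet_apply] at h₁ h₂
  have := norm_sub_le ((2 * Real.pi) • w - ξ') ((2 * Real.pi) • w - ξ)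
  rw [sub_sub_sub_cancel_left] at this
  linarith [hb _ h₁, hb _ h₂]

/-- The distribution with Fourier transform `w ↦ b (2πw - ξ)`. -/
def packetDistribution (b : 𝓢(E n, ℂ)) (ξ : E n) : 𝓢'(E n, ℂ) :=
  toTemperedDistributionCLM (E n) ℂ volume (𝓕⁻ (packet b ξ))

theorem packetDistribution_apply (b : 𝓢(E n, ℂ)) (ξ : E n) (ψ : 𝓢(E n, ℂ)) :
    packetDistribution b ξ ψ = ∫ w, packet b ξ w * (𝓕⁻ ψ : 𝓢(E n, ℂ)) w := by
  refine (toTemperedDistributionCLM_apply_apply volume (𝓕⁻ (packet b ξ)) ψ).trans ?_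
  have h := integral_fourierInv_smul_eq (packet b ξ) ψ
  simp only [smul_eq_mul] at h ⊢
  simp only [← h, mul_comm]

theorem fourierMultiplierCLM_packetDistribution_apply {g : E n → ℂ} (hg : g.HasTemperateGrowth)
    (b : 𝓢(E n, ℂ)) (ξ : E n) (ψ : 𝓢(E n, ℂ)) :
    TemperedDistribution.fourierMultiplierCLM ℂ g (packetDistribution b ξ) ψ =
      ∫ w, packet b ξ w * (g w * (𝓕⁻ ψ : 𝓢(E n, ℂ)) w) := by
  rw [TemperedDistribution.fourierMultiplierCLM_apply_apply, packetDistribution_apply,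
    FourierTransform.fourierInv_fourier_eq]
  simp only [smulLeftCLM_apply_apply hg, smul_eq_mul]

/-- The `L^p` norm of the Fourier transform of `w ↦ b (2πw)`, which is the `L^p` norm of every wave
packet with profile `b`. -/
def packetNorm (p : ℝ≥0∞) (b : 𝓢(E n, ℂ)) : ℝ≥0∞ :=
  eLpNorm (𝓕 (dilateTwoPi n b) : 𝓢(E n, ℂ)) p volume

theorem packetNorm_ne_top (p : ℝ≥0∞) (b : 𝓢(E n, ℂ)) : packetNorm p b ≠ ⊤ :=
  ((𝓕 (dilateTwoPi n b) : 𝓢(E n, ℂ)).memLp p volume).2.ne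

theorem fourier_packet_apply (b : 𝓢(E n, ℂ)) (ξ x : E n) :
    (𝓕 (packet b ξ) : 𝓢(E n, ℂ)) x = multiplierKernel b ξ x := by
  rw [← integral_cexp_mul_dilate_sub, fourier_coe, Real.fourier_eq']
  simp only [smul_eq_mul, packet_apply]

theorem eLpNorm_fourier_packet (p : ℝ≥0∞) (b : 𝓢(E n, ℂ)) (ξ : E n) :
    eLpNorm (𝓕 (packet b ξ) : 𝓢(E n, ℂ)) p volume = packetNorm p b :=
  eLpNorm_congr_norm_ae (.of_forall fun x => by
    rw [fourier_packet_apply, norm_multiplierKernel, fourier_coe])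

theorem eLpNorm_fourierInv_packet (p : ℝ≥0∞) (b : 𝓢(E n, ℂ)) (ξ : E n) :
    eLpNorm (𝓕⁻ (packet b ξ) : 𝓢(E n, ℂ)) p volume = packetNorm p b := by
  rw [← eLpNorm_fourier_packet p b ξ, ← eLpNorm_comp_measurePreserving
    (𝓕 (packet b ξ) : 𝓢(E n, ℂ)).continuous.aestronglyMeasurable
    (Measure.measurePreserving_neg (volume : Measure (E n)))]
  refine eLpNorm_congr_ae (.of_forall fun x => ?_)
  rw [fourierInv_coe, Real.fourierInv_eq_fourier_neg, Function.comp_apply, fourier_coe]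

theorem distLpNorm_packetDistribution_le (p : ℝ≥0∞) (b : 𝓢(E n, ℂ)) (ξ : E n) :
    distLpNorm p (packetDistribution b ξ) ≤ packetNorm p b := by
  rw [← eLpNorm_fourierInv_packet p b ξ]
  refine distLpNorm_le_of_memLp (SchwartzMap.memLp _ p volume) fun ψ => ?_
  refine (toTemperedDistributionCLM_apply_apply volume (𝓕⁻ (packet b ξ)) ψ).trans ?_
  simp only [smul_eq_mul, mul_comm]

/-- The superposition over `k ∈ F` of the wave packets with amplitudes `a k` and frequencies
`ξ k`. -/
def packetSum (b : 𝓢(E n, ℂ)) (ξ : (Fin n → ℤ) → E n) (F : Finset (Fin n → ℤ))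
    (a : (Fin n → ℤ) → ℝ≥0) : 𝓢'(E n, ℂ) :=
  ∑ k ∈ F, ((a k : ℝ) : ℂ) • packetDistribution b (ξ k)

theorem map_packetSum (T : 𝓢'(E n, ℂ) →L[ℂ] 𝓢'(E n, ℂ)) (b : 𝓢(E n, ℂ))
    (ξ : (Fin n → ℤ) → E n) (F : Finset (Fin n → ℤ)) (a : (Fin n → ℤ) → ℝ≥0) :
    T (packetSum b ξ F a) = ∑ k ∈ F, ((a k : ℝ) : ℂ) • T (packetDistribution b (ξ k)) := by
  rw [packetSum, map_sum]
  simp_rw [map_smul]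

theorem enorm_ofReal_coe (r : ℝ≥0) : ‖((r : ℝ) : ℂ)‖ₑ = r := by
  rw [← ofReal_norm, show ‖((r : ℝ) : ℂ)‖ = r from Complex.norm_of_nonneg r.2,
    ENNReal.ofReal_coe_nnreal]

variable {φ : E n → ℂ} {p q : ℝ≥0∞}

theorem IsPartitionWindow.exists_distLpNorm_box_le (hφ : IsPartitionWindow φ) (hp : 1 ≤ p) :
    ∃ C : ℝ, 0 < C ∧ ∀ k u, distLpNorm p (box φ k u) ≤ ENNReal.ofReal C * distLpNorm p u := by
  obtain ⟨s, C, hC, hmul⟩ := exists_distLpNorm_fourierMultiplier_le (n := n) hp le_rfl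
  have := apply_nonneg (s.sup (schwartzSeminormFamily ℂ (E n) ℂ)) hφ.schwartz
  exact ⟨C * (s.sup (schwartzSeminormFamily ℂ (E n) ℂ) hφ.schwartz + 1), by positivity, fun k u =>
    hmul hφ.schwartz _ (by positivity) (by linarith) (latticePoint k) u⟩

theorem IsPartitionWindow.box_packetDistribution_eq_zero (hφ : IsPartitionWindow φ) {R r : ℝ}
    (hR : ∀ ξ, φ ξ ≠ 0 → ‖ξ‖ ≤ R) {b : 𝓢(E n, ℂ)} (hb : ∀ x, b x ≠ 0 → ‖x‖ ≤ r) {ξ : E n}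
    {k : Fin n → ℤ} (h : R + r < ‖ξ - latticePoint k‖) :
    box φ k (packetDistribution b ξ) = 0 := by
  have hdisj (w : E n) : packet b ξ w * φ ((2 * Real.pi) • w - latticePoint k) = 0 := by
    by_contra hne
    have h₁ := left_ne_zero_of_mul hne
    rw [packet_apply] at h₁
    have := norm_sub_le ((2 * Real.pi) • w - latticePoint k) ((2 * Real.pi) • w - ξ)
    rw [sub_sub_sub_cancel_left] at this
    linarith [hb _ h₁, hR _ (right_ne_zero_of_mul hne)]
  ext ψ
  rw [box, fourierMultiplierCLM_packetDistribution_apply (hφ.hasTemperateGrowth k)]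
  simp_rw [← mul_assoc, hdisj, zero_mul, integral_zero]
  rfl

theorem IsPartitionWindow.sub_mem_latticeCube_of_box_packetDistribution_ne_zero
    (hφ : IsPartitionWindow φ) {R : ℝ} (hR : ∀ ξ, φ ξ ≠ 0 → ‖ξ‖ ≤ R) {L : ℕ} (hL : R + 2 ≤ L)
    {b : 𝓢(E n, ℂ)} (hb : ∀ x, b x ≠ 0 → ‖x‖ ≤ 1) {ξ : E n} {j k : Fin n → ℤ}
    (hξ : ‖ξ - latticePoint k‖ ≤ 1) (hne : box φ j (packetDistribution b ξ) ≠ 0) :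
    k - j ∈ latticeCube n L := by
  refine mem_latticeCube_of_norm_le (le_trans ?_ hL)
  contrapose! hne
  have := norm_sub_le (ξ - latticePoint j) (ξ - latticePoint k)
  rw [sub_sub_sub_cancel_left, ← latticePoint_sub] at this
  exact hφ.box_packetDistribution_eq_zero hR hb (by linarith)

theorem IsPartitionWindow.exists_distLpNorm_box_packetSum_le (hφ : IsPartitionWindow φ)
    (hp : 1 ≤ p) : ∃ (L : ℕ) (C : ℝ), 0 < C ∧ ∀ b : 𝓢(E n, ℂ), (∀ x, b x ≠ 0 → ‖x‖ ≤ 1) →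
      ∀ ξ F (a : (Fin n → ℤ) → ℝ≥0), (∀ k ∈ F, ‖ξ k - latticePoint k‖ ≤ 1) →
      ∀ j, distLpNorm p (box φ j (packetSum b ξ F a)) ≤
        ENNReal.ofReal C * packetNorm p b * ∑ l ∈ latticeCube n L, (a (j + l) : ℝ≥0∞) := by
  obtain ⟨R, -, hR⟩ := hφ.exists_radius
  obtain ⟨L, hL⟩ := exists_nat_ge (R + 2)
  obtain ⟨C, hC, hbox⟩ := hφ.exists_distLpNorm_box_le hp
  refine ⟨L, C, hC, fun b hb ξ F a hξ j => ?_⟩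
  classical
  set u : (Fin n → ℤ) → 𝓢'(E n, ℂ) := fun k =>
    ((a k : ℝ) : ℂ) • box φ j (packetDistribution b (ξ k)) with hu
  have hnear : ∀ k ∈ F, distLpNorm p (u k) ≠ 0 → k - j ∈ latticeCube n L := by
    intro k hk hne
    refine hφ.sub_mem_latticeCube_of_box_packetDistribution_ne_zero hR hL hb (hξ k hk) fun h => ?_
    have h₀ : u k = 0 := by
      ext
      simp only [hu, h]
      exact mul_zero _
    exact hne (by rw [h₀, distLpNorm_zero])
  have hterm (k : Fin n → ℤ) :
      distLpNorm p (u k) ≤ ENNReal.ofReal C * packetNorm p b * (a k : ℝ≥0∞) :=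
    calc distLpNorm p (u k) ≤ ‖((a k : ℝ) : ℂ)‖ₑ * (ENNReal.ofReal C * packetNorm p b) :=
          (distLpNorm_smul_le _ _).trans (mul_le_mul_right ((hbox j _).trans
            (mul_le_mul_right (distLpNorm_packetDistribution_le p b (ξ k)) _)) _)
      _ = _ := by rw [enorm_ofReal_coe, mul_comm]
  calc distLpNorm p (box φ j (packetSum b ξ F a))
      ≤ ∑ k ∈ F, distLpNorm p (u k) := by
        rw [box, map_packetSum]
        exact distLpNorm_sum_le hp _ _
    _ = ∑ k ∈ F with k - j ∈ latticeCube n L, distLpNorm p (u k) :=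
        (Finset.sum_filter_of_ne hnear).symm
    _ ≤ ∑ k ∈ (latticeCube n L).map (addLeftEmbedding j), distLpNorm p (u k) := by
        refine Finset.sum_le_sum_of_subset fun k hk => ?_
        rw [Finset.mem_filter] at hk
        exact Finset.mem_map.2 ⟨k - j, hk.2, add_sub_cancel j k⟩
    _ = ∑ l ∈ latticeCube n L, distLpNorm p (u (j + l)) := Finset.sum_map _ _ _
    _ ≤ _ := by
        rw [Finset.mul_sum]
        exact Finset.sum_le_sum fun l _ => hterm (j + l)

theorem IsPartitionWindow.exists_modulationNorm_packetSum_le (hφ : IsPartitionWindow φ)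
    (hp : 1 ≤ p) (hq : 1 ≤ q) (s : ℝ) :
    ∃ C : ℝ≥0, ∀ b : 𝓢(E n, ℂ), (∀ x, b x ≠ 0 → ‖x‖ ≤ 1) →
      ∀ ξ F (a : (Fin n → ℤ) → ℝ≥0), (∀ k ∈ F, ‖ξ k - latticePoint k‖ ≤ 1) →
      modulationNorm φ s p q (packetSum b ξ F a) ≤
        C * packetNorm p b * ellNorm q (weighted s fun k => a k) := by
  obtain ⟨L, C, -, hbox⟩ := hφ.exists_distLpNorm_box_packetSum_le hp
  obtain ⟨D, -, hshift⟩ := exists_ellNorm_weighted_sum_shift_le n L s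
  refine ⟨C.toNNReal * D.toNNReal, fun b hb ξ F a hξ => ?_⟩
  rw [modulationNorm_eq hq]
  calc _ ≤ ENNReal.ofReal C * packetNorm p b *
        ellNorm q (weighted s fun k => ∑ l ∈ latticeCube n L, (a (k + l) : ℝ≥0∞)) := by
        refine ellNorm_le_const_mul fun k => ?_
        rw [weighted, weighted, mul_left_comm]
        gcongr
        exact hbox b hb ξ F a hξ k
    _ ≤ ENNReal.ofReal C * packetNorm p b *
        (ENNReal.ofReal D * ellNorm q (weighted s fun k => a k)) := by
        gcongr
        exact hshift q hq fun k => (a k : ℝ≥0∞)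
    _ = _ := by
        simp only [ENNReal.coe_mul, ENNReal.ofReal]
        ring

end Packets

/-! ### Bumps and their dilations -/

section Bumps

variable {n : ℕ} {δ R : ℝ} {b : 𝓢(E n, ℂ)}

/-- `b` is nonnegative, not identically zero, and vanishes outside the ball of radius `δ`: the
profiles of the wave packets used as test functions. -/
structure IsBump (δ : ℝ) (b : 𝓢(E n, ℂ)) : Prop where
  norm_le : ∀ x, b x ≠ 0 → ‖x‖ ≤ δ
  eq_norm : ∀ x, b x = ‖b x‖
  ne_zero : b ≠ 0

theorem exists_isBump (hδ : 0 < δ) : ∃ b : 𝓢(E n, ℂ), IsBump δ b := by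
  let f : ContDiffBump (0 : E n) := ⟨δ / 2, δ, by linarith, by linarith⟩
  have hcs : HasCompactSupport fun x => (f x : ℂ) :=
    f.hasCompactSupport.comp_left (g := fun t : ℝ => (t : ℂ)) Complex.ofReal_zero
  let b : 𝓢(E n, ℂ) := hcs.toSchwartzMap (Complex.ofRealCLM.contDiff.comp f.contDiff)
  have hb (x : E n) : b x = (f x : ℂ) := rfl
  refine ⟨b, fun x hx => ?_, fun x => ?_, fun h => ?_⟩
  · rw [hb, Ne, Complex.ofReal_eq_zero, ← Ne, ← Function.mem_support, f.support_eq] at hx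
    exact (mem_ball_zero_iff.1 hx).le
  · rw [hb, Complex.norm_of_nonneg f.nonneg]
  · have h₀ := hb 0
    rw [h, f.one_of_mem_closedBall (Metric.mem_closedBall_self f.rIn_pos.le)] at h₀
    simp at h₀

/-- The square of the `L^2` norm of `w ↦ b (2πw)`, which is that of every wave packet with
profile `b`. -/
def packetEnergy (b : 𝓢(E n, ℂ)) : ℝ := ∫ w, ‖dilateTwoPi n b w‖ ^ 2

theorem integrable_norm_sq (f : 𝓢(E n, ℂ)) : Integrable fun w => ‖f w‖ ^ 2 :=
  (f.memLp 2 volume).integrable_norm_pow two_ne_zero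

theorem packetEnergy_pos (hb : b ≠ 0) : 0 < packetEnergy b := by
  obtain ⟨x, hx⟩ := DFunLike.ne_iff.1 hb
  refine integral_pos_of_integrable_nonneg_nonzero (x := (2 * Real.pi)⁻¹ • x)
    ((dilateTwoPi n b).continuous.norm.pow 2) (integrable_norm_sq _) (fun w => by positivity) ?_
  rw [dilateTwoPi_apply, smul_inv_smul₀ two_pi_ne_zero]
  simpa using hx

/-- The dilation `x ↦ b (R x)`. -/
def dilateBump (hR : R ≠ 0) (b : 𝓢(E n, ℂ)) : 𝓢(E n, ℂ) :=
  compCLMOfContinuousLinearEquiv ℂ (dilation (E n) hR) b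

theorem dilateBump_apply (hR : R ≠ 0) (b : 𝓢(E n, ℂ)) (x : E n) :
    dilateBump hR b x = b (R • x) := rfl

theorem IsBump.dilateBump (hb : IsBump δ b) (hR : 1 ≤ R) :
    IsBump δ (dilateBump (zero_lt_one.trans_le hR).ne' b) where
  norm_le x hx := by
    rw [dilateBump_apply] at hx
    refine le_trans ?_ (hb.norm_le _ hx)
    rw [norm_smul, Real.norm_of_nonneg (by linarith)]
    exact le_mul_of_one_le_left (norm_nonneg x) hR
  eq_norm x := hb.eq_norm _
  ne_zero h := by
    obtain ⟨x, hx⟩ := DFunLike.ne_iff.1 hb.ne_zero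
    refine hx ?_
    rw [← smul_inv_smul₀ (zero_lt_one.trans_le hR).ne' x, ← dilateBump_apply (by positivity), h]
    rfl

theorem packetEnergy_dilateBump (hR : 0 < R) (b : 𝓢(E n, ℂ)) :
    packetEnergy (dilateBump hR.ne' b) = (R ^ n)⁻¹ * packetEnergy b := by
  have h := Measure.integral_comp_smul_of_nonneg volume
    (fun w => ‖dilateTwoPi n b w‖ ^ 2) R (hR := hR.le)
  rw [finrank_euclideanSpace_fin, smul_eq_mul] at h
  rw [packetEnergy, packetEnergy, ← h]
  simp only [dilateTwoPi_apply, dilateBump_apply, smul_comm R]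

theorem fourier_dilateTwoPi_dilateBump_apply (hR : 0 < R) (b : 𝓢(E n, ℂ)) (x : E n) :
    (𝓕 (dilateTwoPi n (dilateBump hR.ne' b)) : 𝓢(E n, ℂ)) x =
      ((R ^ n)⁻¹ : ℝ) • (𝓕 (dilateTwoPi n b) : 𝓢(E n, ℂ)) (R⁻¹ • x) := by
  rw [fourier_coe, fourier_coe, Real.fourier_eq', Real.fourier_eq']
  have h := Measure.integral_comp_smul_of_nonneg volume (fun w : E n =>
    Complex.exp (↑(-2 * Real.pi * inner ℝ w (R⁻¹ • x)) * Complex.I) • dilateTwoPi n b w) R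
    (hR := hR.le)
  rw [finrank_euclideanSpace_fin] at h
  rw [← h]
  simp only [dilateTwoPi_apply, dilateBump_apply, smul_comm R (2 * Real.pi),
    real_inner_smul_left, real_inner_smul_right, inv_mul_cancel_left₀ hR.ne']

theorem eLpNorm_comp_inv_smul (g : 𝓢(E n, ℂ)) (p : ℝ≥0∞) (hR : 0 < R) :
    eLpNorm (fun x => g (R⁻¹ • x)) p volume =
      ENNReal.ofReal (R ^ (n * p⁻¹.toReal)) * eLpNorm g p volume := by
  have hmeas : AEMeasurable (fun x : E n => R⁻¹ • x) volume := by fun_prop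
  have hRn : 0 < R ^ n := by positivity
  rw [show (fun x => g (R⁻¹ • x)) = g ∘ fun x : E n => R⁻¹ • x from rfl,
    ← eLpNorm_map_measure g.continuous.aestronglyMeasurable hmeas,
    Measure.map_addHaar_smul _ (inv_ne_zero hR.ne'), finrank_euclideanSpace_fin, inv_pow, inv_inv,
    abs_of_pos hRn, eLpNorm_smul_measure_of_ne_zero (by simpa using hRn), smul_eq_mul, one_div,
    ENNReal.ofReal_rpow_of_pos hRn, ← Real.rpow_natCast, ← Real.rpow_mul hR.le]

theorem packetNorm_dilateBump (p : ℝ≥0∞) (hR : 0 < R) (b : 𝓢(E n, ℂ)) :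
    packetNorm p (dilateBump hR.ne' b) =
      ENNReal.ofReal (R ^ (n * p⁻¹.toReal - n)) * packetNorm p b := by
  rw [packetNorm, packetNorm, funext (fourier_dilateTwoPi_dilateBump_apply hR b)]
  refine (eLpNorm_const_smul ((R ^ n)⁻¹ : ℝ) (fun x => 𝓕 (dilateTwoPi n b) (R⁻¹ • x)) p
    volume).trans ?_
  rw [eLpNorm_comp_inv_smul _ p hR, ← mul_assoc, ← ofReal_norm,
    Real.norm_of_nonneg (by positivity), ← ENNReal.ofReal_mul (by positivity), sub_eq_neg_add,
    Real.rpow_add hR, Real.rpow_neg hR.le, Real.rpow_natCast]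

/-- The factor with which the profile `b` enters the necessary conditions for boundedness from
`L^p₁` to `L^p₂`: it comes from an upper bound for wave packets in `L^p₁`, and from a lower bound
for their images in `L^p₂` obtained by testing these against the packets themselves. -/
def packetConstant (p₁ p₂ : ℝ≥0∞) (b : 𝓢(E n, ℂ)) : ℝ≥0∞ :=
  (ENNReal.ofReal (packetEnergy b))⁻¹ * packetNorm p₂.conjExponent b * packetNorm p₁ b

theorem packetConstant_ne_top (p₁ p₂ : ℝ≥0∞) (hb : b ≠ 0) : packetConstant p₁ p₂ b ≠ ⊤ :=
  ENNReal.mul_ne_top (ENNReal.mul_ne_top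
    (ENNReal.inv_ne_top.2 (ENNReal.ofReal_pos.2 (packetEnergy_pos hb)).ne')
    (packetNorm_ne_top _ b)) (packetNorm_ne_top _ b)

theorem toReal_inv_conjExponent {p : ℝ≥0∞} (hp : 1 ≤ p) :
    p.conjExponent⁻¹.toReal = 1 - p⁻¹.toReal := by
  have := ENNReal.HolderConjugate.conjExponent hp
  rw [← ENNReal.toReal_one, ← ENNReal.toReal_sub_of_le (ENNReal.inv_le_one.2 hp) ENNReal.one_ne_top,
    ENNReal.HolderConjugate.one_sub_inv p p.conjExponent]

theorem packetConstant_dilateBump (p₁ : ℝ≥0∞) {p₂ : ℝ≥0∞} (hp₂ : 1 ≤ p₂) (hR : 0 < R)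
    (b : 𝓢(E n, ℂ)) :
    packetConstant p₁ p₂ (dilateBump hR.ne' b) =
      ENNReal.ofReal (R ^ (n * (p₁⁻¹.toReal - p₂⁻¹.toReal))) * packetConstant p₁ p₂ b := by
  have hexp : R ^ (n * (p₁⁻¹.toReal - p₂⁻¹.toReal)) =
      R ^ n * R ^ (n * p₂.conjExponent⁻¹.toReal - n) * R ^ (n * p₁⁻¹.toReal - n) := by
    rw [← Real.rpow_natCast, ← Real.rpow_add hR, ← Real.rpow_add hR, toReal_inv_conjExponent hp₂]
    ring_nf
  have hinv : (ENNReal.ofReal ((R ^ n)⁻¹))⁻¹ = ENNReal.ofReal (R ^ n) := by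
    rw [ENNReal.ofReal_inv_of_pos (by positivity), inv_inv]
  rw [packetConstant, packetEnergy_dilateBump, packetNorm_dilateBump, packetNorm_dilateBump,
    ENNReal.ofReal_mul (by positivity), ENNReal.mul_inv, hinv, hexp,
    ENNReal.ofReal_mul (by positivity), ENNReal.ofReal_mul (by positivity), packetConstant]
  · ring
  all_goals simp [hR]

end Bumps

/-! ### Lower bounds for images of wave packets -/

section LowerBound

variable {n : ℕ} {φ M : E n → ℂ} {p q : ℝ≥0∞} {b : 𝓢(E n, ℂ)} {σ c δ : ℝ}

/-- The points of `F` are nonzero and at distance at least `5` from each other, so that wave packets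
whose frequencies lie within unit distance of `F` have disjoint Fourier supports. -/
structure IsSparse (F : Finset (Fin n → ℤ)) : Prop where
  norm_ge : ∀ k ∈ F, 1 ≤ ‖latticePoint k‖
  separated : ∀ k ∈ F, ∀ k' ∈ F, k' ≠ k → 5 ≤ ‖latticePoint k - latticePoint k'‖

theorem symbolOperator_packetSum_apply (hM : M.HasTemperateGrowth) {r : ℝ}
    (hb : ∀ x, b x ≠ 0 → ‖x‖ ≤ r) {ξ : (Fin n → ℤ) → E n} {F : Finset (Fin n → ℤ)}
    {k : Fin n → ℤ} (hk : k ∈ F) (hξ : ∀ k' ∈ F, k' ≠ k → r + r < ‖ξ k' - ξ k‖)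
    (a : (Fin n → ℤ) → ℝ≥0) :
    symbolOperator M (packetSum b ξ F a) (𝓕 (packet b (ξ k))) =
      (a k : ℝ) * ∫ w, M ((2 * Real.pi) • w) * packet b (ξ k) w ^ 2 := by
  have happly (k' : Fin n → ℤ) :
      symbolOperator M (packetDistribution b (ξ k')) (𝓕 (packet b (ξ k))) =
        ∫ w, M ((2 * Real.pi) • w) * (packet b (ξ k') w * packet b (ξ k) w) := by
    rw [symbolOperator, fourierMultiplierCLM_packetDistribution_apply
      (hasTemperateGrowth_comp_smul hM two_pi_ne_zero), FourierTransform.fourierInv_fourier_eq]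
    simp only [mul_left_comm]
  rw [map_packetSum, _root_.sum_apply, Finset.sum_eq_single k]
  · simp_rw [pow_two]
    rw [← happly]
    rfl
  · intro k' hk' hne
    refine mul_eq_zero_of_right _ ((happly k').trans ?_)
    simp_rw [packet_mul_packet_eq_zero hb (hξ k' hk' hne), mul_zero, integral_zero]
  · exact fun h => absurd hk h

theorem integral_norm_packet_sq (b : 𝓢(E n, ℂ)) (ξ : E n) :
    ∫ w, ‖packet b ξ w‖ ^ 2 = packetEnergy b :=
  integral_sub_right_eq_self (fun w => ‖dilateTwoPi n b w‖ ^ 2) ((2 * Real.pi)⁻¹ • ξ)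

theorem IsBump.packet_sq (hb : IsBump δ b) (ξ w : E n) :
    packet b ξ w ^ 2 = ((‖packet b ξ w‖ ^ 2 : ℝ) : ℂ) := by
  rw [packet_apply, hb.eq_norm, Complex.norm_real, norm_norm, Complex.ofReal_pow]

theorem IsBump.integral_packet_sq (hb : IsBump δ b) (ξ : E n) :
    ∫ w, packet b ξ w ^ 2 = packetEnergy b := by
  simp_rw [hb.packet_sq, integral_complex_ofReal, integral_norm_packet_sq]

theorem IsProbe.norm_sub_mul_packet_sq_le {κ ξ : E n} (hξ : IsProbe M σ c δ κ ξ)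
    (hb : ∀ x, b x ≠ 0 → ‖x‖ ≤ δ) (w : E n) :
    ‖(M ((2 * Real.pi) • w) - M ξ) * packet b ξ w ^ 2‖ ≤ ‖M ξ‖ / 2 * ‖packet b ξ w‖ ^ 2 := by
  rw [norm_mul, norm_pow]
  rcases eq_or_ne (packet b ξ w) 0 with h | h
  · simp [h]
  · rw [packet_apply] at h
    gcongr
    exact hξ.norm_image_sub_le _ (hb _ h)

theorem IsProbe.le_norm_integral_mul_packet_sq {κ ξ : E n} (hξ : IsProbe M σ c δ κ ξ)
    (hM : Continuous M) (hb : IsBump δ b) :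
    ‖M ξ‖ / 2 * packetEnergy b ≤ ‖∫ w, M ((2 * Real.pi) • w) * packet b ξ w ^ 2‖ := by
  have hbound := hξ.norm_sub_mul_packet_sq_le hb.norm_le
  have hint := integrable_norm_sq (packet b ξ)
  have herror : Integrable fun w => (M ((2 * Real.pi) • w) - M ξ) * packet b ξ w ^ 2 := by
    refine (hint.const_mul _).mono' ?_ (.of_forall hbound)
    have := (packet b ξ).continuous
    exact Continuous.aestronglyMeasurable (by fun_prop)
  have hmain : Integrable fun w => M ξ * packet b ξ w ^ 2 := by
    simp_rw [hb.packet_sq]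
    exact hint.ofReal.const_mul _
  have hsplit : ∫ w, M ((2 * Real.pi) • w) * packet b ξ w ^ 2 =
      M ξ * packetEnergy b + ∫ w, (M ((2 * Real.pi) • w) - M ξ) * packet b ξ w ^ 2 := by
    rw [← hb.integral_packet_sq ξ, ← integral_const_mul, ← integral_add hmain herror]
    simp only [sub_mul, add_sub_cancel]
  have herror_le : ‖∫ w, (M ((2 * Real.pi) • w) - M ξ) * packet b ξ w ^ 2‖ ≤
      ‖M ξ‖ / 2 * packetEnergy b := by
    rw [← integral_norm_packet_sq b ξ, ← integral_const_mul]
    exact norm_integral_le_of_norm_le (hint.const_mul _) (.of_forall hbound)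
  have htri := norm_sub_le_norm_add (M ξ * (packetEnergy b : ℂ))
    (∫ w, (M ((2 * Real.pi) • w) - M ξ) * packet b ξ w ^ 2)
  rw [norm_mul, Complex.norm_of_nonneg (packetEnergy_pos hb.ne_zero).le, ← hsplit] at htri
  linarith

theorem IsPartitionWindow.apply_fourier_packet_eq_sum (hφ : IsPartitionWindow φ) {R : ℝ}
    (hR : ∀ ξ, φ ξ ≠ 0 → ‖ξ‖ ≤ R) {L : ℕ} (hL : R + 2 ≤ L) (hb : ∀ x, b x ≠ 0 → ‖x‖ ≤ 1) {ξ : E n}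
    {k : Fin n → ℤ} (hξ : ‖ξ - latticePoint k‖ ≤ 1) (u : 𝓢'(E n, ℂ)) :
    u (𝓕 (packet b ξ)) = ∑ l ∈ latticeCube n L, box φ (k + l) u (𝓕 (packet b ξ)) := by
  have hbox (l : Fin n → ℤ) : box φ (k + l) u (𝓕 (packet b ξ)) =
      u (FourierTransform.fourierCLM ℂ 𝓢(E n, ℂ) (smulLeftCLM ℂ
        (fun w : E n => φ ((2 * Real.pi) • w - latticePoint (k + l))) (packet b ξ))) := by
    rw [box, TemperedDistribution.fourierMultiplierCLM_apply_apply,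
      FourierTransform.fourierInv_fourier_eq]
    rfl
  simp_rw [hbox]
  rw [← map_sum, ← map_sum]
  suffices h : ∑ l ∈ latticeCube n L, smulLeftCLM ℂ
      (fun w : E n => φ ((2 * Real.pi) • w - latticePoint (k + l))) (packet b ξ) = packet b ξ by
    rw [h]
    rfl
  ext w
  rw [_root_.sum_apply]
  simp_rw [smulLeftCLM_apply_apply (hφ.hasTemperateGrowth _), smul_eq_mul]
  rw [← Finset.sum_mul]
  rcases eq_or_ne (packet b ξ w) 0 with h | h
  · rw [h, mul_zero]
  · rw [hφ.sum_eq_one hR hL, one_mul]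
    rw [packet_apply] at h
    have := norm_add_le ((2 * Real.pi) • w - ξ) (ξ - latticePoint k)
    rw [sub_add_sub_cancel] at this
    linarith [hb _ h]

theorem IsPartitionWindow.le_sum_distLpNorm_box (hφ : IsPartitionWindow φ) {R : ℝ}
    (hR : ∀ ξ, φ ξ ≠ 0 → ‖ξ‖ ≤ R) {L : ℕ} (hL : R + 2 ≤ L) (hM : M.HasTemperateGrowth) (hp : 1 ≤ p)
    (hδ : δ ≤ 1) (hb : IsBump δ b) {ξ : (Fin n → ℤ) → E n} {F : Finset (Fin n → ℤ)}
    (hF : IsSparse F) (hξ : ∀ k ∈ F, IsProbe M σ c δ (latticePoint k) (ξ k))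
    (a : (Fin n → ℤ) → ℝ≥0) {k : Fin n → ℤ} (hk : k ∈ F) :
    ENNReal.ofReal (c * bracket k ^ σ / 2 * packetEnergy b) * a k ≤
      packetNorm p.conjExponent b * ∑ l ∈ latticeCube n L,
        distLpNorm p (box φ (k + l) (symbolOperator M (packetSum b ξ F a))) := by
  have hb₁ (x : E n) (hx : b x ≠ 0) : ‖x‖ ≤ 1 := (hb.norm_le x hx).trans hδ
  have hsep : ∀ k' ∈ F, k' ≠ k → (1 : ℝ) + 1 < ‖ξ k' - ξ k‖ := by
    intro k' hk' hne
    have hkk' := hF.separated k' hk' k hk hne.symm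
    have htri := norm_sub_le_norm_sub_add_norm_sub (latticePoint k') (ξ k') (latticePoint k)
    have htri' := norm_sub_le_norm_sub_add_norm_sub (ξ k') (ξ k) (latticePoint k)
    rw [norm_sub_rev _ (ξ k')] at htri
    linarith [(hξ k hk).norm_sub_le, (hξ k' hk').norm_sub_le]
  set u := symbolOperator M (packetSum b ξ F a)
  set g : 𝓢(E n, ℂ) := 𝓕 (packet b (ξ k))
  have henergy := packetEnergy_pos hb.ne_zero
  calc ENNReal.ofReal (c * bracket k ^ σ / 2 * packetEnergy b) * a k
      ≤ ENNReal.ofReal (‖M (ξ k)‖ / 2 * packetEnergy b) * a k := by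
        gcongr
        exact (hξ k hk).le_norm
    _ ≤ ENNReal.ofReal ‖∫ w, M ((2 * Real.pi) • w) * packet b (ξ k) w ^ 2‖ * a k := by
        gcongr
        exact (hξ k hk).le_norm_integral_mul_packet_sq hM.1.continuous hb
    _ = ‖u g‖ₑ := by
        rw [symbolOperator_packetSum_apply hM hb₁ hk hsep, enorm_mul, ofReal_norm, mul_comm,
          enorm_ofReal_coe]
    _ = ‖∑ l ∈ latticeCube n L, box φ (k + l) u g‖ₑ := by
        rw [hφ.apply_fourier_packet_eq_sum hR hL hb₁ (hξ k hk).norm_sub_le]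
    _ ≤ ∑ l ∈ latticeCube n L, ‖box φ (k + l) u g‖ₑ := enorm_sum_le _ _
    _ ≤ ∑ l ∈ latticeCube n L, packetNorm p.conjExponent b * distLpNorm p (box φ (k + l) u) := by
        refine Finset.sum_le_sum fun l _ => ?_
        rw [mul_comm, ← eLpNorm_fourier_packet _ b (ξ k)]
        exact enorm_apply_le_distLpNorm hp _ g
    _ = _ := (Finset.mul_sum _ _ _).symm

theorem IsPartitionWindow.exists_le_modulationNorm_symbolOperator_packetSum
    (hφ : IsPartitionWindow φ) (hM : M.HasTemperateGrowth) (hp : 1 ≤ p) (hq : 1 ≤ q) (s : ℝ)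
    (σ : ℝ) (hc : 0 < c) (hδ : δ ≤ 1) :
    ∃ C : ℝ≥0, ∀ b : 𝓢(E n, ℂ), IsBump δ b → ∀ F, IsSparse F →
      ∀ ξ, (∀ k ∈ F, IsProbe M σ c δ (latticePoint k) (ξ k)) →
      ∀ a : (Fin n → ℤ) → ℝ≥0, (∀ k ∉ F, a k = 0) →
      ellNorm q (weighted (s + σ) fun k => a k) ≤
        C * ((ENNReal.ofReal (packetEnergy b))⁻¹ * packetNorm p.conjExponent b) *
          modulationNorm φ s p q (symbolOperator M (packetSum b ξ F a)) := by
  obtain ⟨R, -, hR⟩ := hφ.exists_radius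
  obtain ⟨L, hL⟩ := exists_nat_ge (R + 2)
  obtain ⟨D, -, hshift⟩ := exists_ellNorm_weighted_sum_shift_le n L s
  refine ⟨(c / 2)⁻¹.toNNReal * D.toNNReal, fun b hb F hF ξ hξ a ha => ?_⟩
  have henergy := packetEnergy_pos hb.ne_zero
  set u := symbolOperator M (packetSum b ξ F a)
  set v : (Fin n → ℤ) → ℝ≥0∞ := fun k => distLpNorm p (box φ k u)
  have hlow : ∀ k ∈ F, ENNReal.ofReal (bracket k ^ σ) * a k ≤ ENNReal.ofReal (c / 2)⁻¹ *
      (ENNReal.ofReal (packetEnergy b))⁻¹ * packetNorm p.conjExponent b *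
        ∑ l ∈ latticeCube n L, v (k + l) := by
    intro k hk
    have hcancel : bracket k ^ σ =
        (c / 2)⁻¹ * (packetEnergy b)⁻¹ * (c * bracket k ^ σ / 2 * packetEnergy b) := by field_simp
    rw [mul_assoc _ (packetNorm _ _), hcancel, ENNReal.ofReal_mul (by positivity),
      ENNReal.ofReal_mul (by positivity), ENNReal.ofReal_inv_of_pos henergy,
      mul_assoc _ _ (a k : ℝ≥0∞)]
    exact mul_le_mul_right (hφ.le_sum_distLpNorm_box hR hL hM hp hδ hb hF hξ a hk) _
  have hweighted (k : Fin n → ℤ) : weighted (s + σ) (fun k => (a k : ℝ≥0∞)) k ≤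
      ENNReal.ofReal (c / 2)⁻¹ * (ENNReal.ofReal (packetEnergy b))⁻¹ *
        packetNorm p.conjExponent b *
          weighted s (fun k => ∑ l ∈ latticeCube n L, v (k + l)) k := by
    by_cases hk : k ∈ F
    · rw [← weighted_weighted, weighted, weighted, weighted, mul_left_comm (_ * _)]
      exact mul_le_mul_right (hlow k hk) _
    · rw [weighted, ha k hk, ENNReal.coe_zero, mul_zero]
      exact zero_le
  rw [modulationNorm_eq hq]
  refine ((ellNorm_le_const_mul hweighted).trans (mul_le_mul_right (hshift q hq v) _)).trans_eq ?_
  simp only [ENNReal.coe_mul, ENNReal.ofReal]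
  ring

end LowerBound

/-! ### Divergence of lattice sums -/

section Divergence

variable {n : ℕ}

theorem bracket_le_of_abs_le {L : ℕ} (hn : 1 ≤ n) (hL : 1 ≤ L) {m : Fin n → ℤ}
    (hm : ∀ i, |(m i : ℝ)| ≤ 2 * L) : bracket m ≤ (1 + 2 * n) * L := by
  have hn' : (1 : ℝ) ≤ n := by exact_mod_cast hn
  have hL' : (1 : ℝ) ≤ L := by exact_mod_cast hL
  have hnorm : ‖latticePoint m‖ ^ 2 ≤ n * (2 * L) ^ 2 := by
    rw [EuclideanSpace.norm_sq_eq]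
    calc ∑ i, ‖latticePoint m i‖ ^ 2 ≤ ∑ _i : Fin n, (2 * (L : ℝ)) ^ 2 := by
          refine Finset.sum_le_sum fun i _ => ?_
          gcongr
          exact hm i
      _ = _ := by simp
  rw [bracket, Real.sqrt_le_left (by positivity)]
  nlinarith [mul_nonneg (sub_nonneg.2 hn') (sq_nonneg (L : ℝ)), mul_self_nonneg ((L : ℝ) - 1)]

/-- The dyadic box of integer vectors with all coordinates in `{L + 1, …, 2L}`. -/
def dyadicBox (n L : ℕ) : Finset (Fin n → ℤ) :=
  Fintype.piFinset fun _ => Finset.Icc (L + 1 : ℤ) (2 * L)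

theorem mem_dyadicBox {L : ℕ} {m : Fin n → ℤ} :
    m ∈ dyadicBox n L ↔ ∀ i, L + 1 ≤ m i ∧ m i ≤ 2 * L := by
  simp [dyadicBox, Fintype.mem_piFinset]

theorem card_dyadicBox (n L : ℕ) : (dyadicBox n L).card = L ^ n := by
  rw [dyadicBox, Fintype.card_piFinset_const, Int.card_Icc]
  congr 1
  omega

theorem inv_pow_le_sum_dyadicBox {L : ℕ} (hn : 1 ≤ n) (hL : 1 ≤ L) :
    ((1 + 2 * n : ℝ) ^ n)⁻¹ ≤ ∑ m ∈ dyadicBox n L, bracket m ^ (-(n : ℝ)) := by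
  have : (0 : ℝ) < L := by exact_mod_cast hL
  calc ((1 + 2 * n : ℝ) ^ n)⁻¹ = ∑ _m ∈ dyadicBox n L, (((1 + 2 * n : ℝ) * L) ^ n)⁻¹ := by
        rw [Finset.sum_const, card_dyadicBox, nsmul_eq_mul, mul_pow]
        push_cast
        field_simp
    _ ≤ _ := by
        refine Finset.sum_le_sum fun m hm => ?_
        have hpos := bracket_pos m
        rw [Real.rpow_neg hpos.le, Real.rpow_natCast]
        gcongr
        refine bracket_le_of_abs_le hn hL fun i => ?_
        have hmi := mem_dyadicBox.1 hm i
        rw [← Int.cast_abs, abs_of_nonneg (by omega)]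
        exact_mod_cast hmi.2

theorem lt_of_summable_bracket_rpow (hn : 1 ≤ n) {t : ℝ}
    (h : Summable fun m : Fin n → ℤ => bracket m ^ (-t)) : (n : ℝ) < t := by
  by_contra! ht
  have hsum : Summable fun m : Fin n → ℤ => bracket m ^ (-(n : ℝ)) :=
    h.of_nonneg_of_le (fun m => (bracket_rpow_pos m _).le) fun m =>
      Real.rpow_le_rpow_of_exponent_le (one_le_bracket m) (by linarith)
  have hε : 0 < ((1 + 2 * n : ℝ) ^ n)⁻¹ := by positivity
  obtain ⟨s, hs⟩ := summable_iff_vanishing_norm.1 hsum _ hε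
  obtain ⟨B, hB⟩ := s.bddAbove
  let i₀ : Fin n := ⟨0, hn⟩
  have hdisj : Disjoint (dyadicBox n ((B i₀).toNat + 1)) s := by
    refine Finset.disjoint_left.2 fun m hm hms => ?_
    have hlow := (mem_dyadicBox.1 hm i₀).1
    have hup : m i₀ ≤ B i₀ := hB hms i₀
    omega
  have hsmall := hs _ hdisj
  rw [Real.norm_of_nonneg (Finset.sum_nonneg fun m _ => (bracket_rpow_pos m _).le)] at hsmall
  exact hsmall.not_ge (inv_pow_le_sum_dyadicBox hn (Nat.le_add_left _ _))

end Divergence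

/-! ### Sequence space inequalities on sparse sets -/

section Sparse

variable {n : ℕ} {q q₁ q₂ : ℝ≥0∞}

theorem isSparse_singleton {k : Fin n → ℤ} (hk : 1 ≤ ‖latticePoint k‖) : IsSparse {k} where
  norm_ge k' hk' := by rwa [Finset.mem_singleton.1 hk']
  separated k' hk' k'' hk'' h :=
    absurd ((Finset.mem_singleton.1 hk'').trans (Finset.mem_singleton.1 hk').symm) h

theorem latticePoint_zsmul (c : ℤ) (m : Fin n → ℤ) :
    latticePoint (c • m) = (c : ℝ) • latticePoint m := by
  ext i
  simp [latticePoint]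

theorem one_le_norm_latticePoint {m : Fin n → ℤ} (hm : m ≠ 0) : 1 ≤ ‖latticePoint m‖ := by
  obtain ⟨i, hi⟩ := Function.ne_iff.1 hm
  refine le_trans ?_ (PiLp.norm_apply_le (latticePoint m) i)
  simp only [latticePoint, Real.norm_eq_abs]
  exact_mod_cast Int.one_le_abs hi

theorem five_le_norm_latticePoint_five_zsmul {m : Fin n → ℤ} (hm : m ≠ 0) :
    5 ≤ ‖latticePoint ((5 : ℤ) • m)‖ := by
  rw [latticePoint_zsmul, norm_smul]
  norm_num
  linarith [one_le_norm_latticePoint hm]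

theorem isSparse_image_five_zsmul {G : Finset (Fin n → ℤ)} (hG : 0 ∉ G) :
    IsSparse (G.image fun m => (5 : ℤ) • m) := by
  refine ⟨Finset.forall_mem_image.2 fun m hm => ?_, Finset.forall_mem_image.2 fun m _ =>
    Finset.forall_mem_image.2 fun m' _ hne => ?_⟩
  · have := five_le_norm_latticePoint_five_zsmul (ne_of_mem_of_not_mem hm hG)
    linarith
  · rw [← latticePoint_sub, ← smul_sub]
    refine five_le_norm_latticePoint_five_zsmul (sub_ne_zero.2 ?_)
    rintro rfl
    exact hne rfl

theorem bracket_rpow_le_mul_bracket_zsmul_rpow {c : ℤ} (hc : 1 ≤ c) (m : Fin n → ℤ) (x : ℝ) :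
    bracket m ^ x ≤ (c : ℝ) ^ |x| * bracket (c • m) ^ x := by
  have hc' : (1 : ℝ) ≤ c := by exact_mod_cast hc
  have hm := bracket_pos m
  have hcm := bracket_pos (c • m)
  have hnorm : ‖latticePoint (c • m)‖ = c * ‖latticePoint m‖ := by
    rw [latticePoint_zsmul, norm_smul, Real.norm_of_nonneg (by linarith)]
  rcases le_total 0 x with hx | hx
  · refine (Real.rpow_le_rpow hm.le ?_ hx).trans
      (le_mul_of_one_le_left (by positivity) (Real.one_le_rpow hc' (abs_nonneg x)))
    rw [bracket, bracket, hnorm]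
    gcongr
    exact le_mul_of_one_le_left (norm_nonneg _) hc'
  · have hle : bracket (c • m) ≤ c * bracket m := by
      rw [bracket, bracket, hnorm, Real.sqrt_le_left (by positivity), mul_pow, mul_pow,
        Real.sq_sqrt (by positivity)]
      nlinarith
    calc bracket m ^ x = (c : ℝ) ^ |x| * (c * bracket m) ^ x := by
          rw [Real.mul_rpow (by linarith) hm.le, ← mul_assoc, ← Real.rpow_add (by linarith),
            abs_of_nonpos hx, neg_add_cancel, Real.rpow_zero, one_mul]
      _ ≤ (c : ℝ) ^ |x| * bracket (c • m) ^ x := by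
          gcongr ?_ * ?_
          exact Real.rpow_le_rpow_of_nonpos hcm hle hx

theorem summable_bracket_rpow_of_isSparse {x B : ℝ}
    (h : ∀ F : Finset (Fin n → ℤ), IsSparse F → ∑ k ∈ F, bracket k ^ x ≤ B) :
    Summable fun m : Fin n → ℤ => bracket m ^ x := by
  classical
  refine summable_of_sum_le (c := bracket (0 : Fin n → ℤ) ^ x + 5 ^ |x| * B)
    (fun m => (bracket_rpow_pos m x).le) fun G => ?_
  calc ∑ m ∈ G, bracket m ^ x ≤ ∑ m ∈ insert 0 (G.erase 0), bracket m ^ x :=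
        Finset.sum_le_sum_of_subset_of_nonneg (Finset.insert_erase_subset 0 G)
          fun m _ _ => (bracket_rpow_pos m x).le
    _ = bracket (0 : Fin n → ℤ) ^ x + ∑ m ∈ G.erase 0, bracket m ^ x :=
        Finset.sum_insert (Finset.notMem_erase 0 G)
    _ ≤ bracket (0 : Fin n → ℤ) ^ x +
          ∑ m ∈ G.erase 0, 5 ^ |x| * bracket ((5 : ℤ) • m) ^ x := by
        gcongr with m
        exact_mod_cast bracket_rpow_le_mul_bracket_zsmul_rpow (by norm_num : (1 : ℤ) ≤ 5) m x
    _ ≤ bracket (0 : Fin n → ℤ) ^ x + 5 ^ |x| * B := by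
        rw [← Finset.mul_sum, ← Finset.sum_image (g := fun m : Fin n → ℤ => (5 : ℤ) • m)
          (f := fun k => bracket k ^ x) (smul_right_injective _ (by norm_num)).injOn]
        gcongr
        exact h _ (isSparse_image_five_zsmul (Finset.notMem_erase 0 G))

/-- The sequence `⟨k⟩^x` restricted to `F`: the coefficients of the test functions. -/
def truncatedPower (F : Finset (Fin n → ℤ)) (x : ℝ) : (Fin n → ℤ) → ℝ≥0 :=
  (F : Set (Fin n → ℤ)).indicator fun k => (bracket k ^ x).toNNReal

variable {F : Finset (Fin n → ℤ)} {k : Fin n → ℤ} {x s t : ℝ}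

theorem truncatedPower_of_notMem (hk : k ∉ F) : truncatedPower F x k = 0 :=
  Set.indicator_of_notMem (by simpa using hk) _

theorem coe_truncatedPower_of_mem (hk : k ∈ F) :
    (truncatedPower F x k : ℝ≥0∞) = ENNReal.ofReal (bracket k ^ x) := by
  rw [truncatedPower, Set.indicator_of_mem (by simpa using hk)]
  rfl

theorem weighted_truncatedPower (s x : ℝ) (F : Finset (Fin n → ℤ)) :
    weighted s (fun k => truncatedPower F x k) =
      fun k => (truncatedPower F (s + x) k : ℝ≥0∞) := by
  ext k
  rw [weighted]
  by_cases hk : k ∈ F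
  · rw [coe_truncatedPower_of_mem hk, coe_truncatedPower_of_mem hk, Real.rpow_add (bracket_pos k),
      ENNReal.ofReal_mul (bracket_rpow_pos k s).le]
  · rw [truncatedPower_of_notMem hk, truncatedPower_of_notMem hk, ENNReal.coe_zero, mul_zero]

theorem ellNorm_truncatedPower (h0 : q ≠ 0) (h : q ≠ ⊤) (F : Finset (Fin n → ℤ)) (x : ℝ) :
    ellNorm q (fun k => truncatedPower F (x * q⁻¹.toReal) k) =
      (∑ k ∈ F, ENNReal.ofReal (bracket k ^ x)) ^ q⁻¹.toReal := by
  have hpos : 0 < q.toReal := ENNReal.toReal_pos h0 h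
  rw [ellNorm_of_ne_top h0 h, ENNReal.toReal_inv, one_div, tsum_eq_sum (s := F) fun k hk => by
    rw [truncatedPower_of_notMem hk, ENNReal.coe_zero, ENNReal.zero_rpow_of_pos hpos]]
  congr 1
  refine Finset.sum_congr rfl fun k hk => ?_
  rw [coe_truncatedPower_of_mem hk, ENNReal.ofReal_rpow_of_pos (bracket_rpow_pos k _),
    ← Real.rpow_mul (bracket_pos k).le, inv_mul_cancel_right₀ hpos.ne']

theorem ellNorm_truncatedPower_le (h0 : q ≠ 0) (F : Finset (Fin n → ℤ)) (x : ℝ) :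
    ellNorm q (fun k => truncatedPower F (x * q⁻¹.toReal) k) ≤
      (∑ k ∈ F, ENNReal.ofReal (bracket k ^ x)) ^ q⁻¹.toReal := by
  rcases eq_or_ne q ⊤ with rfl | hq
  · rw [ellNorm_top]
    refine iSup_le fun k => ?_
    by_cases hk : k ∈ F
    · simp [coe_truncatedPower_of_mem hk]
    · simp [truncatedPower_of_notMem hk]
  · exact (ellNorm_truncatedPower h0 hq F x).le

theorem ofReal_bracket_rpow_le_of_ellNorm_weighted_le (hq₁ : q₁ ≠ 0) (hq₂ : q₂ ≠ 0) {K : ℝ≥0∞}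
    (h : ∀ a : (Fin n → ℤ) → ℝ≥0, (∀ j ∉ ({k} : Finset (Fin n → ℤ)), a j = 0) →
      ellNorm q₂ (weighted t fun k => a k) ≤ K * ellNorm q₁ (weighted s fun k => a k)) :
    ENNReal.ofReal (bracket k ^ (t - s)) ≤ K := by
  have hone : ellNorm q₁ (weighted s fun j => truncatedPower {k} (-s) j) ≤ 1 := by
    have := ellNorm_truncatedPower_le hq₁ {k} 0
    rwa [zero_mul, Finset.sum_singleton, Real.rpow_zero, ENNReal.ofReal_one, ENNReal.one_rpow,
      ← add_neg_cancel s, ← weighted_truncatedPower] at this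
  calc ENNReal.ofReal (bracket k ^ (t - s))
      = weighted t (fun j => (truncatedPower {k} (-s) j : ℝ≥0∞)) k := by
        rw [sub_eq_add_neg, ← coe_truncatedPower_of_mem (Finset.mem_singleton_self k)]
        exact (congrFun (weighted_truncatedPower t (-s) {k}) k).symm
    _ ≤ ellNorm q₂ (weighted t fun j => truncatedPower {k} (-s) j) := apply_le_ellNorm hq₂ _ k
    _ ≤ K * ellNorm q₁ (weighted s fun j => truncatedPower {k} (-s) j) :=
        h _ fun j hj => truncatedPower_of_notMem hj
    _ ≤ K := mul_le_of_le_one_right zero_le hone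

theorem sum_bracket_rpow_le_of_ellNorm_weighted_le (hq₂ : q₂ ≠ 0) (hq : q₂ < q₁) {K : ℝ≥0∞}
    (h : ∀ a : (Fin n → ℤ) → ℝ≥0, (∀ k ∉ F, a k = 0) →
      ellNorm q₂ (weighted t fun k => a k) ≤ K * ellNorm q₁ (weighted s fun k => a k)) :
    ∑ k ∈ F, ENNReal.ofReal (bracket k ^ (-((s - t) * (gapExponent q₁ q₂).toReal))) ≤
      K ^ (gapExponent q₁ q₂).toReal := by
  set r := (gapExponent q₁ q₂).toReal
  have hr : 0 < r := gapExponent_toReal_pos hq₂ hq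
  have hrinv : r⁻¹ = q₂⁻¹.toReal - q₁⁻¹.toReal := inv_toReal_gapExponent hq₂ hq.le
  set S := ∑ k ∈ F, ENNReal.ofReal (bracket k ^ (-((s - t) * r)))
  have hS : S ≠ ⊤ := ENNReal.sum_ne_top.2 fun k _ => ENNReal.ofReal_ne_top
  rcases eq_or_ne S 0 with h0 | h0
  · rw [h0]
    exact zero_le
  -- With this power of the bracket the two norms are `S^(1/q₂)` and `S^(1/q₁)`.
  have htest := h (truncatedPower F (-s + -((s - t) * r) * q₁⁻¹.toReal))
    fun k hk => truncatedPower_of_notMem hk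
  have hexp₂ : t + (-s + -((s - t) * r) * q₁⁻¹.toReal) = -((s - t) * r) * q₂⁻¹.toReal := by
    have : q₂⁻¹.toReal = r⁻¹ + q₁⁻¹.toReal := by rw [hrinv, sub_add_cancel]
    rw [this]
    field_simp
    ring
  rw [weighted_truncatedPower, weighted_truncatedPower, add_neg_cancel_left, hexp₂,
    ellNorm_truncatedPower hq₂ hq.ne_top] at htest
  have hpow : S ^ q₂⁻¹.toReal ≤ K * S ^ q₁⁻¹.toReal :=
    htest.trans (mul_le_mul_right (ellNorm_truncatedPower_le (ne_bot_of_gt hq) F _) K)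
  have hroot : S ^ r⁻¹ ≤ K := by
    rw [hrinv, ENNReal.rpow_sub _ _ h0 hS]
    exact ENNReal.div_le_of_le_mul hpow
  rwa [ENNReal.rpow_inv_le_iff hr] at hroot

end Sparse

/-! ### Necessary conditions -/

section Necessity

variable {n : ℕ} {φ M : E n → ℂ} {p₁ p₂ q₁ q₂ : ℝ≥0∞} {s₁ s₂ σ : ℝ}

theorem ellNorm_ne_top_of_finite {q : ℝ≥0∞} (hq : 1 ≤ q) {F : Finset (Fin n → ℤ)}
    {a : (Fin n → ℤ) → ℝ≥0∞} (ha : ∀ k, a k ≠ ⊤) (hF : ∀ k ∉ F, a k = 0) : ellNorm q a ≠ ⊤ := by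
  refine ne_top_of_le_ne_top ?_ (ellNorm_antitone one_ne_zero hq a)
  rw [ellNorm_of_ne_top one_ne_zero ENNReal.one_ne_top]
  simp only [ENNReal.toReal_one, ENNReal.rpow_one, div_one]
  rw [tsum_eq_sum fun k hk => hF k hk]
  exact ENNReal.sum_ne_top.2 fun k _ => ha k

theorem ellNorm_weighted_ne_top_of_finite {q : ℝ≥0∞} (hq : 1 ≤ q) (s : ℝ)
    {F : Finset (Fin n → ℤ)} {a : (Fin n → ℤ) → ℝ≥0} (ha : ∀ k ∉ F, a k = 0) :
    ellNorm q (weighted s fun k => a k) ≠ ⊤ :=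
  ellNorm_ne_top_of_finite hq (F := F)
    (fun k => ENNReal.mul_ne_top ENNReal.ofReal_ne_top ENNReal.coe_ne_top)
    fun k hk => by rw [weighted, ha k hk, ENNReal.coe_zero, mul_zero]

theorem IsExactSymbol.exists_ellNorm_weighted_le_packetConstant (hM : IsExactSymbol σ M)
    (hφ : IsPartitionWindow φ) (hp₁ : 1 ≤ p₁) (hp₂ : 1 ≤ p₂) (hq₁ : 1 ≤ q₁) (hq₂ : 1 ≤ q₂)
    (h : IsBoundedOnModulation φ s₁ p₁ q₁ s₂ p₂ q₂ (symbolOperator M)) :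
    ∃ (δ : ℝ) (C : ℝ≥0), 0 < δ ∧ ∀ b : 𝓢(E n, ℂ), IsBump δ b → ∀ F, IsSparse F →
      ∀ a : (Fin n → ℤ) → ℝ≥0, (∀ k ∉ F, a k = 0) →
      ellNorm q₂ (weighted (s₂ + σ) fun k => a k) ≤
        C * packetConstant p₁ p₂ b * ellNorm q₁ (weighted s₁ fun k => a k) := by
  obtain ⟨C, hC⟩ := h
  obtain ⟨c, δ, hc, hδ, hδ₁, hprobe⟩ := hM.exists_isProbe
  obtain ⟨C₁, hup⟩ := hφ.exists_modulationNorm_packetSum_le hp₁ hq₁ s₁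
  obtain ⟨C₂, hlow⟩ := hφ.exists_le_modulationNorm_symbolOperator_packetSum
    hM.hasTemperateGrowth hp₂ hq₂ s₂ σ hc hδ₁
  refine ⟨δ, C₂ * C * C₁, hδ, fun b hb F hF a ha => ?_⟩
  have hprobe' (k : Fin n → ℤ) :
      ∃ ξ, 1 ≤ ‖latticePoint k‖ → IsProbe M σ c δ (latticePoint k) ξ := by
    by_cases hk : 1 ≤ ‖latticePoint k‖
    · exact (hprobe _ hk).imp fun ξ hξ _ => hξ
    · exact ⟨0, fun h => absurd h hk⟩
  choose ξ hξ using hprobe'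
  have hξF : ∀ k ∈ F, IsProbe M σ c δ (latticePoint k) (ξ k) := fun k hk => hξ k (hF.norm_ge k hk)
  have hnorm := hup b (fun x hx => (hb.norm_le x hx).trans hδ₁) ξ F a
    fun k hk => (hξF k hk).norm_sub_le
  have hmem : packetSum b ξ F a ∈ modulationSpace φ s₁ p₁ q₁ :=
    hnorm.trans_lt (ENNReal.mul_lt_top
      (ENNReal.mul_lt_top ENNReal.coe_lt_top (packetNorm_ne_top p₁ b).lt_top)
      (ellNorm_weighted_ne_top_of_finite hq₁ s₁ ha).lt_top)
  refine ((hlow b hb F hF ξ hξF a ha).trans (mul_le_mul_right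
    ((hC _ hmem).2.trans (mul_le_mul_right hnorm _)) _)).trans_eq ?_
  simp only [ENNReal.coe_mul, packetConstant]
  ring

theorem IsExactSymbol.exists_ellNorm_weighted_le (hM : IsExactSymbol σ M)
    (hφ : IsPartitionWindow φ) (hp₁ : 1 ≤ p₁) (hp₂ : 1 ≤ p₂) (hq₁ : 1 ≤ q₁) (hq₂ : 1 ≤ q₂)
    (h : IsBoundedOnModulation φ s₁ p₁ q₁ s₂ p₂ q₂ (symbolOperator M)) :
    ∃ K : ℝ≥0∞, K ≠ ⊤ ∧ ∀ F : Finset (Fin n → ℤ), IsSparse F →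
      ∀ a : (Fin n → ℤ) → ℝ≥0, (∀ k ∉ F, a k = 0) →
      ellNorm q₂ (weighted (s₂ + σ) fun k => a k) ≤ K * ellNorm q₁ (weighted s₁ fun k => a k) := by
  obtain ⟨δ, C, hδ, hbound⟩ := hM.exists_ellNorm_weighted_le_packetConstant hφ hp₁ hp₂ hq₁ hq₂ h
  obtain ⟨b, hb⟩ := exists_isBump (n := n) hδ
  exact ⟨C * packetConstant p₁ p₂ b,
    ENNReal.mul_ne_top ENNReal.coe_ne_top (packetConstant_ne_top p₁ p₂ hb.ne_zero), hbound b hb⟩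

/-- The integer vector `(m, 0, …, 0)`. -/
def axisPoint (hn : 1 ≤ n) (m : ℤ) : Fin n → ℤ := Pi.single ⟨0, hn⟩ m

theorem norm_latticePoint_axisPoint (hn : 1 ≤ n) (m : ℤ) :
    ‖latticePoint (axisPoint hn m)‖ = |(m : ℝ)| := by
  have : latticePoint (axisPoint hn m) = EuclideanSpace.single ⟨0, hn⟩ (m : ℝ) := by
    ext i
    by_cases hi : i = ⟨0, hn⟩
    · subst hi; simp [latticePoint, axisPoint]
    · simp [latticePoint, axisPoint, hi]
  rw [this, PiLp.norm_single, Real.norm_eq_abs]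

theorem IsExactSymbol.exponent_le (hn : 1 ≤ n) (hM : IsExactSymbol σ M)
    (hφ : IsPartitionWindow φ) (hp₁ : 1 ≤ p₁) (hp₂ : 1 ≤ p₂) (hq₁ : 1 ≤ q₁) (hq₂ : 1 ≤ q₂)
    (h : IsBoundedOnModulation φ s₁ p₁ q₁ s₂ p₂ q₂ (symbolOperator M)) : p₁ ≤ p₂ := by
  obtain ⟨δ, C, hδ, hbound⟩ := hM.exists_ellNorm_weighted_le_packetConstant hφ hp₁ hp₂ hq₁ hq₂ h
  obtain ⟨b, hb⟩ := exists_isBump (n := n) hδ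
  by_contra! hlt
  have hneg : n * (p₁⁻¹.toReal - p₂⁻¹.toReal) < 0 := by
    refine mul_neg_of_pos_of_neg (by exact_mod_cast hn) (sub_neg.2 ?_)
    exact (ENNReal.toReal_lt_toReal (ENNReal.inv_ne_top.2 (one_pos.trans_le hp₁).ne')
      (ENNReal.inv_ne_top.2 (one_pos.trans_le hp₂).ne')).2 (ENNReal.inv_lt_inv.2 hlt)
  have hsparse : IsSparse {axisPoint hn 1} :=
    isSparse_singleton (by rw [norm_latticePoint_axisPoint]; simp)
  -- Dilated bumps are still bumps, but their packet constant tends to zero if `p₂ < p₁`.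
  have hconst (R : ℝ) (hR : 1 ≤ R) :
      ENNReal.ofReal (bracket (axisPoint hn 1) ^ (s₂ + σ - s₁)) ≤
        C * packetConstant p₁ p₂ b * ENNReal.ofReal (R ^ (n * (p₁⁻¹.toReal - p₂⁻¹.toReal))) := by
    refine (ofReal_bracket_rpow_le_of_ellNorm_weighted_le (one_pos.trans_le hq₁).ne'
      (one_pos.trans_le hq₂).ne' (hbound _ (hb.dilateBump hR) _ hsparse)).trans_eq ?_
    rw [packetConstant_dilateBump p₁ hp₂ (one_pos.trans_le hR)]
    ring
  have hlim : Filter.Tendsto (fun R : ℝ => C * packetConstant p₁ p₂ b *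
      ENNReal.ofReal (R ^ (n * (p₁⁻¹.toReal - p₂⁻¹.toReal)))) Filter.atTop (nhds 0) := by
    have hrpow := ENNReal.tendsto_ofReal (tendsto_rpow_neg_atTop (neg_pos.2 hneg))
    simpa using ENNReal.Tendsto.const_mul hrpow (Or.inr (ENNReal.mul_ne_top
      (ENNReal.coe_ne_top (r := C)) (packetConstant_ne_top p₁ p₂ hb.ne_zero)))
  refine (ge_of_tendsto hlim ((Filter.eventually_ge_atTop 1).mono hconst)).not_gt ?_
  exact ENNReal.ofReal_pos.2 (bracket_rpow_pos _ _)

theorem IsExactSymbol.smoothness_le (hn : 1 ≤ n) (hM : IsExactSymbol σ M)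
    (hφ : IsPartitionWindow φ) (hp₁ : 1 ≤ p₁) (hp₂ : 1 ≤ p₂) (hq₁ : 1 ≤ q₁) (hq₂ : 1 ≤ q₂)
    (h : IsBoundedOnModulation φ s₁ p₁ q₁ s₂ p₂ q₂ (symbolOperator M)) : s₂ + σ ≤ s₁ := by
  obtain ⟨K, hK, hseq⟩ := hM.exists_ellNorm_weighted_le hφ hp₁ hp₂ hq₁ hq₂ h
  by_contra! hlt
  have hbound (m : ℕ) (hm : 1 ≤ m) : ENNReal.ofReal ((m : ℝ) ^ (s₂ + σ - s₁)) ≤ K := by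
    have hnorm : ‖latticePoint (axisPoint hn m)‖ = m := by rw [norm_latticePoint_axisPoint]; simp
    have hsparse : IsSparse {axisPoint hn m} :=
      isSparse_singleton (by rw [hnorm]; exact_mod_cast hm)
    refine le_trans ?_ (ofReal_bracket_rpow_le_of_ellNorm_weighted_le (one_pos.trans_le hq₁).ne'
      (one_pos.trans_le hq₂).ne' (hseq _ hsparse))
    gcongr
    exact hnorm.ge.trans (norm_le_japaneseBracket _)
  have hlim := ENNReal.tendsto_ofReal_atTop.comp
    ((tendsto_rpow_atTop (sub_pos.2 hlt)).comp tendsto_natCast_atTop_atTop)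
  exact hK (top_le_iff.1 (le_of_tendsto hlim ((Filter.eventually_ge_atTop 1).mono hbound)))

theorem IsExactSymbol.gap_lt (hn : 1 ≤ n) (hM : IsExactSymbol σ M)
    (hφ : IsPartitionWindow φ) (hp₁ : 1 ≤ p₁) (hp₂ : 1 ≤ p₂) (hq₂ : 1 ≤ q₂) (hq : q₂ < q₁)
    (h : IsBoundedOnModulation φ s₁ p₁ q₁ s₂ p₂ q₂ (symbolOperator M)) :
    s₂ + σ + n * q₂⁻¹.toReal < s₁ + n * q₁⁻¹.toReal := by
  have hq₂' : q₂ ≠ 0 := (one_pos.trans_le hq₂).ne'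
  obtain ⟨K, hK, hseq⟩ := hM.exists_ellNorm_weighted_le hφ hp₁ hp₂ (hq₂.trans hq.le) hq₂ h
  set r := (gapExponent q₁ q₂).toReal
  have hr : 0 < r := gapExponent_toReal_pos hq₂' hq
  have hsum : Summable fun m : Fin n → ℤ => bracket m ^ (-((s₁ - (s₂ + σ)) * r)) := by
    refine summable_bracket_rpow_of_isSparse (B := (K ^ r).toReal) fun F hF => ?_
    have hsumF := sum_bracket_rpow_le_of_ellNorm_weighted_le hq₂' hq (hseq F hF)
    rwa [← ENNReal.ofReal_sum_of_nonneg fun m _ => (bracket_rpow_pos m _).le,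
      ENNReal.ofReal_le_iff_le_toReal (ENNReal.rpow_ne_top_of_nonneg hr.le hK)] at hsumF
  have hlt := lt_of_summable_bracket_rpow hn hsum
  rw [← div_lt_iff₀ hr, div_eq_mul_inv, inv_toReal_gapExponent hq₂' hq.le] at hlt
  linarith

end Necessity

end SphericalModulation

end

theorem theorem1p1_general {n : ℕ} (hn : 1 ≤ n) {φ M : SphericalModulation.E n → ℂ}
    (hφ : SphericalModulation.IsPartitionWindow φ) {σ : ℝ}
    (hM : SphericalModulation.IsExactSymbol σ M) {p₁ p₂ q₁ q₂ : ℝ≥0∞} (hp₁ : 1 ≤ p₁)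
    (hp₂ : 1 ≤ p₂) (hq₁ : 1 ≤ q₁) (hq₂ : 1 ≤ q₂) (s₁ s₂ : ℝ) :
    (q₁ ≤ q₂ →
      (SphericalModulation.IsBoundedOnModulation φ s₁ p₁ q₁ s₂ p₂ q₂
          (SphericalModulation.symbolOperator M) ↔
        p₁ ≤ p₂ ∧ s₁ ≥ s₂ + σ)) ∧
    (q₁ > q₂ →
      (SphericalModulation.IsBoundedOnModulation φ s₁ p₁ q₁ s₂ p₂ q₂
          (SphericalModulation.symbolOperator M) ↔
        p₁ ≤ p₂ ∧ s₁ + n * (q₁⁻¹).toReal > s₂ + σ + n * (q₂⁻¹).toReal)) := by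
  refine ⟨fun hq => ⟨fun h => ⟨?_, ?_⟩, fun ⟨hp, hs⟩ => ?_⟩,
    fun hq => ⟨fun h => ⟨?_, ?_⟩, fun ⟨hp, hs⟩ => ?_⟩⟩
  · exact hM.exponent_le hn hφ hp₁ hp₂ hq₁ hq₂ h
  · exact hM.smoothness_le hn hφ hp₁ hp₂ hq₁ hq₂ h
  · exact SphericalModulation.isBoundedOnModulation_symbolOperator_of_le hφ hM.toIsSymbol hp₁ hp
      hq₁ hq hs
  · exact hM.exponent_le hn hφ hp₁ hp₂ hq₁ hq₂ h
  · exact hM.gap_lt hn hφ hp₁ hp₂ hq₂ hq h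
  · exact SphericalModulation.isBoundedOnModulation_symbolOperator_of_gap hφ hM.toIsSymbol hp₁ hp
      hq₂ hq hs

theorem theorem1p1 (n N : ℕ) (hn : 2 ≤ n) (hN : 1 ≤ N)
    (φ : SphericalModulation.E n → ℂ) (hφ : SphericalModulation.IsPartitionWindow φ)
    (p₁ p₂ q₁ q₂ : ℝ≥0∞) (hp₁ : 1 ≤ p₁) (hp₂ : 1 ≤ p₂) (hq₁ : 1 ≤ q₁) (hq₂ : 1 ≤ q₂)
    (s₁ s₂ σ : ℝ) (hσ : σ = 2 - ((n : ℝ) - 1) / 2 * N) :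
    (q₁ ≤ q₂ →
      (SphericalModulation.IsBoundedOnModulation φ s₁ p₁ q₁ s₂ p₂ q₂
          (SphericalModulation.laplacianIteratedAverage n N) ↔
        p₁ ≤ p₂ ∧ s₁ ≥ s₂ + σ)) ∧
    (q₁ > q₂ →
      (SphericalModulation.IsBoundedOnModulation φ s₁ p₁ q₁ s₂ p₂ q₂
          (SphericalModulation.laplacianIteratedAverage n N) ↔
        p₁ ≤ p₂ ∧ s₁ + n * (q₁⁻¹).toReal > s₂ + σ + n * (q₂⁻¹).toReal)) := by
  rw [SphericalModulation.laplacianIteratedAverage_eq_symbolOperator (by omega) N]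
  exact theorem1p1_general (by omega) hφ (hσ ▸ SphericalModulation.isExactSymbol_averageSymbol
    (by omega) N) hp₁ hp₂ hq₁ hq₂ s₁ s₂
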